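/- **Setting.** Let $\Theta\subset\mathbb R^d$ be compact and convex with $\theta_0\in\operatorname{int}\Theta$. Let $\rho:\mathbb R^d\to[0,\infty)$ be convex with $\rho(u)=0$ iff $u=0$, $\rho(h)\le 1+|h|^p$ for some $p\ge1$, and such that $\xi\mapsto\int\rho(u-\xi)e^{-u'au}du$ has a unique minimizer for every positive definite $a$; put $\rho_n(u)=\rho(\sqrt n u)$. Let $\pi$ be a continuous probability density on $\Theta$, bounded below by a positive constant. Let $m_i(\theta)\in\mathbb R^q$ ($i\ge1$, $\theta\in\Theta$) be random vectors with finite mean on a probability space $(\Omega,\mathcal F,P)$, such that for each $\theta\in\Theta$ the sequence $(m_i(\theta))_i$ is stationary and ergodic. $P^*$, $P_*$ are outer and inner probability; $\to_p$, $o_p$, $O_p$, $\to_d$ are understood with respect to $P^*$. Let $$g_n(\theta)=\tfrac1n\sum_{i=1}^n m_i(\theta),\qquad L_n(\theta)=-\tfrac n2\, g_n(\theta)'W_n(\theta)g_n(\theta),$$ with $W_n(\theta)$ random $q\times q$ matrices and $\theta\mapsto L_n(\theta)$ measurable. Assume: (i) $E m_i(\theta)=0$ iff $\theta=\theta_0$;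 $\sup_{\theta\in\Theta}|W_n(\theta)-W(\theta)|\to_p0$; $W(\theta)$ is positive definite and continuous on $\Theta$. (ii) $G(\theta)=\nabla_\theta E m_i(\theta)$ exists and is continuous on $\Theta$; $J(\theta)=G(\theta)'W(\theta)G(\theta)$ is continuous on $\Theta$ and positive definite for $\theta$ near $\theta_0$. (iii) With $\Delta_n=-nG(\theta_0)'W(\theta_0)g_n(\theta_0)$, $\Delta_n/\sqrt n\to_d N(0,S)$ for a positive definite $S$; moreover $\sqrt n\,g_n(\theta_0)=O_p(1)$. (iv) For every $\epsilon>0$ there is $\delta>0$ with $$\limsup_n P^*\Big\{\sup_{\theta,\theta'\in\Theta,\,|\theta-\theta'|\le\delta}\frac{\sqrt n\,|g_n(\theta)-g_n(\theta')-(Eg_n(\theta)-Eg_n(\theta'))|}{1+\sqrt n|\theta-\theta'|}>\epsilon\Big\}<\epsilon .$$ Write $J=J(\theta_0)$, $U_n=J^{-1}\Delta_n/\sqrt n$, $p_n(\theta)=e^{L_n(\theta)}\pi(\theta)/\int_\Theta e^{L_n}\pi$, $p_\infty^*(h)=\sqrt{\det J/(2\pi)^d}\,e^{-h'Jh/2}$,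 and let $q_\alpha$ be the standard normal $\alpha$-quantile. **Conclusions.** (A) (Expansion.) $S^{-1/2}\Delta_n/\sqrt n\to_d N(0,I)$, $J$ and $S$ are positive definite, and the remainder $R_n$ in $L_n(\theta)-L_n(\theta_0)=(\theta-\theta_0)'\Delta_n-\frac n2(\theta-\theta_0)'J(\theta-\theta_0)+R_n(\theta)$ satisfies: for each $\epsilon>0$, for all sufficiently small $\delta>0$ and all sufficiently large $M$, with suprema over $\theta\in\Theta$, $$\limsup_nP^*\Big\{\sup_{M/\sqrt n\le|\theta-\theta_0|\le\delta}\tfrac{|R_n(\theta)|}{n|\theta-\theta_0|^2}>\epsilon\Big\}<\epsilon,\qquad \limsup_nP^*\Big\{\sup_{|\theta-\theta_0|\le M/\sqrt n}|R_n(\theta)|>\epsilon\Big\}=0.$$ (B) (Total variation of moments.) For every $\alpha\ge0$, $\int_{H_n}(1+|h|^\alpha)|p_n^*(h)-p_\infty^*(h)|\,dh\to_p0$, where $H_n=\{\sqrt n(\theta-\theta_0)-U_n:\theta\in\Theta\}$ and $p_n^*(h)=n^{-d/2}p_n(\theta_0+(h+U_n)/\sqrt n)$. (C) (Laplace type estimators.)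 $z\mapsto\int\rho(u-z)p^*_\infty(u)du$ has a unique minimizer $\xi$, which is $0$ if $\rho$ is symmetric; $S^{-1/2}JU_n\to_dN(0,I)$; and every $\hat\theta\in\arg\min_{\zeta\in\Theta}\int_\Theta\rho_n(\theta-\zeta)p_n(\theta)d\theta$ satisfies $\sqrt n(\hat\theta-\theta_0)=\xi+U_n+o_p(1)$ and $S^{-1/2}J(\sqrt n(\hat\theta-\theta_0)-\xi)\to_dN(0,I)$. (D) (Sandwich inference.) Let $\bar\theta=\int_\Theta\theta p_n$ and $\hat J^{-1}=\int_\Theta n(\theta-\bar\theta)(\theta-\bar\theta)'p_n$. Then $\hat JJ^{-1}\to_pI$. If $\hat S S^{-1}\to_pI$, and $g:\Theta\to\mathbb R$ is $C^1$ with $\nabla g(\theta_0)\ne0$, then with $c_n(\alpha)=g(\bar\theta)+q_\alpha\sqrt{\nabla g(\bar\theta)'\hat J^{-1}\hat S\hat J^{-1}\nabla g(\bar\theta)}/\sqrt n$ one has $P_*\{c_n(\alpha/2)\le g(\theta_0)\le c_n(1-\alpha/2)\}\to1-\alpha$ for all $\alpha\in(0,1)$. (E) (Information equality and quantile inference.)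 If $S=G(\theta_0)'W(\theta_0)G(\theta_0)$, then the information equality $JS^{-1}=I$ holds, and for every $C^1$ function $g:\Theta\to\mathbb R$, with $c_{g,n}(\alpha)=\inf\{x:\int_{\{\theta\in\Theta:\,g(\theta)\le x\}}p_n\ge\alpha\}$ and all $\alpha\in(0,1)$: $c_{g,n}(\alpha)-g(\hat\theta)-q_\alpha\sqrt{\nabla g(\theta_0)'J^{-1}\nabla g(\theta_0)}/\sqrt n=o_p(1/\sqrt n)$ for every estimator with $\sqrt n(\hat\theta-\theta_0)=U_n+o_p(1)$; and, if $\nabla g(\theta_0)\neq0$, $P^*\{c_{g,n}(\alpha/2)\le g(\theta_0)\le c_{g,n}(1-\alpha/2)\}\to1-\alpha$. (F) If $W(\theta_0)=V^{-1}$, where $V=\lim_n\operatorname{Var}[\sqrt n g_n(\theta_0)]$ and $\sqrt n g_n(\theta_0)\to_dN(0,V)$, then $S=G(\theta_0)'W(\theta_0)G(\theta_0)$, so the conclusions of (E) hold. -/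

import Mathlib

open MeasureTheory ProbabilityTheory Filter Topology Matrix
open scoped ENNReal MatrixOrder BoundedContinuousFunction

noncomputable section

/-- Euclidean space of dimension `k`, with the Euclidean norm. -/
abbrev Eu (k : ℕ) : Type := EuclideanSpace ℝ (Fin k)

/-- Matrix times column vector, in Euclidean space. -/
def matVec {k l : ℕ} (A : Matrix (Fin k) (Fin l) ℝ) (x : Eu l) : Eu k :=
  WithLp.toLp 2 (A *ᵥ x.ofLp)

/-- The quadratic form `v' A v`. -/
def quadForm {k : ℕ} (A : Matrix (Fin k) (Fin k) ℝ) (v : Eu k) : ℝ :=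
  v.ofLp ⬝ᵥ (A *ᵥ v.ofLp)

/-! ### Stochastic convergence

A measure of Mathlib, applied to an arbitrary set, returns the outer measure of that set. So
`P A` is the outer probability of `A`, and `TendstoInMeasure P` is convergence in outer
probability, with no measurability required. -/

/-- Inner probability. -/
def innerProb {Ω : Type*} [MeasurableSpace Ω] (P : Measure Ω) (A : Set Ω) : ℝ≥0∞ :=
  1 - P Aᶜ

/-- Outer expectation of a bounded function: the infimum of the expectations of its integrable
majorants. -/
def outerExpectation {Ω : Type*} [MeasurableSpace Ω] (P : Measure Ω) (f : Ω → ℝ) : ℝ :=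
  sInf {a : ℝ | ∃ u : Ω → ℝ, Measurable u ∧ Integrable u P ∧ (∀ ω, f ω ≤ u ω) ∧
    a = ∫ ω, u ω ∂P}

/-- Convergence in distribution, with respect to the outer probability, of maps `X n` (not
necessarily measurable) to the law `ν`: the outer expectations of `f (X n)` converge to `∫ f dν`
for every bounded continuous `f`. -/
def TendstoInLaw {Ω : Type*} [MeasurableSpace Ω] (P : Measure Ω) {k : ℕ}
    (X : ℕ → Ω → Eu k) (ν : Measure (Eu k)) : Prop :=
  ∀ f : Eu k →ᵇ ℝ, Tendsto (fun n : ℕ => outerExpectation P fun ω => f (X n ω)) atTop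
    (𝓝 (∫ x, f x ∂ν))

/-- Entrywise convergence in outer probability of random matrices to a constant matrix. -/
def MatTendstoInProb {Ω : Type*} [MeasurableSpace Ω] (P : Measure Ω) {k : ℕ}
    (A : ℕ → Ω → Matrix (Fin k) (Fin k) ℝ) (B : Matrix (Fin k) (Fin k) ℝ) : Prop :=
  ∀ i j, TendstoInMeasure P (fun (n : ℕ) ω => A n ω i j) atTop (fun _ => B i j)

/-- `X n = O_p(1)`. -/
def BoundedInProb {Ω : Type*} [MeasurableSpace Ω] (P : Measure Ω) {k : ℕ}
    (X : ℕ → Ω → Eu k) : Prop :=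
  ∀ ε : ℝ, 0 < ε → ∃ M : ℝ, limsup (fun n : ℕ => P {ω | M < ‖X n ω‖}) atTop ≤ ENNReal.ofReal ε

/-- The sequence `X` of random vectors is stationary and ergodic: its law on the space of
sequences is invariant and ergodic under the shift. -/
structure IsStationaryErgodic {Ω : Type*} [MeasurableSpace Ω] (P : Measure Ω) {k : ℕ}
    (X : ℕ → Ω → Eu k) : Prop where
  measurable : ∀ i, Measurable (X i)
  ergodic : Ergodic (fun (x : ℕ → Eu k) (i : ℕ) => x (i + 1)) (P.map fun ω i => X i ω)

/-- The `α`-quantile of the standard normal distribution. -/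
def stdNormalQuantile (α : ℝ) : ℝ :=
  sInf {x : ℝ | α ≤ cdf (gaussianReal 0 1) x}

/-! ### Parameter space, loss function and prior -/

/-- The true parameter is interior to a compact convex parameter space. -/
structure ParameterAssumption {d : ℕ} (Θ : Set (Eu d)) (θ₀ : Eu d) : Prop where
  compact : IsCompact Θ
  convex : Convex ℝ Θ
  interior : θ₀ ∈ interior Θ

/-- Conditions on the loss `ρ` (the loss at sample size `n` is `u ↦ ρ (√n u)`) and on the
weighting function `prior`. -/
structure PenaltyAssumption {d : ℕ} (Θ : Set (Eu d)) (ρ : Eu d → ℝ) (prior : Eu d → ℝ) :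
    Prop where
  nonneg : ∀ u, 0 ≤ ρ u
  eq_zero_iff : ∀ u, ρ u = 0 ↔ u = 0
  convex : ConvexOn ℝ Set.univ ρ
  growth : ∃ p : ℝ, 1 ≤ p ∧ ∀ h, ρ h ≤ 1 + ‖h‖ ^ p
  unique_min : ∀ a : Matrix (Fin d) (Fin d) ℝ, a.PosDef →
    ∃! ξ : Eu d, ∀ z : Eu d,
      ∫ u, ρ (u - ξ) * Real.exp (-quadForm a u) ≤ ∫ u, ρ (u - z) * Real.exp (-quadForm a u)
  prior_continuous : ContinuousOn prior Θ
  prior_pos : ∃ c : ℝ, 0 < c ∧ ∀ θ ∈ Θ, c ≤ prior θ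
  prior_density : ∫ θ in Θ, prior θ = 1

/-! ### The quadratic expansion of a criterion function

`L n θ ω` is a criterion function, `Δ n ω` the score at `θ₀`, `J n` and `S n` the curvature
matrix and the asymptotic variance of the normalized score. -/

/-- The remainder `R_n(θ)`, defined by
`L_n(θ) - L_n(θ₀) = (θ - θ₀)' Δ_n - (θ - θ₀)' [n J_n] (θ - θ₀) / 2 + R_n(θ)`. -/
def expansionRemainder {Ω : Type*} {d : ℕ} (L : ℕ → Eu d → Ω → ℝ) (θ₀ : Eu d)
    (Δ : ℕ → Ω → Eu d) (J : ℕ → Matrix (Fin d) (Fin d) ℝ) (n : ℕ) (θ : Eu d) (ω : Ω) : ℝ :=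
  L n θ ω - L n θ₀ ω -
    ((θ - θ₀).ofLp ⬝ᵥ (Δ n ω).ofLp - (1 / 2) * quadForm ((n : ℝ) • J n) (θ - θ₀))

/-- Bounded and uniformly positive definite sequence of constant matrices. -/
def UniformlyPosDef {d : ℕ} (A : ℕ → Matrix (Fin d) (Fin d) ℝ) : Prop :=
  (∀ n, (A n).PosDef) ∧ ∃ c C : ℝ, 0 < c ∧ 0 < C ∧
    ∀ n (v : Eu d), c * ‖v‖ ^ 2 ≤ quadForm (A n) v ∧ quadForm (A n) v ≤ C * ‖v‖ ^ 2

/-- The inverse square root of a positive definite matrix. -/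
def invSqrt {d : ℕ} (A : Matrix (Fin d) (Fin d) ℝ) : Matrix (Fin d) (Fin d) ℝ :=
  (CFC.sqrt A)⁻¹

/-- The expansion assumption. An event `sup f > ε` is written as `∃ θ, f θ > ε`. -/
structure ExpansionAssumption {Ω : Type*} [MeasurableSpace Ω] (P : Measure Ω) {d : ℕ}
    (Θ : Set (Eu d)) (θ₀ : Eu d) (L : ℕ → Eu d → Ω → ℝ) (Δ : ℕ → Ω → Eu d)
    (J S : ℕ → Matrix (Fin d) (Fin d) ℝ) : Prop where
  score_normal : TendstoInLaw P
    (fun (n : ℕ) ω => matVec (invSqrt (S n)) ((√(n : ℝ))⁻¹ • Δ n ω)) (stdGaussian (Eu d))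
  J_posDef : UniformlyPosDef J
  S_posDef : UniformlyPosDef S
  remainder : ∀ ε : ℝ, 0 < ε → ∃ δ₀ : ℝ, 0 < δ₀ ∧ ∃ M₀ : ℝ, 0 < M₀ ∧
    ∀ δ : ℝ, 0 < δ → δ ≤ δ₀ → ∀ M : ℝ, M₀ ≤ M →
      limsup (fun n : ℕ => P {ω | ∃ θ ∈ Θ, M / √(n : ℝ) ≤ ‖θ - θ₀‖ ∧ ‖θ - θ₀‖ ≤ δ ∧
        ε < |expansionRemainder L θ₀ Δ J n θ ω| / (n * ‖θ - θ₀‖ ^ 2)}) atTop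
          < ENNReal.ofReal ε ∧
      limsup (fun n : ℕ => P {ω | ∃ θ ∈ Θ, ‖θ - θ₀‖ ≤ M / √(n : ℝ) ∧
        ε < |expansionRemainder L θ₀ Δ J n θ ω|}) atTop = 0

/-- The generalized information equality. -/
def InformationEquality {d : ℕ} (J S : ℕ → Matrix (Fin d) (Fin d) ℝ) : Prop :=
  Tendsto (fun n : ℕ => J n * (S n)⁻¹) atTop (𝓝 1)

/-! ### Quasi-posterior quantities -/

/-- The quasi-posterior density `p_n(θ)`. -/
def quasiPosterior {Ω : Type*} {d : ℕ} (Θ : Set (Eu d)) (L : ℕ → Eu d → Ω → ℝ)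
    (prior : Eu d → ℝ) (n : ℕ) (ω : Ω) (θ : Eu d) : ℝ :=
  Real.exp (L n θ ω) * prior θ / ∫ t in Θ, Real.exp (L n t ω) * prior t

/-- The limit normal density `p*_∞` with mean zero and variance `J⁻¹`. -/
def limitDensity {d : ℕ} (J : Matrix (Fin d) (Fin d) ℝ) (h : Eu d) : ℝ :=
  √(J.det / (2 * Real.pi) ^ d) * Real.exp (-(1 / 2) * quadForm J h)

/-- `U_n = J_n⁻¹ Δ_n / √n`. -/
def centering {Ω : Type*} {d : ℕ} (Δ : ℕ → Ω → Eu d)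
    (J : ℕ → Matrix (Fin d) (Fin d) ℝ) (n : ℕ) (ω : Ω) : Eu d :=
  (√(n : ℝ))⁻¹ • matVec (J n)⁻¹ (Δ n ω)

/-- The quasi-posterior density `p*_n` of `h = √n (θ - θ₀) - U_n`. -/
def localPosterior {Ω : Type*} {d : ℕ} (Θ : Set (Eu d)) (θ₀ : Eu d) (L : ℕ → Eu d → Ω → ℝ)
    (prior : Eu d → ℝ) (Δ : ℕ → Ω → Eu d) (J : ℕ → Matrix (Fin d) (Fin d) ℝ)
    (n : ℕ) (ω : Ω) (h : Eu d) : ℝ :=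
  ((√(n : ℝ))⁻¹) ^ d * quasiPosterior Θ L prior n ω
    (θ₀ + (√(n : ℝ))⁻¹ • (h + centering Δ J n ω))

/-- The range `H_n` of the local parameter `h`. -/
def localRange {Ω : Type*} {d : ℕ} (Θ : Set (Eu d)) (θ₀ : Eu d) (Δ : ℕ → Ω → Eu d)
    (J : ℕ → Matrix (Fin d) (Fin d) ℝ) (n : ℕ) (ω : Ω) : Set (Eu d) :=
  (fun θ => √(n : ℝ) • (θ - θ₀) - centering Δ J n ω) '' Θ

/-- The quasi-posterior risk `Q_n(ζ)`. -/
def quasiRisk {Ω : Type*} {d : ℕ} (Θ : Set (Eu d)) (L : ℕ → Eu d → Ω → ℝ)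
    (prior : Eu d → ℝ) (ρ : Eu d → ℝ) (n : ℕ) (ω : Ω) (ζ : Eu d) : ℝ :=
  ∫ θ in Θ, ρ (√(n : ℝ) • (θ - ζ)) * quasiPosterior Θ L prior n ω θ

/-- A Laplace type estimator: a minimizer over `Θ` of the quasi-posterior risk. -/
def IsLTE {Ω : Type*} {d : ℕ} (Θ : Set (Eu d)) (L : ℕ → Eu d → Ω → ℝ)
    (prior : Eu d → ℝ) (ρ : Eu d → ℝ) (θhat : ℕ → Ω → Eu d) : Prop :=
  ∀ n ω, θhat n ω ∈ Θ ∧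
    ∀ ζ ∈ Θ, quasiRisk Θ L prior ρ n ω (θhat n ω) ≤ quasiRisk Θ L prior ρ n ω ζ

/-- The quasi-posterior distribution function `F_{g,n}` of `g(θ)`. -/
def posteriorCDF {Ω : Type*} {d : ℕ} (Θ : Set (Eu d)) (L : ℕ → Eu d → Ω → ℝ)
    (prior : Eu d → ℝ) (g : Eu d → ℝ) (n : ℕ) (ω : Ω) (x : ℝ) : ℝ :=
  ∫ θ in Θ ∩ {θ | g θ ≤ x}, quasiPosterior Θ L prior n ω θ

/-- The quasi-posterior quantile `c_{g,n}(α)` of `g(θ)`. -/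
def posteriorQuantile {Ω : Type*} {d : ℕ} (Θ : Set (Eu d)) (L : ℕ → Eu d → Ω → ℝ)
    (prior : Eu d → ℝ) (g : Eu d → ℝ) (n : ℕ) (ω : Ω) (α : ℝ) : ℝ :=
  sInf {x : ℝ | α ≤ posteriorCDF Θ L prior g n ω x}

/-- The quasi-posterior mean. -/
def posteriorMean {Ω : Type*} {d : ℕ} (Θ : Set (Eu d)) (L : ℕ → Eu d → Ω → ℝ)
    (prior : Eu d → ℝ) (n : ℕ) (ω : Ω) : Eu d :=
  ∫ θ in Θ, quasiPosterior Θ L prior n ω θ • θ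

/-- `n` times the quasi-posterior variance matrix; this is the estimate of `J_n⁻¹`. -/
def posteriorVar {Ω : Type*} {d : ℕ} (Θ : Set (Eu d)) (L : ℕ → Eu d → Ω → ℝ)
    (prior : Eu d → ℝ) (n : ℕ) (ω : Ω) : Matrix (Fin d) (Fin d) ℝ :=
  Matrix.of fun i j => ∫ θ in Θ, n * (θ i - posteriorMean Θ L prior n ω i) *
    (θ j - posteriorMean Θ L prior n ω j) * quasiPosterior Θ L prior n ω θ

/-! ### The large sample conclusions -/

/-- Convergence of the local quasi-posterior in every total variation of moments norm. -/
def TVMConvergence {Ω : Type*} [MeasurableSpace Ω] (P : Measure Ω) {d : ℕ}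
    (Θ : Set (Eu d)) (θ₀ : Eu d) (L : ℕ → Eu d → Ω → ℝ) (prior : Eu d → ℝ)
    (Δ : ℕ → Ω → Eu d) (J : ℕ → Matrix (Fin d) (Fin d) ℝ) : Prop :=
  ∀ α : ℝ, 0 ≤ α → ∀ ε : ℝ, 0 < ε →
    Tendsto (fun n : ℕ => P {ω | ENNReal.ofReal ε ≤
      ∫⁻ h in localRange Θ θ₀ Δ J n ω, ENNReal.ofReal ((1 + ‖h‖ ^ α) *
        |localPosterior Θ θ₀ L prior Δ J n ω h - limitDensity (J n) h|)}) atTop (𝓝 0)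

/-- Asymptotic behaviour of the Laplace type estimators for the loss `ρ`. The constant `ξ n` is
the unique minimizer of the risk `z ↦ ∫ ρ(u - z) p*_∞(u) du`. -/
def LTEConclusion {Ω : Type*} [MeasurableSpace Ω] (P : Measure Ω) {d : ℕ}
    (Θ : Set (Eu d)) (θ₀ : Eu d) (L : ℕ → Eu d → Ω → ℝ) (prior ρ : Eu d → ℝ)
    (Δ : ℕ → Ω → Eu d) (J S : ℕ → Matrix (Fin d) (Fin d) ℝ) : Prop :=
  ∃ ξ : ℕ → Eu d,
    (∀ n z, (∀ y, ∫ u, ρ (u - z) * limitDensity (J n) u ≤ ∫ u, ρ (u - y) * limitDensity (J n) u)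
      ↔ z = ξ n) ∧
    ((∀ h, ρ (-h) = ρ h) → ∀ n, ξ n = 0) ∧
    TendstoInLaw P (fun (n : ℕ) ω => matVec (invSqrt (S n) * J n) (centering Δ J n ω))
      (stdGaussian (Eu d)) ∧
    ∀ θhat : ℕ → Ω → Eu d, IsLTE Θ L prior ρ θhat →
      TendstoInMeasure P (fun (n : ℕ) ω => √(n : ℝ) • (θhat n ω - θ₀) - (ξ n + centering Δ J n ω))
        atTop (fun _ => 0) ∧
      TendstoInLaw P
        (fun (n : ℕ) ω => matVec (invSqrt (S n) * J n) (√(n : ℝ) • (θhat n ω - θ₀) - ξ n))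
        (stdGaussian (Eu d))

/-- Validity of the quasi-posterior quantile intervals for `g(θ₀)`. Here `θhat` is any estimator
with `√n (θhat - θ₀) = U_n + o_p(1)`. -/
def InferenceI {Ω : Type*} [MeasurableSpace Ω] (P : Measure Ω) {d : ℕ}
    (Θ : Set (Eu d)) (θ₀ : Eu d) (L : ℕ → Eu d → Ω → ℝ) (prior : Eu d → ℝ)
    (Δ : ℕ → Ω → Eu d) (J : ℕ → Matrix (Fin d) (Fin d) ℝ) : Prop :=
  ∀ g : Eu d → ℝ, ContDiffOn ℝ 1 g Θ →
    (∀ θhat : ℕ → Ω → Eu d,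
      TendstoInMeasure P (fun (n : ℕ) ω => √(n : ℝ) • (θhat n ω - θ₀) - centering Δ J n ω)
        atTop (fun _ => 0) →
      ∀ α ∈ Set.Ioo (0 : ℝ) 1,
        TendstoInMeasure P (fun (n : ℕ) ω => √(n : ℝ) *
          (posteriorQuantile Θ L prior g n ω α - g (θhat n ω) -
            stdNormalQuantile α * (√(quadForm (J n)⁻¹ (gradient g θ₀)) / √(n : ℝ))))
          atTop (fun _ => 0)) ∧
    (gradient g θ₀ ≠ 0 → ∀ α ∈ Set.Ioo (0 : ℝ) 1,
      Tendsto (fun n : ℕ => P {ω | posteriorQuantile Θ L prior g n ω (α / 2) ≤ g θ₀ ∧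
        g θ₀ ≤ posteriorQuantile Θ L prior g n ω (1 - α / 2)}) atTop
        (𝓝 (ENNReal.ofReal (1 - α))))

/-- The endpoint `c_{g,n}(α)` of the sandwich interval: quasi-posterior mean, quasi-posterior
variance and an estimate `Shat` of the variance of the score. -/
def sandwichEndpoint {Ω : Type*} {d : ℕ} (Θ : Set (Eu d)) (L : ℕ → Eu d → Ω → ℝ)
    (prior : Eu d → ℝ) (Shat : ℕ → Ω → Matrix (Fin d) (Fin d) ℝ) (g : Eu d → ℝ)
    (n : ℕ) (ω : Ω) (α : ℝ) : ℝ :=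
  g (posteriorMean Θ L prior n ω) + stdNormalQuantile α *
    (√(quadForm (posteriorVar Θ L prior n ω * Shat n ω * posteriorVar Θ L prior n ω)
      (gradient g (posteriorMean Θ L prior n ω))) / √(n : ℝ))

/-- Consistency of the quasi-posterior variance and validity of the sandwich intervals. -/
def InferenceII {Ω : Type*} [MeasurableSpace Ω] (P : Measure Ω) {d : ℕ}
    (Θ : Set (Eu d)) (θ₀ : Eu d) (L : ℕ → Eu d → Ω → ℝ) (prior : Eu d → ℝ)
    (J S : ℕ → Matrix (Fin d) (Fin d) ℝ) : Prop :=
  MatTendstoInProb P (fun (n : ℕ) ω => (posteriorVar Θ L prior n ω)⁻¹ * (J n)⁻¹) 1 ∧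
  ∀ Shat : ℕ → Ω → Matrix (Fin d) (Fin d) ℝ,
    MatTendstoInProb P (fun (n : ℕ) ω => Shat n ω * (S n)⁻¹) 1 →
    ∀ g : Eu d → ℝ, ContDiffOn ℝ 1 g Θ → gradient g θ₀ ≠ 0 →
      ∀ α ∈ Set.Ioo (0 : ℝ) 1,
        Tendsto (fun n : ℕ => innerProb P
          {ω | sandwichEndpoint Θ L prior Shat g n ω (α / 2) ≤ g θ₀ ∧
            g θ₀ ≤ sandwichEndpoint Θ L prior Shat g n ω (1 - α / 2)}) atTop
          (𝓝 (ENNReal.ofReal (1 - α)))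

/-! ### Method of moments -/

/-- The sample moments `g_n(θ)`, the average of the first `n` of the `m_i(θ)`. -/
def sampleMoment {Ω : Type*} {d q : ℕ} (m : ℕ → Eu d → Ω → Eu q) (n : ℕ) (θ : Eu d) (ω : Ω) :
    Eu q :=
  (n : ℝ)⁻¹ • ∑ i ∈ Finset.range n, m i θ ω

/-- The criterion `L_n(θ) = - n g_n(θ)' W_n(θ) g_n(θ) / 2`. -/
def gmmCriterion {Ω : Type*} {d q : ℕ} (m : ℕ → Eu d → Ω → Eu q)
    (Wn : ℕ → Eu d → Ω → Matrix (Fin q) (Fin q) ℝ) (n : ℕ) (θ : Eu d) (ω : Ω) : ℝ :=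
  -(n * quadForm (Wn n θ ω) (sampleMoment m n θ ω)) / 2

/-- The score `Δ_n(θ₀) = - n G(θ₀)' W(θ₀) g_n(θ₀)`. -/
def gmmScore {Ω : Type*} {d q : ℕ} (m : ℕ → Eu d → Ω → Eu q) (W : Eu d → Matrix (Fin q) (Fin q) ℝ)
    (G : Eu d → Matrix (Fin q) (Fin d) ℝ) (θ₀ : Eu d) (n : ℕ) (ω : Ω) : Eu d :=
  -((n : ℝ) • matVec ((G θ₀)ᵀ * W θ₀) (sampleMoment m n θ₀ ω))

/-- `J(θ) = G(θ)' W(θ) G(θ)`. -/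
def gmmJ {d q : ℕ} (W : Eu d → Matrix (Fin q) (Fin q) ℝ) (G : Eu d → Matrix (Fin q) (Fin d) ℝ)
    (θ : Eu d) : Matrix (Fin d) (Fin d) ℝ :=
  (G θ)ᵀ * W θ * G θ

/-- `V` is the long-run variance of the moments at `θ₀`: the limit of the variance matrix of
`√n g_n(θ₀)`. -/
def IsLongRunVariance {Ω : Type*} [MeasurableSpace Ω] (P : Measure Ω) {d q : ℕ}
    (m : ℕ → Eu d → Ω → Eu q) (θ₀ : Eu d) (V : Matrix (Fin q) (Fin q) ℝ) : Prop :=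
  (∀ i, MemLp (m i θ₀) 2 P) ∧
  ∀ a b, Tendsto (fun n : ℕ => cov[fun ω => √(n : ℝ) * sampleMoment m n θ₀ ω a,
    fun ω => √(n : ℝ) * sampleMoment m n θ₀ ω b; P]) atTop (𝓝 (V a b))

end

/-!
The criterion `L_n(θ) = -n g_n(θ)' W_n(θ) g_n(θ) / 2` is locally quadratic, so the quasi-posterior is
asymptotically normal, and estimators and intervals computed from it inherit this.

All stochastic limits are taken along one filter on pairs `(n, ω)`, `highProb`: a property holds
eventually along it when it holds with outer probability tending to one. Convergence in outer
probability to a constant is convergence along this filter, so no measurability is needed and the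
usual calculus of limits applies. Tight sequences enter through `ExhaustsInProb.eventually` and
`ExhaustsInProb.tendsto`: to prove an `o_p` statement one may assume that they are bounded.

The expansion. Stochastic equicontinuity and differentiability of the mean replace `√n g_n(θ)` by
`√n g_n(θ₀) + G √n (θ - θ₀)` up to a small multiple of `1 + √n |θ - θ₀|`, uniformly near `θ₀`
(`MomentModel.linearization`). Inserting this in the quadratic form gives the bounds on the remainder
(`MomentModel.remainder_near`, `MomentModel.remainder_far`). Globally, identification and compactness
give `|E m(θ)| ≥ c |θ - θ₀|`. Chaining the equicontinuity bound along segments of the convex parameter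
space then yields `L_n(θ) - L_n(θ₀) ≤ O_p(1) - c n |θ - θ₀|²` over the whole parameter space
(`MomentModel.exists_exhausts_criterion`).

The quasi-posterior. These two facts, with tightness of `U_n`, make up `QuasiBayes.Regular`. In the
local coordinate `h = √n (θ - θ₀) - U_n` the unnormalized weights converge pointwise to
`π(θ₀) exp (-h' J h / 2)` and, by the global bound, are dominated by a Gaussian function, so dominated
convergence gives convergence in total variation of moments (`QuasiBayes.Regular.tendsto_tvm`).

The consequences. The local risk of a Laplace type estimator is convex and converges uniformly on
compact sets to a limit with a unique minimizer, so minimizers converge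
(`QuasiBayes.Regular.tendsto_lte`). The posterior mean and variance are integrals of polynomials and
converge to the moments of the limit. The posterior distribution function of a smooth `g`, linear in
local coordinates, converges to a normal distribution function, hence so do its quantiles
(`QuasiBayes.Regular.tendsto_posteriorQuantile`). In each case the interval endpoints are
`g(θ₀) + (∇g(θ₀)' U_n + q σ + o_p(1)) / √n`, and the coverage follows from the normality of `U_n`
(`QuasiBayes.Regular.tendsto_coverage`). When the weight is the inverse of the variance of the moments,
comparing the two limits in law of the score identifies `S` with `J`
(`score_variance_eq_curvature`).
-/

/-! ### Convergence in outer probability as convergence along a filter -/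

section HighProb

variable {Ω : Type*} [MeasurableSpace Ω] {P : Measure Ω}

/-- The filter on `ℕ × Ω` of the properties that hold with outer probability approaching one: `A`
belongs to it when `P {ω | (n, ω) ∉ A}` tends to zero. Convergence to zero in outer probability is
convergence along this filter, so `o_p` statements obey the ordinary calculus of limits. -/
def highProb (P : Measure Ω) : Filter (ℕ × Ω) where
  sets := {A | Tendsto (fun n : ℕ => P {ω | (n, ω) ∉ A}) atTop (𝓝 0)}
  univ_sets := by simp
  sets_of_superset := by
    intro A B hA hAB
    refine tendsto_of_tendsto_of_tendsto_of_le_of_le tendsto_const_nhds hA (fun n => zero_le)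
      fun n => measure_mono fun ω h h' => h (hAB h')
  inter_sets := by
    intro A B hA hB
    have h := Tendsto.add hA hB
    rw [add_zero] at h
    refine tendsto_of_tendsto_of_tendsto_of_le_of_le tendsto_const_nhds h (fun n => zero_le)
      fun n => (measure_mono ?_).trans (measure_union_le _ _)
    intro ω hω
    by_contra hc
    simp only [Set.mem_union, Set.mem_ofPred_eq, not_or, not_not] at hc
    exact hω ⟨hc.1, hc.2⟩

lemma eventually_highProb {p : ℕ × Ω → Prop} :
    (∀ᶠ x in highProb P, p x) ↔ Tendsto (fun n : ℕ => P {ω | ¬ p (n, ω)}) atTop (𝓝 0) :=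
  Iff.rfl

lemma tendsto_fst_highProb : Tendsto (Prod.fst : ℕ × Ω → ℕ) (highProb P) atTop := by
  rw [tendsto_atTop]
  intro b
  rw [eventually_highProb]
  refine tendsto_const_nhds.congr' ?_
  filter_upwards [eventually_ge_atTop b] with n hn
  simp [hn]

lemma tendstoInMeasure_iff_highProb {E : Type*} [PseudoEMetricSpace E] {X : ℕ → Ω → E} {c : E} :
    TendstoInMeasure P X atTop (fun _ => c) ↔
      Tendsto (fun x : ℕ × Ω => X x.1 x.2) (highProb P) (𝓝 c) := by
  rw [EMetric.tendsto_nhds]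
  refine forall₂_congr fun ε hε => ?_
  rw [eventually_highProb]
  simp only [not_lt]

/-- A family of sets of pairs `(n, ω)` whose sections have outer probability asymptotically as
close to one as desired. With `G K = {x | ‖X x‖ ≤ K}` this says that `X = O_p(1)`. -/
def ExhaustsInProb (P : Measure Ω) {κ : Type*} (G : κ → Set (ℕ × Ω)) : Prop :=
  ∀ η : ℝ, 0 < η → ∃ k, ∀ᶠ n : ℕ in atTop, P {ω | (n, ω) ∉ G k} ≤ ENNReal.ofReal η

/-- To show that a property holds with probability approaching one, it may be assumed that the
stochastically bounded quantities are bounded by a constant. -/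
lemma ExhaustsInProb.eventually {κ : Type*} {G : κ → Set (ℕ × Ω)} (hG : ExhaustsInProb P G)
    {p : ℕ × Ω → Prop} (h : ∀ k, ∀ᶠ x in highProb P, x ∈ G k → p x) :
    ∀ᶠ x in highProb P, p x := by
  rw [eventually_highProb, ENNReal.tendsto_nhds_zero]
  intro ε hε
  obtain ⟨η, hη, hηε⟩ := ENNReal.lt_iff_exists_nnreal_btwn.1 (ENNReal.half_pos hε.ne')
  obtain ⟨k, hk⟩ := hG η (by exact_mod_cast hη)
  have h2 := (ENNReal.tendsto_nhds_zero.1 (eventually_highProb.1 (h k))) _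
    (ENNReal.half_pos hε.ne')
  filter_upwards [hk, h2] with n hn hn2
  rw [ENNReal.ofReal_coe_nnreal] at hn
  calc P {ω | ¬ p (n, ω)}
      ≤ P ({ω | (n, ω) ∉ G k} ∪ {ω | ¬ ((n, ω) ∈ G k → p (n, ω))}) := by
        refine measure_mono fun ω hω => ?_
        by_cases hc : (n, ω) ∈ G k
        · right
          exact fun h => hω (h hc)
        · exact Or.inl hc
    _ ≤ _ := measure_union_le _ _
    _ ≤ ε / 2 + ε / 2 := add_le_add (hn.trans hηε.le) hn2
    _ = ε := ENNReal.add_halves ε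

lemma ExhaustsInProb.tendsto {κ : Type*} {G : κ → Set (ℕ × Ω)} (hG : ExhaustsInProb P G)
    {E : Type*} [TopologicalSpace E] {X : ℕ × Ω → E} {c : E}
    (h : ∀ k, Tendsto X (highProb P ⊓ 𝓟 (G k)) (𝓝 c)) : Tendsto X (highProb P) (𝓝 c) := by
  intro s hs
  refine hG.eventually fun k => ?_
  have := h k hs
  rwa [mem_map, mem_inf_principal] at this

lemma ExhaustsInProb.inter {κ κ' : Type*} {G : κ → Set (ℕ × Ω)} {G' : κ' → Set (ℕ × Ω)}
    (hG : ExhaustsInProb P G) (hG' : ExhaustsInProb P G') :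
    ExhaustsInProb P fun k : κ × κ' => G k.1 ∩ G' k.2 := by
  intro η hη
  obtain ⟨k, hk⟩ := hG (η / 2) (half_pos hη)
  obtain ⟨k', hk'⟩ := hG' (η / 2) (half_pos hη)
  refine ⟨(k, k'), ?_⟩
  filter_upwards [hk, hk'] with n h1 h2
  calc P {ω | (n, ω) ∉ G k ∩ G' k'}
      ≤ P ({ω | (n, ω) ∉ G k} ∪ {ω | (n, ω) ∉ G' k'}) := by
        refine measure_mono fun ω hω => ?_
        by_contra hc
        simp only [Set.mem_union, Set.mem_ofPred_eq, not_or, not_not] at hc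
        exact hω hc
    _ ≤ _ := measure_union_le _ _
    _ ≤ ENNReal.ofReal (η / 2) + ENNReal.ofReal (η / 2) := add_le_add h1 h2
    _ = ENNReal.ofReal η := by
        rw [← ENNReal.ofReal_add (by positivity) (by positivity), add_halves]

lemma ExhaustsInProb.mono {κ κ' : Type*} {G : κ → Set (ℕ × Ω)} {G' : κ' → Set (ℕ × Ω)}
    (hG : ExhaustsInProb P G) (h : ∀ k, ∃ k', ∀ᶠ x in highProb P, x ∈ G k → x ∈ G' k') :
    ExhaustsInProb P G' := by
  intro η hη
  obtain ⟨k, hk⟩ := hG (η / 2) (half_pos hη)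
  obtain ⟨k', hk'⟩ := h k
  refine ⟨k', ?_⟩
  have h2 := (ENNReal.tendsto_nhds_zero.1 (eventually_highProb.1 hk')) (ENNReal.ofReal (η / 2))
    (by simpa using hη)
  filter_upwards [hk, h2] with n h1 h2
  calc P {ω | (n, ω) ∉ G' k'}
      ≤ P ({ω | (n, ω) ∉ G k} ∪ {ω | ¬ ((n, ω) ∈ G k → (n, ω) ∈ G' k')}) := by
        refine measure_mono fun ω hω => ?_
        by_cases hc : (n, ω) ∈ G k
        · right
          exact fun h => hω (h hc)
        · exact Or.inl hc
    _ ≤ _ := measure_union_le _ _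
    _ ≤ ENNReal.ofReal (η / 2) + ENNReal.ofReal (η / 2) := add_le_add h1 h2
    _ = ENNReal.ofReal η := by
        rw [← ENNReal.ofReal_add (by positivity) (by positivity), add_halves]

lemma BoundedInProb.exhausts {k : ℕ} {X : ℕ → Ω → Eu k} (h : BoundedInProb P X) :
    ExhaustsInProb P fun K : ℝ => {x : ℕ × Ω | ‖X x.1 x.2‖ ≤ K} := by
  intro η hη
  obtain ⟨M, hM⟩ := h (η / 2) (half_pos hη)
  refine ⟨M, ?_⟩
  have : limsup (fun n : ℕ => P {ω | M < ‖X n ω‖}) atTop < ENNReal.ofReal η :=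
    hM.trans_lt ((ENNReal.ofReal_lt_ofReal_iff hη).2 (half_lt_self hη))
  filter_upwards [eventually_lt_of_limsup_lt this] with n hn
  simpa using hn.le

end HighProb

/-! ### Convergence in law with respect to outer expectation -/

section Law

variable {Ω : Type*} [MeasurableSpace Ω] {P : Measure Ω} [IsProbabilityMeasure P]

lemma outerExpectation_le {f u : Ω → ℝ} {B : ℝ} (hf : ∀ ω, |f ω| ≤ B) (hu : Measurable u)
    (hui : Integrable u P) (h : ∀ ω, f ω ≤ u ω) : outerExpectation P f ≤ ∫ ω, u ω ∂P := by
  refine csInf_le ⟨-B, ?_⟩ ⟨u, hu, hui, h, rfl⟩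
  rintro a ⟨v, hv, hvi, hfv, rfl⟩
  have := integral_mono (integrable_const (-B)) hvi
    (fun ω => (neg_le_of_abs_le (hf ω)).trans (hfv ω))
  simpa using this

lemma le_outerExpectation {f v : Ω → ℝ} {B : ℝ} (hf : ∀ ω, |f ω| ≤ B)
    (hvi : Integrable v P) (h : ∀ ω, v ω ≤ f ω) : ∫ ω, v ω ∂P ≤ outerExpectation P f := by
  refine le_csInf ⟨_, fun _ => B, measurable_const, integrable_const _,
    fun ω => le_of_abs_le (hf ω), rfl⟩ ?_
  rintro a ⟨u, hu, hui, hfu, rfl⟩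
  exact integral_mono hvi hui fun ω => (h ω).trans (hfu ω)

lemma outerExpectation_eq_integral {f : Ω → ℝ} {B : ℝ} (hf : ∀ ω, |f ω| ≤ B) (hm : Measurable f) :
    outerExpectation P f = ∫ ω, f ω ∂P := by
  have hi : Integrable f P := Integrable.of_bound hm.aestronglyMeasurable B (ae_of_all _ hf)
  exact le_antisymm (outerExpectation_le hf hm hi fun _ => le_rfl)
    (le_outerExpectation hf hi fun _ => le_rfl)

/-- Uniformly bounded functions that differ by `o_p(1)` have asymptotically the same outer
expectation. -/
lemma tendsto_outerExpectation_sub {F H : ℕ → Ω → ℝ} {B : ℝ} (hF : ∀ n ω, |F n ω| ≤ B)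
    (hH : ∀ n ω, |H n ω| ≤ B) (hHm : ∀ n, Measurable (H n))
    (h : Tendsto (fun x : ℕ × Ω => F x.1 x.2 - H x.1 x.2) (highProb P) (𝓝 0)) :
    Tendsto (fun n => outerExpectation P (F n) - ∫ ω, H n ω ∂P) atTop (𝓝 0) := by
  have hB : 0 ≤ B := by
    obtain ⟨ω⟩ : Nonempty Ω := nonempty_of_isProbabilityMeasure P
    exact (abs_nonneg _).trans (hF 0 ω)
  rw [Metric.tendsto_nhds]
  intro ε hε
  have hbad := eventually_highProb.1 (Metric.tendsto_nhds.1 h (ε / 3) (by positivity))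
  have hbad' := (ENNReal.tendsto_nhds_zero.1 hbad) (ENNReal.ofReal (ε / (3 * (2 * B + 1))))
    (by rw [gt_iff_lt, ENNReal.ofReal_pos]; positivity)
  filter_upwards [hbad'] with n hn
  set T := toMeasurable P {ω | ¬ dist (F n ω - H n ω) 0 < ε / 3}
  have hT : MeasurableSet T := measurableSet_toMeasurable _ _
  have hPT : P.real T ≤ ε / (3 * (2 * B + 1)) := by
    rw [measureReal_def, measure_toMeasurable]
    exact ENNReal.toReal_le_of_le_ofReal (by positivity) hn
  have hHi : Integrable (H n) P :=
    Integrable.of_bound (hHm n).aestronglyMeasurable B (ae_of_all _ (hH n))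
  have hTi : Integrable (T.indicator fun _ => 2 * B) P :=
    (integrable_const _).indicator hT
  have hint : ∫ ω, T.indicator (fun _ => 2 * B) ω ∂P = P.real T * (2 * B) := by
    rw [integral_indicator_const _ hT, smul_eq_mul]
  have key : ∀ ω, |F n ω - H n ω| ≤ ε / 3 + T.indicator (fun _ => 2 * B) ω := by
    intro ω
    by_cases hω : ω ∈ T
    · rw [Set.indicator_of_mem hω]
      have h1 := abs_sub (F n ω) (H n ω)
      linarith [hF n ω, hH n ω]
    · rw [Set.indicator_of_notMem hω]
      have : ¬ ¬ dist (F n ω - H n ω) 0 < ε / 3 := fun hc => hω (subset_toMeasurable _ _ hc)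
      rw [not_not, Real.dist_0_eq_abs] at this
      linarith
  have hup : outerExpectation P (F n) ≤
      ∫ ω, (H n ω + (ε / 3 + T.indicator (fun _ => 2 * B) ω)) ∂P := by
    refine outerExpectation_le (hF n) ?_ (hHi.add ((integrable_const _).add hTi)) ?_
    · exact (hHm n).add (measurable_const.add (measurable_const.indicator hT))
    · intro ω
      linarith [(abs_le.1 (key ω)).2]
  have hlo : ∫ ω, (H n ω - (ε / 3 + T.indicator (fun _ => 2 * B) ω)) ∂P ≤
      outerExpectation P (F n) := by
    refine le_outerExpectation (hF n) (hHi.sub ((integrable_const _).add hTi)) ?_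
    intro ω
    linarith [(abs_le.1 (key ω)).1]
  have hci : Integrable (fun ω => ε / 3 + T.indicator (fun _ => 2 * B) ω) P :=
    (integrable_const _).add hTi
  rw [integral_add hHi hci, integral_add (integrable_const _) hTi, hint] at hup
  rw [integral_sub hHi hci, integral_add (integrable_const _) hTi, hint] at hlo
  simp only [integral_const, probReal_univ, one_smul] at hup hlo
  have h3 : P.real T * (2 * B) ≤ ε / 3 := by
    calc P.real T * (2 * B) ≤ ε / (3 * (2 * B + 1)) * (2 * B + 1) := by
          gcongr
          linarith
      _ = ε / 3 := by field_simp
  rw [Real.dist_0_eq_abs, abs_lt]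
  constructor <;> linarith

lemma BoundedContinuousFunction.abs_apply_le {E : Type*} [TopologicalSpace E] (f : E →ᵇ ℝ)
    (x : E) : |f x| ≤ ‖f‖ := f.norm_coe_le_norm x

lemma TendstoInLaw.tendsto_integral {k : ℕ} {X : ℕ → Ω → Eu k} {ν : Measure (Eu k)}
    (h : TendstoInLaw P X ν) (hX : ∀ n, Measurable (X n)) (f : Eu k →ᵇ ℝ) :
    Tendsto (fun n => ∫ ω, f (X n ω) ∂P) atTop (𝓝 (∫ x, f x ∂ν)) := by
  refine (h f).congr fun n => outerExpectation_eq_integral (B := ‖f‖)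
    (fun ω => f.abs_apply_le _) (f.continuous.measurable.comp (hX n))

/-- Slutsky's lemma: a perturbation by `o_p(1)`, measurable or not, of a tight measurable sequence
does not change its limit in law. -/
lemma TendstoInLaw.of_sub_tendsto {k : ℕ} {X Y : ℕ → Ω → Eu k} {ν : Measure (Eu k)}
    (h : TendstoInLaw P X ν) (hX : ∀ n, Measurable (X n))
    (ht : ExhaustsInProb P fun K : ℝ => {x : ℕ × Ω | ‖X x.1 x.2‖ ≤ K})
    (hXY : Tendsto (fun x : ℕ × Ω => Y x.1 x.2 - X x.1 x.2) (highProb P) (𝓝 0)) :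
    TendstoInLaw P Y ν := by
  intro f
  have key : Tendsto (fun x : ℕ × Ω => f (Y x.1 x.2) - f (X x.1 x.2)) (highProb P) (𝓝 0) := by
    rw [Metric.tendsto_nhds]
    intro ε hε
    refine ht.eventually fun K => ?_
    have huc : UniformContinuousOn f (Metric.closedBall 0 (K + 1)) :=
      (isCompact_closedBall _ _).uniformContinuousOn_of_continuous f.continuous.continuousOn
    obtain ⟨δ, hδ, hδ'⟩ := Metric.uniformContinuousOn_iff.1 huc ε hε
    filter_upwards [Metric.tendsto_nhds.1 hXY (min δ 1) (by positivity)] with x hx hK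
    rw [dist_zero_right] at hx
    have hK' : ‖X x.1 x.2‖ ≤ K := hK
    have hx1 := hx.trans_le (min_le_right _ _)
    have := hδ' (Y x.1 x.2) ?_ (X x.1 x.2) ?_ ?_
    · rw [Real.dist_eq] at this ⊢
      rwa [sub_zero]
    · rw [mem_closedBall_zero_iff]
      have h3 := norm_sub_norm_le (Y x.1 x.2) (X x.1 x.2)
      linarith
    · rw [mem_closedBall_zero_iff]
      linarith
    · rw [dist_eq_norm]
      exact hx.trans_le (min_le_left _ _)
  have h1 := tendsto_outerExpectation_sub (P := P) (F := fun n ω => f (Y n ω))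
    (H := fun n ω => f (X n ω)) (B := ‖f‖) (fun n ω => f.abs_apply_le _)
    (fun n ω => f.abs_apply_le _) (fun n => f.continuous.measurable.comp (hX n)) key
  simpa using h1.add (h.tendsto_integral hX f)

end Law

lemma TendstoInLaw.comp_continuous {Ω : Type*} [MeasurableSpace Ω] {P : Measure Ω} {k l : ℕ}
    {X : ℕ → Ω → Eu k} {ν : Measure (Eu k)}
    (h : TendstoInLaw P X ν) {g : Eu k → Eu l} (hg : Continuous g) :
    TendstoInLaw P (fun n ω => g (X n ω)) (ν.map g) := by
  intro f
  have := h (f.compContinuous ⟨g, hg⟩)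
  rw [integral_map hg.measurable.aemeasurable f.continuous.aestronglyMeasurable]
  exact this

/-- The limit in law is unique. -/
lemma TendstoInLaw.unique {Ω : Type*} [MeasurableSpace Ω] {P : Measure Ω} {k : ℕ}
    {X : ℕ → Ω → Eu k} {ν ν' : Measure (Eu k)}
    [IsProbabilityMeasure ν] [IsProbabilityMeasure ν'] (h : TendstoInLaw P X ν)
    (h' : TendstoInLaw P X ν') : ν = ν' :=
  ext_of_forall_integral_eq_of_IsFiniteMeasure fun f => tendsto_nhds_unique (h f) (h' f)

/-! ### Matrices acting on Euclidean space -/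

section MatVec

/-- `matVec A` as a continuous linear map. -/
noncomputable def matVecL {k l : ℕ} (A : Matrix (Fin k) (Fin l) ℝ) : Eu l →L[ℝ] Eu k :=
  LinearMap.toContinuousLinearMap (Matrix.toEuclideanLin A)

lemma matVecL_apply {k l : ℕ} (A : Matrix (Fin k) (Fin l) ℝ) (x : Eu l) :
    matVecL A x = matVec A x := rfl

lemma continuous_matVec {k l : ℕ} (A : Matrix (Fin k) (Fin l) ℝ) : Continuous (matVec A) :=
  (matVecL A).continuous

lemma matVec_add {k l : ℕ} (A : Matrix (Fin k) (Fin l) ℝ) (x y : Eu l) :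
    matVec A (x + y) = matVec A x + matVec A y := (matVecL A).map_add x y

lemma matVec_smul {k l : ℕ} (A : Matrix (Fin k) (Fin l) ℝ) (c : ℝ) (x : Eu l) :
    matVec A (c • x) = c • matVec A x := (matVecL A).map_smul c x

lemma norm_matVec_le {k l : ℕ} (A : Matrix (Fin k) (Fin l) ℝ) (x : Eu l) :
    ‖matVec A x‖ ≤ ‖matVecL A‖ * ‖x‖ := (matVecL A).le_opNorm x

lemma matVec_matVec {k l m : ℕ} (A : Matrix (Fin k) (Fin l) ℝ) (B : Matrix (Fin l) (Fin m) ℝ)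
    (x : Eu m) : matVec A (matVec B x) = matVec (A * B) x := by
  simp [matVec, Matrix.mulVec_mulVec]

lemma matVec_one {k : ℕ} (x : Eu k) : matVec (1 : Matrix (Fin k) (Fin k) ℝ) x = x := by
  simp [matVec]

lemma dotProduct_eq_inner {k : ℕ} (x y : Eu k) : x.ofLp ⬝ᵥ y.ofLp = inner ℝ x y := by
  rw [EuclideanSpace.inner_eq_star_dotProduct, dotProduct_comm]
  rfl

lemma quadForm_eq_inner {k : ℕ} (A : Matrix (Fin k) (Fin k) ℝ) (x : Eu k) :
    quadForm A x = inner ℝ x (matVec A x) := by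
  rw [← dotProduct_eq_inner]
  rfl

lemma inner_matVec_transpose {k l : ℕ} (A : Matrix (Fin k) (Fin l) ℝ) (x : Eu l) (y : Eu k) :
    inner ℝ x (matVec Aᵀ y) = inner ℝ (matVec A x) y := by
  rw [← dotProduct_eq_inner, ← dotProduct_eq_inner]
  simp [matVec, Matrix.dotProduct_mulVec, Matrix.vecMul_transpose]

lemma continuous_quadForm {k : ℕ} (A : Matrix (Fin k) (Fin k) ℝ) :
    Continuous (quadForm A) := by
  have : quadForm A = fun x => inner ℝ x (matVec A x) := funext (quadForm_eq_inner A)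
  rw [this]
  exact continuous_id.inner (continuous_matVec A)

lemma quadForm_smul {k : ℕ} (A : Matrix (Fin k) (Fin k) ℝ) (c : ℝ) (x : Eu k) :
    quadForm A (c • x) = c ^ 2 * quadForm A x := by
  rw [quadForm_eq_inner, quadForm_eq_inner, matVec_smul, inner_smul_left, inner_smul_right]
  simp
  ring

lemma smul_quadForm {k : ℕ} (A : Matrix (Fin k) (Fin k) ℝ) (c : ℝ) (x : Eu k) :
    quadForm (c • A) x = c * quadForm A x := by
  simp [quadForm, Matrix.smul_mulVec]

lemma quadForm_neg {k : ℕ} (A : Matrix (Fin k) (Fin k) ℝ) (x : Eu k) :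
    quadForm A (-x) = quadForm A x := by
  have := quadForm_smul A (-1) x
  simpa using this

lemma quadForm_le {k : ℕ} (A : Matrix (Fin k) (Fin k) ℝ) (x : Eu k) :
    quadForm A x ≤ ‖matVecL A‖ * ‖x‖ ^ 2 := by
  rw [quadForm_eq_inner]
  calc inner ℝ x (matVec A x) ≤ ‖x‖ * ‖matVec A x‖ := real_inner_le_norm _ _
    _ ≤ ‖x‖ * (‖matVecL A‖ * ‖x‖) := by gcongr; exact norm_matVec_le A x
    _ = _ := by ring

lemma Matrix.PosDef.quadForm_pos {k : ℕ} {A : Matrix (Fin k) (Fin k) ℝ} (hA : A.PosDef)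
    {x : Eu k} (hx : x ≠ 0) : 0 < quadForm A x := by
  have := hA.dotProduct_mulVec_pos (x := x.ofLp) (by simpa using hx)
  simpa [quadForm] using this

lemma Matrix.PosDef.quadForm_nonneg {k : ℕ} {A : Matrix (Fin k) (Fin k) ℝ} (hA : A.PosDef)
    (x : Eu k) : 0 ≤ quadForm A x := by
  rcases eq_or_ne x 0 with rfl | hx
  · simp [quadForm]
  · exact (hA.quadForm_pos hx).le

lemma Matrix.PosDef.transpose_eq {k : ℕ} {A : Matrix (Fin k) (Fin k) ℝ} (hA : A.PosDef) :
    Aᵀ = A := by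
  have := hA.1
  rwa [Matrix.IsHermitian, Matrix.conjTranspose_eq_transpose_of_trivial] at this

lemma inner_matVec_of_transpose_eq {k : ℕ} {A : Matrix (Fin k) (Fin k) ℝ} (hA : Aᵀ = A)
    (x y : Eu k) : inner ℝ x (matVec A y) = inner ℝ (matVec A x) y := by
  conv_lhs => rw [← hA]
  exact inner_matVec_transpose A x y

/-- A continuous family of positive definite matrices is uniformly positive definite over a
compact set. -/
lemma exists_forall_le_quadForm {X : Type*} [TopologicalSpace X] {K : Set X} (hK : IsCompact K)
    {k : ℕ} {A : X → Matrix (Fin k) (Fin k) ℝ} (hc : ContinuousOn A K)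
    (hpos : ∀ t ∈ K, (A t).PosDef) :
    ∃ c : ℝ, 0 < c ∧ ∀ t ∈ K, ∀ x : Eu k, c * ‖x‖ ^ 2 ≤ quadForm (A t) x := by
  have hcomp : IsCompact (K ×ˢ Metric.sphere (0 : Eu k) 1) := hK.prod (isCompact_sphere _ _)
  have hcont : ContinuousOn (fun p : X × Eu k => quadForm (A p.1) p.2)
      (K ×ˢ Metric.sphere (0 : Eu k) 1) := by
    have h1 : ContinuousOn (fun p : X × Eu k => A p.1) (K ×ˢ Metric.sphere (0 : Eu k) 1) :=
      hc.comp continuousOn_fst fun p hp => hp.1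
    simp only [quadForm, dotProduct, Matrix.mulVec]
    refine continuousOn_finsetSum _ fun i _ => ?_
    refine ContinuousOn.mul (by fun_prop) ?_
    refine continuousOn_finsetSum _ fun j _ => ?_
    refine ContinuousOn.mul ?_ (by fun_prop)
    exact ((continuous_apply_apply i j).continuousOn (s := Set.univ)).comp h1 fun _ _ => trivial
  have : ∃ c : ℝ, 0 < c ∧ ∀ p ∈ K ×ˢ Metric.sphere (0 : Eu k) 1, c ≤ quadForm (A p.1) p.2 := by
    rcases (K ×ˢ Metric.sphere (0 : Eu k) 1).eq_empty_or_nonempty with he | hne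
    · exact ⟨1, one_pos, by simp [he]⟩
    · obtain ⟨p, hp, hmin⟩ := hcomp.exists_isMinOn hne hcont
      refine ⟨_, (hpos _ hp.1).quadForm_pos ?_, fun q hq => hmin hq⟩
      exact ne_zero_of_mem_unit_sphere (⟨p.2, hp.2⟩ : Metric.sphere (0 : Eu k) 1)
  obtain ⟨c, hc0, hcK⟩ := this
  refine ⟨c, hc0, fun t ht x => ?_⟩
  rcases eq_or_ne x 0 with rfl | hx
  · simp [quadForm]
  · have h1 := hcK (t, ‖x‖⁻¹ • x) ⟨ht, by simp [norm_smul, hx]⟩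
    rw [quadForm_smul] at h1
    have hx' : 0 < ‖x‖ := norm_pos_iff.2 hx
    calc c * ‖x‖ ^ 2 ≤ (‖x‖⁻¹ ^ 2 * quadForm (A t) x) * ‖x‖ ^ 2 := by gcongr
      _ = quadForm (A t) x := by field_simp

lemma Matrix.PosDef.exists_le_quadForm {k : ℕ} {A : Matrix (Fin k) (Fin k) ℝ} (hA : A.PosDef) :
    ∃ c : ℝ, 0 < c ∧ ∀ x : Eu k, c * ‖x‖ ^ 2 ≤ quadForm A x := by
  obtain ⟨c, hc, h⟩ := exists_forall_le_quadForm (K := (Set.univ : Set Unit)) isCompact_univ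
    (A := fun _ => A) continuousOn_const (fun _ _ => hA)
  exact ⟨c, hc, h () trivial⟩

lemma uniformlyPosDef_const {d : ℕ} {A : Matrix (Fin d) (Fin d) ℝ} (hA : A.PosDef) :
    UniformlyPosDef fun _ => A := by
  obtain ⟨c, hc, h⟩ := hA.exists_le_quadForm
  refine ⟨fun _ => hA, c, ‖matVecL A‖ + 1, hc, by positivity, fun _ v => ⟨h v, ?_⟩⟩
  refine (quadForm_le A v).trans ?_
  gcongr
  linarith

lemma isUnit_det_of_posDef {k : ℕ} {A : Matrix (Fin k) (Fin k) ℝ} (hA : A.PosDef) :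
    IsUnit A.det := hA.det_pos.ne'.isUnit

lemma sqrt_mul_sqrt_of_posDef {k : ℕ} {A : Matrix (Fin k) (Fin k) ℝ} (hA : A.PosDef) :
    CFC.sqrt A * CFC.sqrt A = A :=
  CFC.sqrt_mul_sqrt_self A hA.posSemidef.nonneg

lemma det_sqrt_sq {k : ℕ} {A : Matrix (Fin k) (Fin k) ℝ} (hA : A.PosDef) :
    (CFC.sqrt A).det ^ 2 = A.det := by
  rw [sq, ← Matrix.det_mul, sqrt_mul_sqrt_of_posDef hA]

lemma isUnit_det_sqrt {k : ℕ} {A : Matrix (Fin k) (Fin k) ℝ} (hA : A.PosDef) :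
    IsUnit (CFC.sqrt A).det := by
  have h := det_sqrt_sq hA
  refine isUnit_iff_ne_zero.2 fun h0 => hA.det_pos.ne' ?_
  rw [← h, h0]
  ring

lemma transpose_sqrt {k : ℕ} (A : Matrix (Fin k) (Fin k) ℝ) :
    (CFC.sqrt A)ᵀ = CFC.sqrt A := by
  have h : IsSelfAdjoint (CFC.sqrt A) := (CFC.sqrt_nonneg A).isSelfAdjoint
  have := h.star_eq
  rwa [Matrix.star_eq_conjTranspose, Matrix.conjTranspose_eq_transpose_of_trivial] at this

end MatVec

/-! ### Gaussian integrals -/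

section Gaussian

/-- Polynomial moments of a Gaussian weight are finite. -/
lemma integrable_rpow_mul_exp {d : ℕ} {c : ℝ} (hc : 0 < c) {α : ℝ} (hα : 0 ≤ α) :
    Integrable fun h : Eu d => (1 + ‖h‖ ^ α) * Real.exp (-c * ‖h‖ ^ 2) := by
  have h0 : Integrable fun h : Eu d => Real.exp (-(c / 2) * ‖h‖ ^ 2) := by
    have := (GaussianFourier.integrable_cexp_neg_mul_sq_norm_add (V := Eu d)
      (b := ((c / 2 : ℝ) : ℂ)) (by simpa using hc) 0 0).norm
    refine this.congr (ae_of_all _ fun h => ?_)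
    simp only [zero_mul, add_zero]
    rw [Complex.norm_exp]
    congr 1
    have : (-((c / 2 : ℝ) : ℂ) * (‖h‖ : ℂ) ^ 2) = ((-(c / 2) * ‖h‖ ^ 2 : ℝ) : ℂ) := by
      push_cast
      ring
    rw [this, Complex.ofReal_re]
  refine (h0.const_mul (1 + Real.exp (α ^ 2 / (2 * c)))).mono' ?_ (ae_of_all _ fun h => ?_)
  · refine Measurable.aestronglyMeasurable ?_
    fun_prop
  · rw [Real.norm_of_nonneg (by positivity)]
    have h1 : ‖h‖ ^ α ≤ Real.exp (α * ‖h‖) := by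
      calc ‖h‖ ^ α ≤ (Real.exp ‖h‖) ^ α := by
            gcongr
            linarith [Real.add_one_le_exp ‖h‖]
        _ = Real.exp (α * ‖h‖) := by rw [← Real.exp_mul, mul_comm]
    have h2 : α * ‖h‖ + -c * ‖h‖ ^ 2 ≤ α ^ 2 / (2 * c) + -(c / 2) * ‖h‖ ^ 2 := by
      have : α ^ 2 / (2 * c) + -(c / 2) * ‖h‖ ^ 2 - (α * ‖h‖ + -c * ‖h‖ ^ 2)
          = (α - c * ‖h‖) ^ 2 / (2 * c) := by field_simp; ring
      have h3 : 0 ≤ (α - c * ‖h‖) ^ 2 / (2 * c) := by positivity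
      linarith
    calc (1 + ‖h‖ ^ α) * Real.exp (-c * ‖h‖ ^ 2)
        ≤ (1 + Real.exp (α * ‖h‖)) * Real.exp (-c * ‖h‖ ^ 2) := by gcongr
      _ = Real.exp (-c * ‖h‖ ^ 2) + Real.exp (α * ‖h‖ + -c * ‖h‖ ^ 2) := by
          rw [Real.exp_add]; ring
      _ ≤ Real.exp (-(c / 2) * ‖h‖ ^ 2) +
            Real.exp (α ^ 2 / (2 * c) + -(c / 2) * ‖h‖ ^ 2) := by
          gcongr
          linarith
      _ = _ := by rw [Real.exp_add]; ring

lemma limitDensity_nonneg {d : ℕ} (J : Matrix (Fin d) (Fin d) ℝ) (h : Eu d) :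
    0 ≤ limitDensity J h := by
  unfold limitDensity
  positivity

lemma continuous_limitDensity {d : ℕ} (J : Matrix (Fin d) (Fin d) ℝ) :
    Continuous (limitDensity J) := by
  unfold limitDensity
  have := continuous_quadForm J
  fun_prop

lemma limitDensity_neg {d : ℕ} (J : Matrix (Fin d) (Fin d) ℝ) (h : Eu d) :
    limitDensity J (-h) = limitDensity J h := by
  simp only [limitDensity, quadForm_neg]

lemma integrable_rpow_mul_limitDensity {d : ℕ} {J : Matrix (Fin d) (Fin d) ℝ} (hJ : J.PosDef)
    {α : ℝ} (hα : 0 ≤ α) : Integrable fun h : Eu d => (1 + ‖h‖ ^ α) * limitDensity J h := by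
  obtain ⟨c, hc, hcJ⟩ := hJ.exists_le_quadForm
  refine ((integrable_rpow_mul_exp (d := d) (half_pos hc) hα).const_mul
    (√(J.det / (2 * Real.pi) ^ d))).mono' ?_ (ae_of_all _ fun h => ?_)
  · refine Measurable.aestronglyMeasurable ?_
    have := (continuous_limitDensity J).measurable
    fun_prop
  · rw [Real.norm_of_nonneg (mul_nonneg (by positivity) (limitDensity_nonneg J h)), limitDensity,
      mul_left_comm]
    refine mul_le_mul_of_nonneg_left (mul_le_mul_of_nonneg_left ?_ (by positivity)) (by positivity)
    rw [Real.exp_le_exp]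
    linarith [hcJ h]

lemma integrable_limitDensity {d : ℕ} {J : Matrix (Fin d) (Fin d) ℝ} (hJ : J.PosDef) :
    Integrable (limitDensity J) := by
  have := (integrable_rpow_mul_limitDensity hJ le_rfl).const_mul (1 / 2)
  refine this.congr (ae_of_all _ fun h => ?_)
  simp only [Real.rpow_zero]
  ring

/-- The change of variables `h = J^{-1/2} u`. -/
lemma integral_comp_inv_sqrt {d : ℕ} {J : Matrix (Fin d) (Fin d) ℝ} (hJ : J.PosDef)
    (f : Eu d → ℂ) : √J.det • ∫ h, f h = ∫ u, f (matVec (CFC.sqrt J)⁻¹ u) := by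
  have hu := isUnit_det_sqrt hJ
  set B := CFC.sqrt J
  have hdet : LinearMap.det (Matrix.toEuclideanLin B⁻¹) = (B.det)⁻¹ := by
    change LinearMap.det (Matrix.toLpLin 2 2 B⁻¹) = _
    rw [Matrix.toLpLin_eq_toLin, LinearMap.det_toLin, Matrix.det_nonsing_inv,
      Ring.inverse_eq_inv']
  have hne : LinearMap.det (Matrix.toEuclideanLin B⁻¹) ≠ 0 := by
    rw [hdet]
    exact inv_ne_zero hu.ne_zero
  have hmap := Measure.map_linearMap_addHaar_eq_smul_addHaar (volume : Measure (Eu d)) hne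
  have hemb : MeasurableEmbedding (matVec B⁻¹ : Eu d → Eu d) := by
    have hB : B * B⁻¹ = 1 := Matrix.mul_nonsing_inv B hu
    have hB' : B⁻¹ * B = 1 := Matrix.nonsing_inv_mul B hu
    exact (Homeomorph.mk (X := Eu d) (Y := Eu d)
      ⟨matVec B⁻¹, matVec B, fun x => by rw [matVec_matVec, hB, matVec_one],
        fun x => by rw [matVec_matVec, hB', matVec_one]⟩ (continuous_matVec _)
        (continuous_matVec _)).measurableEmbedding
  have h1 : ∫ u, f (matVec B⁻¹ u) = ∫ y, f y ∂(Measure.map (matVec B⁻¹) volume) :=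
    (hemb.integral_map f).symm
  have h2 : (matVec B⁻¹ : Eu d → Eu d) = Matrix.toEuclideanLin B⁻¹ := rfl
  rw [h1, h2, hmap, integral_smul_measure, hdet, inv_inv, ENNReal.toReal_ofReal (abs_nonneg _)]
  congr 1
  rw [← det_sqrt_sq hJ, Real.sqrt_sq_eq_abs]

lemma quadForm_eq_norm_sqrt_sq {d : ℕ} {J : Matrix (Fin d) (Fin d) ℝ} (hJ : J.PosDef)
    (v : Eu d) : quadForm J v = ‖matVec (CFC.sqrt J) v‖ ^ 2 := by
  rw [quadForm_eq_inner, ← real_inner_self_eq_norm_sq, ← inner_matVec_of_transpose_eq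
    (transpose_sqrt J), matVec_matVec, sqrt_mul_sqrt_of_posDef hJ]

lemma quadForm_inv_sqrt {d : ℕ} {J : Matrix (Fin d) (Fin d) ℝ} (hJ : J.PosDef) (u : Eu d) :
    quadForm J (matVec (CFC.sqrt J)⁻¹ u) = ‖u‖ ^ 2 := by
  rw [quadForm_eq_norm_sqrt_sq hJ, matVec_matVec, Matrix.mul_nonsing_inv _ (isUnit_det_sqrt hJ),
    matVec_one]

lemma inv_eq_invSqrt_mul_invSqrt {d : ℕ} {J : Matrix (Fin d) (Fin d) ℝ} (hJ : J.PosDef) :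
    J⁻¹ = invSqrt J * invSqrt J := by
  conv_lhs => rw [← sqrt_mul_sqrt_of_posDef hJ]
  rw [Matrix.mul_inv_rev]
  rfl

lemma transpose_invSqrt {d : ℕ} (J : Matrix (Fin d) (Fin d) ℝ) : (invSqrt J)ᵀ = invSqrt J := by
  rw [invSqrt, Matrix.transpose_nonsing_inv, transpose_sqrt]

lemma quadForm_inv {d : ℕ} {J : Matrix (Fin d) (Fin d) ℝ} (hJ : J.PosDef) (t : Eu d) :
    quadForm J⁻¹ t = ‖matVec (invSqrt J) t‖ ^ 2 := by
  rw [quadForm_eq_inner, ← real_inner_self_eq_norm_sq, ← inner_matVec_of_transpose_eq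
    (transpose_invSqrt J), matVec_matVec, inv_eq_invSqrt_mul_invSqrt hJ]

/-- `limitDensity J` is the density of the normal law with mean zero and variance `J⁻¹`; both have
characteristic function `exp (-t' J⁻¹ t / 2)`. -/
lemma withDensity_limitDensity {d : ℕ} {J : Matrix (Fin d) (Fin d) ℝ} (hJ : J.PosDef) :
    volume.withDensity (fun h => ENNReal.ofReal (limitDensity J h)) =
      multivariateGaussian 0 J⁻¹ := by
  have hfin : IsFiniteMeasure
      (volume.withDensity (fun h : Eu d => ENNReal.ofReal (limitDensity J h))) :=
    isFiniteMeasure_withDensity_ofReal (integrable_limitDensity hJ).2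
  refine Measure.ext_of_charFun (funext fun t => ?_)
  rw [charFun_multivariateGaussian hJ.inv.posSemidef, charFun_apply]
  have hm : Measurable (fun h : Eu d => (limitDensity J h).toNNReal) :=
    (continuous_limitDensity J).measurable.real_toNNReal
  have h1 : ∫ x : Eu d, Complex.exp (inner ℝ x t * Complex.I)
      ∂(volume.withDensity (fun h => ENNReal.ofReal (limitDensity J h))) =
      ∫ h : Eu d, (limitDensity J h : ℂ) * Complex.exp (inner ℝ h t * Complex.I) := by
    refine (integral_withDensity_eq_integral_smul hm _).trans (integral_congr_ae
      (ae_of_all _ fun h => ?_))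
    simp only [NNReal.smul_def, Real.coe_toNNReal _ (limitDensity_nonneg J h)]
    simp
  have hJ0 : 0 < √J.det := Real.sqrt_pos.2 hJ.det_pos
  have h2 := integral_comp_inv_sqrt hJ
    (fun h => (limitDensity J h : ℂ) * Complex.exp (inner ℝ h t * Complex.I))
  have h3 : ∀ u : Eu d, (limitDensity J (matVec (CFC.sqrt J)⁻¹ u) : ℂ) *
      Complex.exp (inner ℝ (matVec (CFC.sqrt J)⁻¹ u) t * Complex.I) =
      (√(J.det / (2 * Real.pi) ^ d) : ℝ) * Complex.exp (-((1 / 2 : ℝ) : ℂ) * (‖u‖ : ℂ) ^ 2 +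
        Complex.I * inner ℝ (matVec (invSqrt J) t) u) := by
    intro u
    rw [limitDensity, quadForm_inv_sqrt hJ, Complex.exp_add, Complex.ofReal_mul, mul_assoc]
    congr 2
    · push_cast
      rfl
    · have : inner ℝ (matVec (CFC.sqrt J)⁻¹ u) t = inner ℝ (matVec (invSqrt J) t) u := by
        rw [← inner_matVec_of_transpose_eq (transpose_invSqrt J), real_inner_comm]
        rfl
      rw [this, mul_comm]
  simp_rw [h3] at h2
  rw [integral_const_mul, GaussianFourier.integral_cexp_neg_mul_sq_norm_add (by norm_num)] at h2
  have h4 : ((Real.pi : ℂ) / ((1 / 2 : ℝ) : ℂ)) ^ (Module.finrank ℝ (Eu d) / 2 : ℂ) =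
      (√((2 * Real.pi) ^ d) : ℝ) := by
    have : ((Real.pi : ℂ) / ((1 / 2 : ℝ) : ℂ)) = ((2 * Real.pi : ℝ) : ℂ) := by push_cast; ring
    rw [this, finrank_euclideanSpace_fin]
    have h5 : ((d : ℂ) / 2) = ((d / 2 : ℝ) : ℂ) := by push_cast; ring
    rw [h5, ← Complex.ofReal_cpow (by positivity), Real.sqrt_eq_rpow, ← Real.rpow_natCast,
      ← Real.rpow_mul (by positivity)]
    congr 2
    ring
  rw [h4, ← mul_assoc, ← Complex.ofReal_mul, ← Real.sqrt_mul (by have := hJ.det_pos; positivity),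
    div_mul_cancel₀ _ (by positivity), Complex.real_smul] at h2
  have h6 := mul_left_cancel₀ (by exact_mod_cast hJ0.ne') h2
  rw [h1, h6]
  congr 1
  have h7 : (t.ofLp ⬝ᵥ J⁻¹ *ᵥ t.ofLp) = ‖matVec (invSqrt J) t‖ ^ 2 := quadForm_inv hJ t
  rw [h7, Complex.I_sq]
  simp
  ring

lemma integral_limitDensity_smul {d : ℕ} {J : Matrix (Fin d) (Fin d) ℝ} (hJ : J.PosDef)
    {F : Type*} [NormedAddCommGroup F] [NormedSpace ℝ F] (f : Eu d → F) :
    ∫ h, limitDensity J h • f h = ∫ h, f h ∂(multivariateGaussian 0 J⁻¹) := by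
  have hm : Measurable (fun h : Eu d => (limitDensity J h).toNNReal) :=
    (continuous_limitDensity J).measurable.real_toNNReal
  rw [← withDensity_limitDensity hJ]
  refine ((integral_withDensity_eq_integral_smul hm _).trans (integral_congr_ae
      (ae_of_all _ fun h => ?_))).symm
  simp only [NNReal.smul_def, Real.coe_toNNReal _ (limitDensity_nonneg J h)]

lemma integral_limitDensity {d : ℕ} {J : Matrix (Fin d) (Fin d) ℝ} (hJ : J.PosDef) :
    ∫ h, limitDensity J h = 1 := by
  have := integral_limitDensity_smul hJ (fun _ => (1 : ℝ))
  simpa using this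

lemma integral_coord_mul_limitDensity {d : ℕ} (J : Matrix (Fin d) (Fin d) ℝ)
    (i : Fin d) : ∫ h : Eu d, h i * limitDensity J h = 0 := by
  have h1 : ∫ h : Eu d, h i * limitDensity J h = -∫ h : Eu d, h i * limitDensity J h := by
    rw [← integral_neg]
    conv_lhs => rw [← integral_neg_eq_self]
    refine integral_congr_ae (ae_of_all _ fun h => ?_)
    simp only [limitDensity_neg, PiLp.neg_apply]
    ring
  linarith

lemma integral_coord_mul_coord_mul_limitDensity {d : ℕ} {J : Matrix (Fin d) (Fin d) ℝ}
    (hJ : J.PosDef) (i j : Fin d) : ∫ h : Eu d, h i * h j * limitDensity J h = J⁻¹ i j := by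
  have hmean : ∀ i : Fin d, ∫ x : Eu d, x i ∂(multivariateGaussian 0 J⁻¹) = 0 := by
    intro i
    rw [← integral_limitDensity_smul hJ, ← integral_coord_mul_limitDensity J i]
    simp [mul_comm]
  have h1 := covariance_eval_multivariateGaussian (μ := 0) hJ.inv.posSemidef i j
  rw [covariance, hmean, hmean, ← integral_limitDensity_smul hJ] at h1
  rw [← h1]
  refine integral_congr_ae (ae_of_all _ fun h => ?_)
  simp only [sub_zero, smul_eq_mul]
  ring

/-- A linear functional of a centred normal vector is a centred normal variable. -/
lemma multivariateGaussian_map_inner {d : ℕ} {S : Matrix (Fin d) (Fin d) ℝ} (hS : S.PosSemidef)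
    (a : Eu d) : (multivariateGaussian 0 S).map (fun x => inner ℝ a x) =
      gaussianReal 0 (quadForm S a).toNNReal := by
  have h1 := IsGaussian.map_eq_gaussianReal (μ := multivariateGaussian 0 S) (innerSL ℝ a)
  have h2 : Var[fun x => inner ℝ a x; multivariateGaussian 0 S] = quadForm S a := by
    rw [← covarianceBilin_self IsGaussian.memLp_two_id, covarianceBilin_multivariateGaussian hS]
    rfl
  have h3 : (multivariateGaussian 0 S)[innerSL ℝ a] = 0 := by
    rw [(innerSL ℝ a).integral_comp_id_comm IsGaussian.integrable_id,
      integral_id_multivariateGaussian, map_zero]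
  rw [h3] at h1
  have h4 : (⇑(innerSL ℝ a) : Eu d → ℝ) = fun x => inner ℝ a x := by
    ext x
    simp
  rw [h4, h2] at h1
  exact h1

lemma multivariateGaussian_map_matVec {d k : ℕ} {S : Matrix (Fin d) (Fin d) ℝ}
    (hS : S.PosSemidef) (A : Matrix (Fin k) (Fin d) ℝ) (hA : (A * S * Aᵀ).PosSemidef) :
    (multivariateGaussian 0 S).map (matVec A) = multivariateGaussian 0 (A * S * Aᵀ) := by
  refine Measure.ext_of_charFun (funext fun t => ?_)
  have h1 : charFun ((multivariateGaussian 0 S).map (matVec A)) t =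
      charFun (multivariateGaussian 0 S) (matVec Aᵀ t) := by
    rw [charFun_apply, charFun_apply, integral_map (continuous_matVec A).measurable.aemeasurable]
    · refine integral_congr_ae (ae_of_all _ fun x => ?_)
      simp only [inner_matVec_transpose]
    · exact Measurable.aestronglyMeasurable (by fun_prop)
  rw [h1, charFun_multivariateGaussian hS, charFun_multivariateGaussian hA]
  simp only [inner_zero_right]
  congr 4
  have h2 : quadForm (A * S * Aᵀ) t = quadForm S (matVec Aᵀ t) := by
    rw [quadForm_eq_inner, quadForm_eq_inner, matVec_matVec, Matrix.mul_assoc, ← matVec_matVec,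
      real_inner_comm, ← inner_matVec_transpose, real_inner_comm]
  exact h2.symm

end Gaussian

/-! ### Normal quantiles and random intervals -/

section Quantile

instance nullSingletonClass_stdNormal : NullSingletonClass (gaussianReal 0 1) :=
  nullSingletonClass_gaussianReal one_ne_zero

lemma continuous_cdf_stdNormal : Continuous (cdf (gaussianReal 0 1)) := by
  refine continuous_iff_continuousAt.2 fun x => ?_
  have h1 := (cdf (gaussianReal 0 1)).measure_singleton x
  rw [measure_cdf, measure_singleton, eq_comm, ENNReal.ofReal_eq_zero, sub_nonpos] at h1
  have hm : Monotone (cdf (gaussianReal 0 1)) := monotone_cdf _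
  rw [hm.continuousAt_iff_leftLim_eq_rightLim, StieltjesFunction.rightLim_eq]
  exact le_antisymm (hm.leftLim_le le_rfl) h1

lemma strictMono_cdf_stdNormal : StrictMono (cdf (gaussianReal 0 1)) := by
  intro x y hxy
  have h1 : gaussianReal 0 1 (Set.Ioc x y) ≠ 0 := fun h0 => by
    have := gaussianReal_absolutelyContinuous' 0 one_ne_zero h0
    rw [Real.volume_Ioc, ENNReal.ofReal_eq_zero] at this
    linarith
  have h2 := (cdf (gaussianReal 0 1)).measure_Ioc x y
  rw [measure_cdf] at h2
  rw [h2] at h1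
  have := ENNReal.ofReal_pos.1 (pos_iff_ne_zero.2 h1)
  linarith

lemma cdf_stdNormal_neg (x : ℝ) :
    cdf (gaussianReal 0 1) (-x) = 1 - cdf (gaussianReal 0 1) x := by
  have h1 : (gaussianReal 0 1).map (fun x => -x) = gaussianReal 0 1 := by
    simpa using gaussianReal_map_neg (μ := 0) (v := 1)
  have h2 : gaussianReal 0 1 (Set.Iic (-x)) = gaussianReal 0 1 (Set.Ioi x) := by
    conv_lhs => rw [← h1]
    rw [Measure.map_apply measurable_neg measurableSet_Iic]
    have : (fun x : ℝ => -x) ⁻¹' Set.Iic (-x) = Set.Ici x := by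
      ext y
      simp
    rw [this]
    exact (measure_congr Ioi_ae_eq_Ici).symm
  have h3 : (gaussianReal 0 1).real (Set.Ioi x) = 1 - (gaussianReal 0 1).real (Set.Iic x) := by
    rw [← probReal_compl_eq_one_sub measurableSet_Iic, Set.compl_Iic]
  rw [cdf_eq_real, cdf_eq_real, ← h3, measureReal_def, h2, measureReal_def]

lemma stdNormal_Icc (x y : ℝ) : gaussianReal 0 1 (Set.Icc x y) =
    ENNReal.ofReal (cdf (gaussianReal 0 1) y - cdf (gaussianReal 0 1) x) := by
  have h2 := (cdf (gaussianReal 0 1)).measure_Icc x y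
  rw [measure_cdf] at h2
  rw [h2, continuous_cdf_stdNormal.continuousAt.continuousWithinAt.leftLim_eq]

lemma cdf_stdNormalQuantile {α : ℝ} (hα : α ∈ Set.Ioo (0 : ℝ) 1) :
    cdf (gaussianReal 0 1) (stdNormalQuantile α) = α := by
  set Φ := cdf (gaussianReal 0 1)
  obtain ⟨x, hx⟩ : ∃ x, Φ x = α := by
    have hlo := ((tendsto_cdf_atBot (gaussianReal 0 1)).eventually_lt_const hα.1).exists
    have hhi := ((tendsto_cdf_atTop (gaussianReal 0 1)).eventually_const_lt hα.2).exists
    obtain ⟨a, ha⟩ := hlo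
    obtain ⟨b, hb⟩ := hhi
    exact mem_range_of_exists_le_of_exists_ge continuous_cdf_stdNormal ⟨a, ha.le⟩ ⟨b, hb.le⟩
  have : {y : ℝ | α ≤ Φ y} = Set.Ici x := by
    ext y
    change α ≤ Φ y ↔ x ≤ y
    rw [← hx]
    exact strictMono_cdf_stdNormal.le_iff_le
  have h2 : stdNormalQuantile α = x := by
    change sInf {y : ℝ | α ≤ Φ y} = x
    rw [this, csInf_Ici]
  rw [h2, hx]

lemma stdNormal_symmetric_interval {α : ℝ} (hα : α ∈ Set.Ioo (0 : ℝ) 1) :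
    gaussianReal 0 1 (Set.Icc (-stdNormalQuantile (1 - α / 2)) (-stdNormalQuantile (α / 2))) =
      ENNReal.ofReal (1 - α) := by
  obtain ⟨h0, h1⟩ := hα
  rw [stdNormal_Icc, cdf_stdNormal_neg, cdf_stdNormal_neg,
    cdf_stdNormalQuantile ⟨by linarith, by linarith⟩,
    cdf_stdNormalQuantile ⟨by linarith, by linarith⟩]
  congr 1
  ring

variable {Ω : Type*} [MeasurableSpace Ω] {P : Measure Ω} [IsProbabilityMeasure P]

/-- Coverage of random intervals. If `T` is asymptotically standard normal and the random
endpoints `A`, `B`, measurable or not, converge to constants `a`, `b`, then both the outer and the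
inner probability of `A ≤ T ≤ B` converge to the normal probability of `[a, b]`. -/
lemma tendsto_prob_between {T : ℕ → Ω → ℝ} (hTm : ∀ n, Measurable (T n))
    (hT : ∀ f : ℝ →ᵇ ℝ, Tendsto (fun n => ∫ ω, f (T n ω) ∂P) atTop
      (𝓝 (∫ x, f x ∂gaussianReal 0 1)))
    {A B : ℕ → Ω → ℝ} {a b : ℝ}
    (hA : Tendsto (fun x : ℕ × Ω => A x.1 x.2) (highProb P) (𝓝 a))
    (hB : Tendsto (fun x : ℕ × Ω => B x.1 x.2) (highProb P) (𝓝 b)) :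
    Tendsto (fun n => P {ω | A n ω ≤ T n ω ∧ T n ω ≤ B n ω}) atTop
      (𝓝 (gaussianReal 0 1 (Set.Icc a b))) ∧
    Tendsto (fun n => innerProb P {ω | A n ω ≤ T n ω ∧ T n ω ≤ B n ω}) atTop
      (𝓝 (gaussianReal 0 1 (Set.Icc a b))) := by
  set μ := gaussianReal 0 1 with hμ
  set Φ := cdf μ with hΦ
  -- The portmanteau theorem, for intervals with constant endpoints.
  have hlim : ∀ x y : ℝ, Tendsto (fun n => P {ω | x ≤ T n ω ∧ T n ω ≤ y}) atTop
      (𝓝 (μ (Set.Icc x y))) := by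
    intro x y
    let μs : ℕ → ProbabilityMeasure ℝ := fun n =>
      ⟨P.map (T n), Measure.isProbabilityMeasure_map (hTm n).aemeasurable⟩
    let μ' : ProbabilityMeasure ℝ := ⟨μ, by rw [hμ]; infer_instance⟩
    have hconv : Tendsto μs atTop (𝓝 μ') := by
      rw [ProbabilityMeasure.tendsto_iff_forall_integral_tendsto]
      intro f
      refine (hT f).congr fun n => ?_
      exact (integral_map (hTm n).aemeasurable f.continuous.aestronglyMeasurable).symm
    have hnull : (μ' : Measure ℝ) (frontier (Set.Icc x y)) = 0 :=
      gaussianReal_absolutelyContinuous 0 one_ne_zero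
        ((convex_Icc x y).addHaar_frontier volume)
    refine (ProbabilityMeasure.tendsto_measure_of_null_frontier_of_tendsto' hconv hnull).congr
      fun n => ?_
    exact Measure.map_apply (hTm n) measurableSet_Icc
  have hcont : Tendsto (fun η : ℝ => μ (Set.Icc (a - η) (b + η))) (𝓝 0) (𝓝 (μ (Set.Icc a b))) := by
    simp only [hμ, stdNormal_Icc]
    have : Continuous fun η : ℝ => ENNReal.ofReal (Φ (b + η) - Φ (a - η)) := by
      have := continuous_cdf_stdNormal
      exact ENNReal.continuous_ofReal.comp (by fun_prop)
    have h2 := this.tendsto 0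
    simpa using h2
  have hsmall : ∀ η : ℝ, 0 < η → Tendsto (fun n : ℕ => P {ω | ¬ (dist (A n ω) a < η ∧
      dist (B n ω) b < η)}) atTop (𝓝 0) := fun η hη =>
    eventually_highProb.1 ((Metric.tendsto_nhds.1 hA η hη).and (Metric.tendsto_nhds.1 hB η hη))
  have hinner : ∀ n, innerProb P {ω | A n ω ≤ T n ω ∧ T n ω ≤ B n ω} ≤
      P {ω | A n ω ≤ T n ω ∧ T n ω ≤ B n ω} := by
    intro n
    rw [innerProb, tsub_le_iff_right, ← measure_univ (μ := P)]
    refine (measure_mono ?_).trans (measure_union_le _ _)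
    rw [Set.union_compl_self]
  -- With high probability the random interval lies inside the interval enlarged by `η` on both
  -- sides, and contains the one shrunk by `η`. The upper bound is proved for `P` and the lower
  -- bound for `innerProb P`, which is the smaller of the two.
  have hup : ∀ c, μ (Set.Icc a b) < c →
      ∀ᶠ n in atTop, P {ω | A n ω ≤ T n ω ∧ T n ω ≤ B n ω} < c := by
    intro c hc
    have h1 : ∀ᶠ η in 𝓝[>] (0 : ℝ), μ (Set.Icc (a - η) (b + η)) < c :=
      (hcont.mono_left nhdsWithin_le_nhds).eventually_lt_const hc
    obtain ⟨η, hη, hη0⟩ := (h1.and self_mem_nhdsWithin).exists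
    have h2 := (hlim (a - η) (b + η)).add (hsmall η hη0)
    rw [add_zero] at h2
    filter_upwards [h2.eventually_lt_const hη] with n hn
    refine ((measure_mono ?_).trans (measure_union_le _ _)).trans_lt hn
    intro ω hω
    by_cases hd : dist (A n ω) a < η ∧ dist (B n ω) b < η
    · left
      rw [Real.dist_eq, abs_lt, Real.dist_eq, abs_lt] at hd
      exact ⟨by linarith [hω.1], by linarith [hω.2]⟩
    · exact Or.inr hd
  have hlow : ∀ c, c < μ (Set.Icc a b) →
      ∀ᶠ n in atTop, c < innerProb P {ω | A n ω ≤ T n ω ∧ T n ω ≤ B n ω} := by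
    intro c hc
    have hneg : Tendsto (fun η : ℝ => -η) (𝓝[>] 0) (𝓝 0) := by
      have : Tendsto (fun η : ℝ => -η) (𝓝 0) (𝓝 0) := by simpa using continuous_neg.tendsto (0 : ℝ)
      exact this.mono_left nhdsWithin_le_nhds
    have h1 : ∀ᶠ η in 𝓝[>] (0 : ℝ), c < μ (Set.Icc (a - -η) (b + -η)) :=
      (hcont.comp hneg).eventually_const_lt hc
    obtain ⟨η, hη, hη0⟩ := (h1.and self_mem_nhdsWithin).exists
    have h2 := ENNReal.Tendsto.sub (hlim (a - -η) (b + -η)) (hsmall η hη0)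
      (Or.inr ENNReal.zero_ne_top)
    rw [tsub_zero] at h2
    filter_upwards [h2.eventually_const_lt hη] with n hn
    refine hn.trans_le ?_
    rw [innerProb]
    have hms : MeasurableSet {ω | a - -η ≤ T n ω ∧ T n ω ≤ b + -η} :=
      (hTm n) (measurableSet_Icc (a := a - -η) (b := b + -η))
    have h3 : P {ω | A n ω ≤ T n ω ∧ T n ω ≤ B n ω}ᶜ ≤
        P {ω | a - -η ≤ T n ω ∧ T n ω ≤ b + -η}ᶜ +
          P {ω | ¬ (dist (A n ω) a < η ∧ dist (B n ω) b < η)} := by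
      refine (measure_mono ?_).trans (measure_union_le _ _)
      intro ω hω
      by_cases hd : dist (A n ω) a < η ∧ dist (B n ω) b < η
      · left
        intro hc
        refine hω ?_
        rw [Real.dist_eq, abs_lt, Real.dist_eq, abs_lt] at hd
        exact ⟨by linarith [hc.1], by linarith [hc.2]⟩
      · exact Or.inr hd
    calc P {ω | a - -η ≤ T n ω ∧ T n ω ≤ b + -η} -
          P {ω | ¬ (dist (A n ω) a < η ∧ dist (B n ω) b < η)}
        = 1 - P {ω | a - -η ≤ T n ω ∧ T n ω ≤ b + -η}ᶜ -
          P {ω | ¬ (dist (A n ω) a < η ∧ dist (B n ω) b < η)} := by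
          rw [prob_compl_eq_one_sub hms, ENNReal.sub_sub_cancel ENNReal.one_ne_top prob_le_one]
      _ ≤ _ := by
          rw [tsub_tsub]
          exact tsub_le_tsub_left h3 _
  refine ⟨tendsto_order.2 ⟨fun c hc => ?_, hup⟩, tendsto_order.2 ⟨hlow, fun c hc => ?_⟩⟩
  · filter_upwards [hlow c hc] with n hn
    exact hn.trans_le (hinner n)
  · filter_upwards [hup c hc] with n hn
    exact (hinner n).trans_lt hn

end Quantile

/-! ### Moment functions: means and uniform bounds -/

section Moments

lemma IsStationaryErgodic.integral_eq {Ω : Type*} [MeasurableSpace Ω] {P : Measure Ω} {k : ℕ}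
    {X : ℕ → Ω → Eu k} (h : IsStationaryErgodic P X) (i : ℕ) :
    ∫ ω, X i ω ∂P = ∫ ω, X 0 ω ∂P := by
  have hm : Measurable fun ω i => X i ω := measurable_pi_lambda _ h.measurable
  have hX : ∀ i, ∫ ω, X i ω ∂P = ∫ x : ℕ → Eu k, x i ∂(P.map fun ω i => X i ω) := fun i =>
    (integral_map hm.aemeasurable (measurable_pi_apply i).aestronglyMeasurable).symm
  induction i with
  | zero => rfl
  | succ i ih =>
    rw [← ih, hX, hX i]
    have hmp := h.ergodic.toMeasurePreserving
    have h2 := integral_map (μ := P.map fun ω i => X i ω)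
      (f := fun x : ℕ → Eu k => x i) hmp.measurable.aemeasurable
      (measurable_pi_apply i).aestronglyMeasurable
    rw [hmp.map_eq] at h2
    exact h2.symm

lemma integral_sampleMoment {Ω : Type*} [MeasurableSpace Ω] {P : Measure Ω} {d q : ℕ}
    {m : ℕ → Eu d → Ω → Eu q} {θ : Eu d} (h : IsStationaryErgodic P fun i => m i θ)
    (hint : ∀ i, Integrable (m i θ) P) {n : ℕ} (hn : n ≠ 0) :
    ∫ ω, sampleMoment m n θ ω ∂P = ∫ ω, m 0 θ ω ∂P := by
  simp only [sampleMoment]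
  rw [integral_smul, integral_finsetSum _ fun i _ => hint i,
    Finset.sum_congr rfl fun i _ => h.integral_eq i, Finset.sum_const, Finset.card_range,
    ← Nat.cast_smul_eq_nsmul ℝ, smul_smul, inv_mul_cancel₀ (by exact_mod_cast hn), one_smul]

lemma measurable_sampleMoment {Ω : Type*} [MeasurableSpace Ω] {P : Measure Ω} {d q : ℕ}
    {m : ℕ → Eu d → Ω → Eu q} {θ : Eu d} (h : IsStationaryErgodic P fun i => m i θ) (n : ℕ) :
    Measurable (sampleMoment m n θ) :=
  (Finset.measurable_sum _ fun i _ => h.measurable i).const_smul (n : ℝ)⁻¹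

lemma abs_inner_matVec_le {q : ℕ} {A : Matrix (Fin q) (Fin q) ℝ} {ε : ℝ} (hA : ∀ a b, |A a b| ≤ ε)
    (x y : Eu q) : |inner ℝ x (matVec A y)| ≤ q ^ 2 * ε * (‖x‖ * ‖y‖) := by
  rw [← dotProduct_eq_inner]
  have h1 : x.ofLp ⬝ᵥ (matVec A y).ofLp = ∑ a, ∑ b, x a * (A a b * y b) := by
    simp only [matVec, dotProduct, Matrix.mulVec, Finset.mul_sum]
  rw [h1]
  calc |∑ a, ∑ b, x a * (A a b * y b)| ≤ ∑ a, ∑ b, |x a * (A a b * y b)| :=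
        (Finset.abs_sum_le_sum_abs _ _).trans
          (Finset.sum_le_sum fun a _ => Finset.abs_sum_le_sum_abs _ _)
    _ ≤ ∑ _a : Fin q, ∑ _b : Fin q, ‖x‖ * (ε * ‖y‖) := by
        refine Finset.sum_le_sum fun a _ => Finset.sum_le_sum fun b _ => ?_
        rw [abs_mul, abs_mul]
        have hx : |x a| ≤ ‖x‖ := PiLp.norm_apply_le x a
        have hy : |y b| ≤ ‖y‖ := PiLp.norm_apply_le y b
        have hε : 0 ≤ ε := (abs_nonneg _).trans (hA a b)
        exact mul_le_mul hx (mul_le_mul (hA a b) hy (abs_nonneg _) hε) (by positivity)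
          (norm_nonneg _)
    _ = q ^ 2 * ε * (‖x‖ * ‖y‖) := by
        simp
        ring

lemma matVec_sub_left {k l : ℕ} (A B : Matrix (Fin k) (Fin l) ℝ) (x : Eu l) :
    matVec (A - B) x = matVec A x - matVec B x := by
  simp [matVec, Matrix.sub_mulVec]

lemma abs_quadForm_sub_le {q : ℕ} {A B : Matrix (Fin q) (Fin q) ℝ} {ε : ℝ}
    (hA : ∀ a b, |A a b - B a b| ≤ ε) (x : Eu q) :
    |quadForm A x - quadForm B x| ≤ q ^ 2 * ε * ‖x‖ ^ 2 := by
  rw [quadForm_eq_inner, quadForm_eq_inner, ← inner_sub_right, ← matVec_sub_left, sq ‖x‖]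
  exact abs_inner_matVec_le (fun a b => hA a b) x x

/-- Identification and a full rank derivative make the mean of the moments grow at least linearly
away from `θ₀`, uniformly over the compact parameter space. -/
lemma exists_mul_norm_le_of_identified {d q : ℕ} {Θ : Set (Eu d)} {θ₀ : Eu d}
    (hΘ : IsCompact Θ) (hθ₀ : θ₀ ∈ interior Θ) {f : Eu d → Eu q} (hf : ContinuousOn f Θ)
    (hid : ∀ θ ∈ Θ, f θ = 0 ↔ θ = θ₀) {A : Matrix (Fin q) (Fin d) ℝ}
    (hA : HasFDerivAt f (matVecL A) θ₀) (hinj : ∀ v : Eu d, matVec A v = 0 → v = 0) :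
    ∃ c : ℝ, 0 < c ∧ ∀ θ ∈ Θ, c * ‖θ - θ₀‖ ≤ ‖f θ‖ := by
  have hθ₀Θ : θ₀ ∈ Θ := interior_subset hθ₀
  have hker : LinearMap.ker (Matrix.toEuclideanLin A) = ⊥ := LinearMap.ker_eq_bot'.2 hinj
  obtain ⟨K, hK, hKA⟩ := LinearMap.exists_antilipschitzWith _ hker
  have hKA' : ∀ v : Eu d, ‖v‖ ≤ K * ‖matVec A v‖ := fun v => by
    have := hKA.le_mul_dist v 0
    rwa [map_zero, dist_zero_right, dist_zero_right] at this
  have hK' : (0 : ℝ) < K := by exact_mod_cast hK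
  have hd : ∀ᶠ θ in 𝓝 θ₀, ‖f θ - f θ₀ - matVecL A (θ - θ₀)‖ ≤ 1 / (2 * K) * ‖θ - θ₀‖ :=
    hA.isLittleO.def (by positivity)
  obtain ⟨r, hr, hball⟩ := Metric.eventually_nhds_iff.1 hd
  have hf0 : f θ₀ = 0 := (hid θ₀ hθ₀Θ).2 rfl
  -- Near `θ₀` the derivative dominates; away from it, compactness and identification do.
  have hnear : ∀ θ, dist θ θ₀ < r → 1 / (2 * K) * ‖θ - θ₀‖ ≤ ‖f θ‖ := by
    intro θ hθ
    have h1 := hball hθ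
    rw [hf0, sub_zero] at h1
    have h2 := hKA' (θ - θ₀)
    have h3 : ‖matVec A (θ - θ₀)‖ ≤ ‖f θ‖ + ‖f θ - matVecL A (θ - θ₀)‖ := by
      have := norm_sub_le (f θ) (f θ - matVecL A (θ - θ₀))
      rwa [sub_sub_cancel] at this
    have h4 : 1 / K * ‖θ - θ₀‖ ≤ ‖matVec A (θ - θ₀)‖ := by
      rw [div_mul_eq_mul_div, one_mul, div_le_iff₀ hK']
      linarith
    have h5 : 1 / (2 * (K : ℝ)) * ‖θ - θ₀‖ = 1 / K * ‖θ - θ₀‖ / 2 := by field_simp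
    rw [h5] at h1 ⊢
    linarith
  have hcomp : IsCompact (Θ \ Metric.ball θ₀ r) := hΘ.diff Metric.isOpen_ball
  obtain ⟨D, hD⟩ := hΘ.isBounded.subset_closedBall θ₀
  have hD0 : 0 ≤ D := by
    have := hD hθ₀Θ
    simpa using this
  obtain ⟨c, hc, hfar⟩ : ∃ c : ℝ, 0 < c ∧ ∀ θ ∈ Θ \ Metric.ball θ₀ r, c ≤ ‖f θ‖ := by
    rcases (Θ \ Metric.ball θ₀ r).eq_empty_or_nonempty with he | hne
    · exact ⟨1, one_pos, by simp [he]⟩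
    · obtain ⟨p, hp, hmin⟩ := hcomp.exists_isMinOn hne (hf.mono Set.sdiff_subset).norm
      refine ⟨_, norm_pos_iff.2 fun h0 => hp.2 ?_, fun t ht => hmin ht⟩
      rw [(hid p hp.1).1 h0]
      exact Metric.mem_ball_self hr
  refine ⟨min (1 / (2 * K)) (c / (D + 1)), by positivity, fun θ hθ => ?_⟩
  by_cases hb : dist θ θ₀ < r
  · exact (mul_le_mul_of_nonneg_right (min_le_left _ _) (norm_nonneg _)).trans (hnear θ hb)
  · have hθD : ‖θ - θ₀‖ ≤ D := by
      have := hD hθ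
      rwa [Metric.mem_closedBall, dist_eq_norm] at this
    calc min (1 / (2 * (K : ℝ))) (c / (D + 1)) * ‖θ - θ₀‖ ≤ c / (D + 1) * (D + 1) := by
          gcongr
          · exact min_le_right _ _
          · linarith
      _ = c := by field_simp
      _ ≤ _ := hfar θ ⟨hθ, hb⟩

end Moments

/-! ### Empirical process bounds -/

section Empirical

variable {Ω : Type*} {d q : ℕ} {Θ : Set (Eu d)} {θ₀ : Eu d}
  {g : ℕ → Eu d → Ω → Eu q} {f : Eu d → Eu q}

/-- The set of pairs `(n, ω)` at which the centred process `√n (g_n - f)` has increments bounded by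
`ε (1 + √n |θ - θ'|)` over distances up to `δ`. -/
def equicontinuitySet (Θ : Set (Eu d)) (g : ℕ → Eu d → Ω → Eu q) (f : Eu d → Eu q) (ε δ : ℝ) :
    Set (ℕ × Ω) :=
  {x | ∀ θ ∈ Θ, ∀ θ' ∈ Θ, ‖θ - θ'‖ ≤ δ →
    √(x.1 : ℝ) * ‖(g x.1 θ x.2 - g x.1 θ' x.2) - (f θ - f θ')‖ ≤
      ε * (1 + √(x.1 : ℝ) * ‖θ - θ'‖)}

/-- Chaining along the segment from `θ₀` to `θ`: increments over distances up to `δ` control all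
increments from `θ₀`, because the parameter space is convex and bounded. -/
lemma norm_increment_le_of_mem_equicontinuitySet (hconv : Convex ℝ Θ) (hθ₀ : θ₀ ∈ Θ) {ε δ D : ℝ}
    {N : ℕ} (hN : N ≠ 0) (hDN : D ≤ N * δ) (hD : ∀ θ ∈ Θ, ‖θ - θ₀‖ ≤ D) {x : ℕ × Ω}
    (hx : x ∈ equicontinuitySet Θ g f ε δ) {θ : Eu d} (hθ : θ ∈ Θ) :
    √(x.1 : ℝ) * ‖(g x.1 θ x.2 - g x.1 θ₀ x.2) - (f θ - f θ₀)‖ ≤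
      ε * (N + √(x.1 : ℝ) * ‖θ - θ₀‖) := by
  have hN' : (0 : ℝ) < N := by exact_mod_cast Nat.pos_of_ne_zero hN
  let p : ℕ → Eu d := fun j => θ₀ + ((j : ℝ) / N) • (θ - θ₀)
  have hp : ∀ j ≤ N, p j ∈ Θ := fun j hj =>
    hconv.add_smul_sub_mem hθ₀ hθ ⟨by positivity, (div_le_one hN').2 (by exact_mod_cast hj)⟩
  have hstep : ∀ j, ‖p (j + 1) - p j‖ = ‖θ - θ₀‖ / N := by
    intro j
    have : p (j + 1) - p j = (1 / N : ℝ) • (θ - θ₀) := by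
      simp only [p, add_sub_add_left_eq_sub, ← sub_smul]
      congr 1
      push_cast
      ring
    rw [this, norm_smul, Real.norm_of_nonneg (by positivity)]
    ring
  have key : ∀ j ≤ N, √(x.1 : ℝ) * ‖(g x.1 (p j) x.2 - g x.1 θ₀ x.2) - (f (p j) - f θ₀)‖ ≤
      j * (ε * (1 + √(x.1 : ℝ) * (‖θ - θ₀‖ / N))) := by
    intro j
    induction j with
    | zero => simp [p]
    | succ j ih =>
      intro hj
      have h1 := ih (by omega)
      have h2 := hx (p (j + 1)) (hp _ hj) (p j) (hp _ (by omega)) (by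
        rw [hstep, div_le_iff₀ hN']
        linarith [hD θ hθ])
      rw [hstep] at h2
      have h3 : (g x.1 (p (j + 1)) x.2 - g x.1 θ₀ x.2) - (f (p (j + 1)) - f θ₀) =
          ((g x.1 (p (j + 1)) x.2 - g x.1 (p j) x.2) - (f (p (j + 1)) - f (p j))) +
          ((g x.1 (p j) x.2 - g x.1 θ₀ x.2) - (f (p j) - f θ₀)) := by abel
      rw [h3]
      calc _ ≤ √(x.1 : ℝ) * (‖(g x.1 (p (j + 1)) x.2 - g x.1 (p j) x.2) -
              (f (p (j + 1)) - f (p j))‖ +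
              ‖(g x.1 (p j) x.2 - g x.1 θ₀ x.2) - (f (p j) - f θ₀)‖) := by
            gcongr
            exact norm_add_le _ _
        _ ≤ _ := by
            push_cast
            linarith
  have hpN : p N = θ := by simp [p, hN'.ne']
  have := key N le_rfl
  rw [hpN] at this
  refine this.trans (le_of_eq ?_)
  field_simp

end Empirical

/-! ### Quadratic expansion of the criterion -/

section Expansion

/-- What the expansion uses of a moment model with sample moments `g n`, population moments `f`,
derivative `G` of `f` at `θ₀` and weights `Wn`, `W`: smooth identification, uniformly consistent
weights, stochastic equicontinuity and tightness of the normalized moments at `θ₀`. -/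
structure MomentModel {Ω : Type*} [MeasurableSpace Ω] (P : Measure Ω) {d q : ℕ} (Θ : Set (Eu d))
    (θ₀ : Eu d) (g : ℕ → Eu d → Ω → Eu q) (f : Eu d → Eu q) (G : Matrix (Fin q) (Fin d) ℝ)
    (Wn : ℕ → Eu d → Ω → Matrix (Fin q) (Fin q) ℝ) (W : Eu d → Matrix (Fin q) (Fin q) ℝ) :
    Prop where
  param : ParameterAssumption Θ θ₀
  continuousOn : ContinuousOn f Θ
  eq_zero_iff : ∀ θ ∈ Θ, f θ = 0 ↔ θ = θ₀
  hasFDerivAt : HasFDerivAt f (matVecL G) θ₀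
  curvature : (Gᵀ * W θ₀ * G).PosDef
  weight_posDef : ∀ θ ∈ Θ, (W θ).PosDef
  weight_continuousOn : ContinuousOn W Θ
  weight_tendsto : ∀ ε : ℝ, 0 < ε →
    ∀ᶠ x in highProb P, ∀ θ ∈ Θ, ∀ a b, |Wn x.1 θ x.2 a b - W θ a b| ≤ ε
  equicontinuous : ∀ ε : ℝ, 0 < ε → ∃ δ : ℝ, 0 < δ ∧
    ∀ᶠ n : ℕ in atTop, P {ω | (n, ω) ∉ equicontinuitySet Θ g f ε δ} ≤ ENNReal.ofReal ε
  tight : ExhaustsInProb P fun K : ℝ => {x : ℕ × Ω | ‖√(x.1 : ℝ) • g x.1 θ₀ x.2‖ ≤ K}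

/-- The criterion of a moment model. -/
noncomputable def quadCriterion {Ω : Type*} {d q : ℕ} (g : ℕ → Eu d → Ω → Eu q)
    (Wn : ℕ → Eu d → Ω → Matrix (Fin q) (Fin q) ℝ) (n : ℕ) (θ : Eu d) (ω : Ω) : ℝ :=
  -(n * quadForm (Wn n θ ω) (g n θ ω)) / 2

/-- The score of a moment model; `B` is the matrix `G' W(θ₀)`. -/
noncomputable def linScore {Ω : Type*} {d q : ℕ} (g : ℕ → Eu d → Ω → Eu q)
    (B : Matrix (Fin d) (Fin q) ℝ) (θ₀ : Eu d) (n : ℕ) (ω : Ω) : Eu d :=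
  -((n : ℝ) • matVec B (g n θ₀ ω))

lemma quadCriterion_eq {Ω : Type*} {d q : ℕ} {g : ℕ → Eu d → Ω → Eu q}
    {Wn : ℕ → Eu d → Ω → Matrix (Fin q) (Fin q) ℝ} (n : ℕ) (θ : Eu d) (ω : Ω) :
    quadCriterion g Wn n θ ω = -(quadForm (Wn n θ ω) (√(n : ℝ) • g n θ ω) / 2) := by
  rw [quadForm_smul, Real.sq_sqrt (Nat.cast_nonneg n), quadCriterion]
  ring

/-- The remainder of the quadratic expansion, in terms of the normalized moments. -/
lemma expansionRemainder_quadCriterion {Ω : Type*} {d q : ℕ} {θ₀ : Eu d}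
    {g : ℕ → Eu d → Ω → Eu q} {G : Matrix (Fin q) (Fin d) ℝ}
    {Wn : ℕ → Eu d → Ω → Matrix (Fin q) (Fin q) ℝ} {W : Eu d → Matrix (Fin q) (Fin q) ℝ}
    (hW : (W θ₀)ᵀ = W θ₀) (n : ℕ) (θ : Eu d) (ω : Ω) :
    expansionRemainder (quadCriterion g Wn) θ₀ (linScore g (Gᵀ * W θ₀) θ₀)
      (fun _ => Gᵀ * W θ₀ * G) n θ ω =
    -((quadForm (Wn n θ ω) (√(n : ℝ) • g n θ ω) - quadForm (W θ₀)
        (√(n : ℝ) • g n θ₀ ω + matVec G (√(n : ℝ) • (θ - θ₀)))) / 2) +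
      (quadForm (Wn n θ₀ ω) (√(n : ℝ) • g n θ₀ ω) - quadForm (W θ₀) (√(n : ℝ) • g n θ₀ ω)) / 2 := by
  have hn : (n : ℝ) = √(n : ℝ) * √(n : ℝ) := (Real.mul_self_sqrt (Nat.cast_nonneg n)).symm
  rw [expansionRemainder, quadCriterion_eq, quadCriterion_eq, smul_quadForm]
  have h1 : (n : ℝ) * quadForm (Gᵀ * W θ₀ * G) (θ - θ₀) =
      quadForm (W θ₀) (matVec G (√(n : ℝ) • (θ - θ₀))) := by
    conv_rhs => rw [matVec_smul, quadForm_smul, Real.sq_sqrt (Nat.cast_nonneg n)]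
    rw [quadForm_eq_inner, quadForm_eq_inner, ← matVec_matVec, ← matVec_matVec,
      inner_matVec_transpose]
  have h2 : (θ - θ₀).ofLp ⬝ᵥ (linScore g (Gᵀ * W θ₀) θ₀ n ω).ofLp =
      -inner ℝ (matVec G (√(n : ℝ) • (θ - θ₀))) (matVec (W θ₀) (√(n : ℝ) • g n θ₀ ω)) := by
    rw [dotProduct_eq_inner, linScore, inner_neg_right, inner_smul_right, ← matVec_matVec,
      inner_matVec_transpose, matVec_smul, matVec_smul, inner_smul_left, inner_smul_right]
    conv_lhs => rw [hn]
    simp only [RCLike.conj_to_real]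
    ring
  set Z := √(n : ℝ) • g n θ₀ ω
  set X := matVec G (√(n : ℝ) • (θ - θ₀))
  have h3 : quadForm (W θ₀) (Z + X) = quadForm (W θ₀) Z + 2 * inner ℝ X (matVec (W θ₀) Z) +
      quadForm (W θ₀) X := by
    simp only [quadForm_eq_inner, matVec_add, inner_add_left, inner_add_right]
    have : inner ℝ Z (matVec (W θ₀) X) = inner ℝ X (matVec (W θ₀) Z) := by
      rw [inner_matVec_of_transpose_eq hW, real_inner_comm]
    linarith
  rw [h1, h2, h3]
  ring

/-- Deterministic bound for the remainder: `X` is the linearization of the normalized moments `Y`,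
and `A`, `A₀` are weights close to `B`. -/
lemma abs_remainder_le {q : ℕ} {A A₀ B : Matrix (Fin q) (Fin q) ℝ} {τ : ℝ} (hτ : τ ≤ 1)
    (hA : ∀ a b, |A a b - B a b| ≤ τ) (hA₀ : ∀ a b, |A₀ a b - B a b| ≤ τ) (X Y Z : Eu q) :
    |-((quadForm A Y - quadForm B X) / 2) + (quadForm A₀ Z - quadForm B Z) / 2| ≤
      (‖matVecL B‖ + q ^ 2) * (τ * (‖X‖ ^ 2 + ‖Z‖ ^ 2) + 2 * ‖X‖ * ‖Y - X‖ + ‖Y - X‖ ^ 2) := by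
  set e := Y - X with he
  have hY : Y = X + e := by rw [he]; abel
  have h0 := abs_quadForm_sub_le hA₀ Z
  have h1 := abs_quadForm_sub_le hA X
  have hb : ∀ x y : Eu q, |inner ℝ x (matVec A y)| ≤ (‖matVecL B‖ + q ^ 2) * (‖x‖ * ‖y‖) := by
    intro x y
    have h2 : matVec A y = matVec B y + matVec (A - B) y := by rw [matVec_sub_left]; abel
    have h3 := abs_inner_matVec_le (A := A - B) (fun a b => hA a b) x y
    have h4 : |inner ℝ x (matVec B y)| ≤ ‖matVecL B‖ * (‖x‖ * ‖y‖) :=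
      calc |inner ℝ x (matVec B y)| ≤ ‖x‖ * ‖matVec B y‖ := abs_real_inner_le_norm _ _
        _ ≤ ‖x‖ * (‖matVecL B‖ * ‖y‖) := by gcongr; exact norm_matVec_le B y
        _ = _ := by ring
    rw [h2, inner_add_right]
    refine (abs_add_le _ _).trans ?_
    have h5 : (q : ℝ) ^ 2 * τ * (‖x‖ * ‖y‖) ≤ (q : ℝ) ^ 2 * 1 * (‖x‖ * ‖y‖) := by gcongr
    linarith
  have h2 : quadForm A Y = quadForm A X + inner ℝ X (matVec A e) + inner ℝ e (matVec A X) +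
      inner ℝ e (matVec A e) := by
    rw [hY]
    simp only [quadForm_eq_inner, matVec_add, inner_add_left, inner_add_right]
    ring
  have h3 := hb X e
  have h4 := hb e X
  have h5 := hb e e
  have hτ0 : (q : ℝ) ^ 2 * τ * (‖X‖ ^ 2 + ‖Z‖ ^ 2) ≤
      (‖matVecL B‖ + q ^ 2) * τ * (‖X‖ ^ 2 + ‖Z‖ ^ 2) := by
    by_cases hq : q = 0
    · subst hq
      have hX : X = 0 := Subsingleton.elim _ _
      have hZ : Z = 0 := Subsingleton.elim _ _
      simp [hX, hZ]
    · have : 0 ≤ τ := (abs_nonneg _).trans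
        (hA ⟨0, Nat.pos_of_ne_zero hq⟩ ⟨0, Nat.pos_of_ne_zero hq⟩)
      gcongr
      linarith [norm_nonneg (matVecL B)]
  have h6 : |quadForm A Y - quadForm B X| ≤ q ^ 2 * τ * ‖X‖ ^ 2 +
      (‖matVecL B‖ + q ^ 2) * (2 * ‖X‖ * ‖e‖ + ‖e‖ ^ 2) := by
    rw [abs_le] at h1 h3 h4 h5 ⊢
    constructor <;> nlinarith
  have h7 : 0 ≤ (‖matVecL B‖ + q ^ 2) * (2 * ‖X‖ * ‖e‖ + ‖e‖ ^ 2) := by positivity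
  rw [abs_le] at h0 h6 ⊢
  have h8 := h0.1.trans h0.2
  have h9 := h6.1.trans h6.2
  constructor <;> nlinarith

variable {Ω : Type*} [MeasurableSpace Ω] {P : Measure Ω} {d q : ℕ} {Θ : Set (Eu d)}
    {θ₀ : Eu d} {g : ℕ → Eu d → Ω → Eu q} {f : Eu d → Eu q} {G : Matrix (Fin q) (Fin d) ℝ}
    {Wn : ℕ → Eu d → Ω → Matrix (Fin q) (Fin q) ℝ} {W : Eu d → Matrix (Fin q) (Fin q) ℝ}

lemma MomentModel.mem (h : MomentModel P Θ θ₀ g f G Wn W) : θ₀ ∈ Θ :=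
  interior_subset h.param.interior

lemma MomentModel.map_zero (h : MomentModel P Θ θ₀ g f G Wn W) : f θ₀ = 0 :=
  (h.eq_zero_iff θ₀ h.mem).2 rfl

lemma MomentModel.injective (h : MomentModel P Θ θ₀ g f G Wn W) (v : Eu d)
    (hv : matVec G v = 0) : v = 0 := by
  by_contra hne
  have h1 := h.curvature.quadForm_pos hne
  rw [quadForm_eq_inner, ← matVec_matVec, hv] at h1
  simp [matVec] at h1

/-- Away from `θ₀` the normalized sample moments grow linearly in `√n |θ - θ₀|`, uniformly over the
whole parameter space. -/
lemma MomentModel.exists_exhausts_moment (h : MomentModel P Θ θ₀ g f G Wn W) :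
    ∃ c : ℝ, 0 < c ∧ ExhaustsInProb P fun K : ℝ => {x : ℕ × Ω | ∀ θ ∈ Θ,
      c * (√(x.1 : ℝ) * ‖θ - θ₀‖) ≤ ‖√(x.1 : ℝ) • g x.1 θ x.2‖ + K} := by
  obtain ⟨c, hc, hcf⟩ := exists_mul_norm_le_of_identified h.param.compact h.param.interior
    h.continuousOn h.eq_zero_iff h.hasFDerivAt h.injective
  refine ⟨c / 2, half_pos hc, ?_⟩
  obtain ⟨D, hD⟩ := h.param.compact.isBounded.subset_closedBall θ₀
  have hD' : ∀ θ ∈ Θ, ‖θ - θ₀‖ ≤ D := fun θ hθ => by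
    have := hD hθ
    rwa [Metric.mem_closedBall, dist_eq_norm] at this
  have hchain : ExhaustsInProb P fun K : ℝ => {x : ℕ × Ω | ∀ θ ∈ Θ,
      √(x.1 : ℝ) * ‖(g x.1 θ x.2 - g x.1 θ₀ x.2) - (f θ - f θ₀)‖ ≤
        K + c / 2 * (√(x.1 : ℝ) * ‖θ - θ₀‖)} := by
    intro η hη
    set ε := min η (c / 2)
    have hε : 0 < ε := lt_min hη (half_pos hc)
    obtain ⟨δ, hδ, hδP⟩ := h.equicontinuous ε hε
    obtain ⟨N, hN⟩ := exists_nat_gt (D / δ)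
    -- A segment of `Θ` is covered by `N + 1` steps of length at most `δ`.
    refine ⟨ε * (N + 1 : ℕ), ?_⟩
    filter_upwards [hδP] with n hn
    refine (measure_mono ?_).trans (hn.trans (ENNReal.ofReal_le_ofReal (min_le_left _ _)))
    intro ω hω hmem
    refine hω fun θ hθ => ?_
    have hDN : D ≤ (N + 1 : ℕ) * δ := by
      rw [div_lt_iff₀ hδ] at hN
      push_cast
      nlinarith
    refine (norm_increment_le_of_mem_equicontinuitySet h.param.convex h.mem
      (Nat.succ_ne_zero N) hDN hD' hmem hθ).trans ?_
    rw [mul_add]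
    gcongr
    exact min_le_right _ _
  refine (hchain.inter h.tight).mono fun k => ⟨k.1 + k.2, Eventually.of_forall ?_⟩
  rintro x ⟨h1, h2⟩ θ hθ
  have h1' := h1 θ hθ
  have h2' : ‖√(x.1 : ℝ) • g x.1 θ₀ x.2‖ ≤ k.2 := h2
  have h3 := hcf θ hθ
  rw [h.map_zero, sub_zero] at h1'
  set s := √(x.1 : ℝ)
  have hs : 0 ≤ s := Real.sqrt_nonneg _
  rw [← Real.norm_of_nonneg hs, ← norm_smul, Real.norm_of_nonneg hs] at h1'
  have h4 : s • f θ = s • g x.1 θ x.2 - s • g x.1 θ₀ x.2 -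
      s • (g x.1 θ x.2 - g x.1 θ₀ x.2 - f θ) := by
    simp only [smul_sub]
    abel
  have h5 : ‖s • f θ‖ ≤ ‖s • g x.1 θ x.2‖ + ‖s • g x.1 θ₀ x.2‖ +
      ‖s • (g x.1 θ x.2 - g x.1 θ₀ x.2 - f θ)‖ := by
    rw [h4]
    exact (norm_sub_le _ _).trans (add_le_add_left (norm_sub_le _ _) _)
  rw [norm_smul, Real.norm_of_nonneg hs] at h5
  have h6 : s * (c * ‖θ - θ₀‖) ≤ s * ‖f θ‖ := by gcongr
  linarith

/-- The criterion decreases at least quadratically in `√n |θ - θ₀|`, uniformly over the whole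
parameter space. -/
lemma MomentModel.exists_exhausts_criterion (h : MomentModel P Θ θ₀ g f G Wn W) :
    ∃ c : ℝ, 0 < c ∧ ExhaustsInProb P fun K : ℝ => {x : ℕ × Ω | ∀ θ ∈ Θ,
      quadCriterion g Wn x.1 θ x.2 - quadCriterion g Wn x.1 θ₀ x.2 ≤
        K - c * (x.1 * ‖θ - θ₀‖ ^ 2)} := by
  obtain ⟨c, hc, hcP⟩ := h.exists_exhausts_moment
  obtain ⟨lam, hlam, hlamW⟩ := exists_forall_le_quadForm h.param.compact h.weight_continuousOn
    h.weight_posDef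
  refine ⟨lam / 4 * (c ^ 2 / 2), by positivity, ?_⟩
  -- Weights within `τ` of the limit keep half of its smallest eigenvalue.
  set τ : ℝ := lam / (2 * (q ^ 2 + 1)) with hτ
  have hτ0 : 0 < τ := by positivity
  have hqτ : (q : ℝ) ^ 2 * τ ≤ lam / 2 := by
    rw [hτ, mul_div_assoc', div_le_div_iff₀ (by positivity) (by positivity)]
    nlinarith
  refine (hcP.inter h.tight).mono fun k =>
    ⟨lam / 4 * k.1 ^ 2 + (‖matVecL (W θ₀)‖ + lam / 2) * k.2 ^ 2 / 2, ?_⟩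
  filter_upwards [h.weight_tendsto τ hτ0] with x hx
  rintro ⟨h1, h2⟩ θ hθ
  have h1' := h1 θ hθ
  have h2' : ‖√(x.1 : ℝ) • g x.1 θ₀ x.2‖ ≤ k.2 := h2
  set Y := √(x.1 : ℝ) • g x.1 θ x.2 with hY
  set Z := √(x.1 : ℝ) • g x.1 θ₀ x.2 with hZ
  rw [quadCriterion_eq, quadCriterion_eq, ← hY, ← hZ]
  have h3 := abs_le.1 (abs_quadForm_sub_le (hx θ hθ) Y)
  have h4 := abs_le.1 (abs_quadForm_sub_le (hx θ₀ h.mem) Z)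
  have h5 := hlamW θ hθ Y
  have h6 := quadForm_le (W θ₀) Z
  have h7 : lam / 2 * ‖Y‖ ^ 2 ≤ quadForm (Wn x.1 θ x.2) Y := by
    nlinarith [sq_nonneg ‖Y‖]
  have h8 : quadForm (Wn x.1 θ₀ x.2) Z ≤ (‖matVecL (W θ₀)‖ + lam / 2) * k.2 ^ 2 := by
    have h9 : quadForm (Wn x.1 θ₀ x.2) Z ≤ (‖matVecL (W θ₀)‖ + lam / 2) * ‖Z‖ ^ 2 := by
      nlinarith [sq_nonneg ‖Z‖]
    refine h9.trans ?_
    gcongr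
  have h10 : c ^ 2 * (x.1 * ‖θ - θ₀‖ ^ 2) ≤ 2 * ‖Y‖ ^ 2 + 2 * k.1 ^ 2 := by
    have h11 : (c * (√(x.1 : ℝ) * ‖θ - θ₀‖)) ^ 2 ≤ (‖Y‖ + k.1) ^ 2 := by
      gcongr
    have h12 : (c * (√(x.1 : ℝ) * ‖θ - θ₀‖)) ^ 2 = c ^ 2 * (x.1 * ‖θ - θ₀‖ ^ 2) := by
      rw [mul_pow, mul_pow, Real.sq_sqrt (Nat.cast_nonneg _)]
    nlinarith [sq_nonneg (‖Y‖ - k.1)]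
  nlinarith

end Expansion

section Linearization

variable {Ω : Type*} [MeasurableSpace Ω] {P : Measure Ω} {d q : ℕ} {Θ : Set (Eu d)}
    {θ₀ : Eu d} {g : ℕ → Eu d → Ω → Eu q} {f : Eu d → Eu q} {G : Matrix (Fin q) (Fin d) ℝ}
    {Wn : ℕ → Eu d → Ω → Matrix (Fin q) (Fin q) ℝ} {W : Eu d → Matrix (Fin q) (Fin q) ℝ}

lemma ENNReal.exists_ofReal_le {e : ℝ≥0∞} (he : 0 < e) {ε : ℝ} (hε : 0 < ε) :
    ∃ ε' : ℝ, 0 < ε' ∧ ε' ≤ ε ∧ ENNReal.ofReal ε' ≤ e := by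
  obtain ⟨r, hr, hre⟩ := ENNReal.lt_iff_exists_nnreal_btwn.1 he
  refine ⟨min ε r, lt_min hε (by exact_mod_cast hr), min_le_left _ _, ?_⟩
  refine (ENNReal.ofReal_le_ofReal (min_le_right _ _)).trans ?_
  rw [ENNReal.ofReal_coe_nnreal]
  exact hre.le

/-- Near `θ₀` the normalized moments are linear in `√n (θ - θ₀)` up to a small relative error, and
the weights are close to `W θ₀`. -/
lemma MomentModel.linearization (h : MomentModel P Θ θ₀ g f G Wn W) {ε : ℝ} (hε : 0 < ε) :
    ∃ δ : ℝ, 0 < δ ∧ ∀ᶠ n : ℕ in atTop, P {ω | ¬ ∀ θ ∈ Θ, ‖θ - θ₀‖ ≤ δ →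
      ‖√(n : ℝ) • g n θ ω - (√(n : ℝ) • g n θ₀ ω + matVec G (√(n : ℝ) • (θ - θ₀)))‖ ≤
        ε * (1 + 2 * (√(n : ℝ) * ‖θ - θ₀‖)) ∧
      ∀ a b, |Wn n θ ω a b - W θ₀ a b| ≤ ε} ≤ ENNReal.ofReal ε := by
  obtain ⟨δ₁, hδ₁, hP₁⟩ := h.equicontinuous (ε / 2) (half_pos hε)
  have hP₂ := (ENNReal.tendsto_nhds_zero.1 (eventually_highProb.1
    (h.weight_tendsto (ε / 2) (half_pos hε)))) (ENNReal.ofReal (ε / 2)) (by simpa using hε)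
  have hd : ∀ᶠ θ in 𝓝 θ₀, ‖f θ - f θ₀ - matVecL G (θ - θ₀)‖ ≤ ε * ‖θ - θ₀‖ :=
    h.hasFDerivAt.isLittleO.def hε
  obtain ⟨δ₂, hδ₂, hball⟩ := Metric.eventually_nhds_iff.1 hd
  have hW : ∀ᶠ θ in 𝓝[Θ] θ₀, ∀ a b, |W θ a b - W θ₀ a b| < ε / 2 := by
    refine eventually_all.2 fun a => eventually_all.2 fun b => ?_
    have h1 : Tendsto (fun θ => W θ a b) (𝓝[Θ] θ₀) (𝓝 (W θ₀ a b)) :=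
      ((continuous_apply_apply a b).tendsto (W θ₀)).comp (h.weight_continuousOn θ₀ h.mem)
    exact Metric.tendsto_nhds.1 h1 _ (half_pos hε)
  rw [eventually_nhdsWithin_iff] at hW
  obtain ⟨δ₃, hδ₃, hball₃⟩ := Metric.eventually_nhds_iff.1 hW
  refine ⟨min δ₁ (min (δ₂ / 2) (δ₃ / 2)), by positivity, ?_⟩
  filter_upwards [hP₁, hP₂] with n h1 h2
  have hsub : {ω | ¬ ∀ θ ∈ Θ, ‖θ - θ₀‖ ≤ min δ₁ (min (δ₂ / 2) (δ₃ / 2)) →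
      ‖√(n : ℝ) • g n θ ω - (√(n : ℝ) • g n θ₀ ω + matVec G (√(n : ℝ) • (θ - θ₀)))‖ ≤
        ε * (1 + 2 * (√(n : ℝ) * ‖θ - θ₀‖)) ∧
      ∀ a b, |Wn n θ ω a b - W θ₀ a b| ≤ ε} ⊆
      {ω | (n, ω) ∉ equicontinuitySet Θ g f (ε / 2) δ₁} ∪
      {ω | ¬ ∀ θ ∈ Θ, ∀ a b, |Wn n θ ω a b - W θ a b| ≤ ε / 2} := by
    intro ω hω
    by_contra hc
    rw [Set.mem_union, not_or] at hc
    obtain ⟨hc1, hc2⟩ := hc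
    have hc1' : (n, ω) ∈ equicontinuitySet Θ g f (ε / 2) δ₁ := not_not.1 hc1
    have hc2' : ∀ θ ∈ Θ, ∀ a b, |Wn n θ ω a b - W θ a b| ≤ ε / 2 := not_not.1 hc2
    refine hω fun θ hθ hθδ => ⟨?_, fun a b => ?_⟩
    · have hθ1 := hθδ.trans (min_le_left _ _)
      have hθ2 : dist θ θ₀ < δ₂ := by
        rw [dist_eq_norm]
        have := hθδ.trans ((min_le_right _ _).trans (min_le_left _ _))
        linarith
      have h3 : √(n : ℝ) * ‖(g n θ ω - g n θ₀ ω) - (f θ - f θ₀)‖ ≤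
          ε / 2 * (1 + √(n : ℝ) * ‖θ - θ₀‖) := hc1' θ hθ θ₀ h.mem hθ1
      have h4 : ‖f θ - f θ₀ - matVec G (θ - θ₀)‖ ≤ ε * ‖θ - θ₀‖ := hball hθ2
      set s := √(n : ℝ)
      have hs : 0 ≤ s := Real.sqrt_nonneg _
      have h5 : s • g n θ ω - (s • g n θ₀ ω + matVec G (s • (θ - θ₀))) =
          s • ((g n θ ω - g n θ₀ ω) - (f θ - f θ₀)) +
            s • (f θ - f θ₀ - matVec G (θ - θ₀)) := by
        rw [matVec_smul]
        simp only [smul_sub]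
        abel
      rw [h5]
      refine (norm_add_le _ _).trans ?_
      rw [norm_smul, norm_smul, Real.norm_of_nonneg hs]
      have h6 : s * ‖f θ - f θ₀ - matVec G (θ - θ₀)‖ ≤ s * (ε * ‖θ - θ₀‖) := by gcongr
      have h7 : 0 ≤ ε * (s * ‖θ - θ₀‖) := by positivity
      linarith
    · have hθ3 : dist θ θ₀ < δ₃ := by
        rw [dist_eq_norm]
        have := hθδ.trans ((min_le_right _ _).trans (min_le_right _ _))
        linarith
      have h3 := hball₃ hθ3 hθ a b
      have h4 := hc2' θ hθ a b
      have h5 := abs_sub_le (Wn n θ ω a b) (W θ a b) (W θ₀ a b)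
      linarith
  calc _ ≤ _ := measure_mono hsub
    _ ≤ _ := measure_union_le _ _
    _ ≤ ENNReal.ofReal (ε / 2) + ENNReal.ofReal (ε / 2) := add_le_add h1 h2
    _ = ENNReal.ofReal ε := by
        rw [← ENNReal.ofReal_add (by positivity) (by positivity), add_halves]

/-- The remainder of the quadratic expansion is uniformly negligible in `n^{-1/2}`-neighbourhoods
of `θ₀`. -/
lemma MomentModel.remainder_near (h : MomentModel P Θ θ₀ g f G Wn W) (M : ℝ) {ε : ℝ}
    (hε : 0 < ε) :
    ∀ᶠ x in highProb P, ∀ θ ∈ Θ, ‖θ - θ₀‖ ≤ M / √(x.1 : ℝ) →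
      |expansionRemainder (quadCriterion g Wn) θ₀ (linScore g (Gᵀ * W θ₀) θ₀)
        (fun _ => Gᵀ * W θ₀ * G) x.1 θ x.2| ≤ ε := by
  have hM : 0 ≤ |M| := abs_nonneg M
  refine h.tight.eventually fun K => ?_
  set B := |K| + ‖matVecL G‖ * |M| with hB
  have hB0 : 0 ≤ B := by positivity
  set C := (‖matVecL (W θ₀)‖ + q ^ 2) *
    ((B ^ 2 + K ^ 2) + 2 * B * (1 + 2 * |M|) + (1 + 2 * |M|) ^ 2) with hC
  have hC0 : 0 ≤ C := by positivity
  set η := min 1 (ε / (C + 1)) with hη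
  have hη0 : 0 < η := by positivity
  have hη1 : η ≤ 1 := min_le_left _ _
  have hηC : η * C ≤ ε := by
    calc η * C ≤ ε / (C + 1) * (C + 1) := by
          gcongr
          · exact min_le_right _ _
          · linarith
      _ = ε := by field_simp
  have hlin : ∀ᶠ x in highProb P, ∀ θ ∈ Θ, ‖θ - θ₀‖ ≤ M / √(x.1 : ℝ) →
      ‖√(x.1 : ℝ) • g x.1 θ x.2 -
        (√(x.1 : ℝ) • g x.1 θ₀ x.2 + matVec G (√(x.1 : ℝ) • (θ - θ₀)))‖ ≤
        η * (1 + 2 * (√(x.1 : ℝ) * ‖θ - θ₀‖)) ∧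
      ∀ a b, |Wn x.1 θ x.2 a b - W θ₀ a b| ≤ η := by
    rw [eventually_highProb, ENNReal.tendsto_nhds_zero]
    intro e he
    -- The equicontinuity bound ties the size of the increments to the exceptional probability, so a
    -- smaller `η'` serves for both; the radius `δ` it needs is eventually larger than `M / √n`.
    obtain ⟨η', hη'0, hη'η, hη'e⟩ := ENNReal.exists_ofReal_le he hη0
    obtain ⟨δ, hδ, hP⟩ := h.linearization hη'0
    have hMδ : ∀ᶠ n : ℕ in atTop, M / √(n : ℝ) ≤ δ := by
      have : Tendsto (fun n : ℕ => M / √(n : ℝ)) atTop (𝓝 0) :=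
        tendsto_const_nhds.div_atTop (Real.tendsto_sqrt_atTop.comp tendsto_natCast_atTop_atTop)
      exact this.eventually_le_const hδ
    filter_upwards [hP, hMδ] with n hn hnδ
    refine (measure_mono ?_).trans (hn.trans hη'e)
    intro ω hω hc
    refine hω fun θ hθ hθM => ?_
    obtain ⟨h1, h2⟩ := hc θ hθ (hθM.trans hnδ)
    exact ⟨h1.trans (by gcongr), fun a b => (h2 a b).trans hη'η⟩
  filter_upwards [hlin, tendsto_fst_highProb.eventually_ge_atTop 1] with x hx hx1 hK θ hθ hθM
  have hs : 0 < √(x.1 : ℝ) := Real.sqrt_pos.2 (by exact_mod_cast hx1)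
  rw [expansionRemainder_quadCriterion (h.weight_posDef _ h.mem).transpose_eq]
  obtain ⟨h1, h2⟩ := hx θ hθ hθM
  have h3 := (hx θ₀ h.mem (by
    rw [sub_self, norm_zero]; exact (norm_nonneg _).trans hθM)).2
  have hK' : ‖√(x.1 : ℝ) • g x.1 θ₀ x.2‖ ≤ K := hK
  have hh : √(x.1 : ℝ) * ‖θ - θ₀‖ ≤ |M| := by
    rw [le_div_iff₀ hs] at hθM
    linarith [le_abs_self M]
  set Z := √(x.1 : ℝ) • g x.1 θ₀ x.2
  set Y := √(x.1 : ℝ) • g x.1 θ x.2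
  refine (abs_remainder_le hη1 h2 h3 _ Y Z).trans ?_
  set X := Z + matVec G (√(x.1 : ℝ) • (θ - θ₀)) with hX
  have hXB : ‖X‖ ≤ B := by
    refine (norm_add_le _ _).trans (add_le_add (hK'.trans (le_abs_self K)) ?_)
    refine (norm_matVec_le _ _).trans ?_
    rw [norm_smul, Real.norm_of_nonneg hs.le]
    gcongr
  have hZ2 : ‖Z‖ ^ 2 ≤ K ^ 2 := by gcongr
  have he : ‖Y - X‖ ≤ η * (1 + 2 * |M|) := h1.trans (by gcongr)
  calc _ ≤ (‖matVecL (W θ₀)‖ + q ^ 2) * (η * (B ^ 2 + K ^ 2) + 2 * B * (η * (1 + 2 * |M|)) +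
          (η * (1 + 2 * |M|)) ^ 2) := by gcongr
    _ ≤ (‖matVecL (W θ₀)‖ + q ^ 2) * (η * (B ^ 2 + K ^ 2) + 2 * B * (η * (1 + 2 * |M|)) +
          η * (1 + 2 * |M|) ^ 2) := by
        gcongr
        rw [mul_pow]
        gcongr
        nlinarith
    _ = η * C := by rw [hC]; ring
    _ ≤ ε := hηC

/-- The remainder of the quadratic expansion is small relative to `n |θ - θ₀|²` outside
`n^{-1/2}`-neighbourhoods of `θ₀`. -/
lemma MomentModel.remainder_far (h : MomentModel P Θ θ₀ g f G Wn W) {ε : ℝ} (hε : 0 < ε) :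
    ∃ δ : ℝ, 0 < δ ∧ ∃ M : ℝ, 0 < M ∧ ∀ᶠ n : ℕ in atTop,
      P {ω | ∃ θ ∈ Θ, M / √(n : ℝ) ≤ ‖θ - θ₀‖ ∧ ‖θ - θ₀‖ ≤ δ ∧
        ε < |expansionRemainder (quadCriterion g Wn) θ₀ (linScore g (Gᵀ * W θ₀) θ₀)
          (fun _ => Gᵀ * W θ₀ * G) n θ ω| / (n * ‖θ - θ₀‖ ^ 2)} ≤ ENNReal.ofReal (ε / 2) := by
  -- For `t = √n |θ - θ₀| ≥ max 1 K` all terms of the bound in `abs_remainder_le` are at most a constant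
  -- times `η t²`, because the normalized moments at `θ₀` are at most `K ≤ t`.
  set γ := ‖matVecL G‖
  set C := (‖matVecL (W θ₀)‖ + q ^ 2) * (((1 + γ) ^ 2 + 1) + 6 * (1 + γ) + 9) with hC
  have hC0 : 0 ≤ C := by positivity
  set η := min (min 1 (ε / 4)) (ε / (C + 1)) with hη
  have hη0 : 0 < η := by positivity
  have hη1 : η ≤ 1 := (min_le_left _ _).trans (min_le_left _ _)
  have hηC : η * C ≤ ε := by
    calc η * C ≤ ε / (C + 1) * (C + 1) := by
          gcongr
          · exact min_le_right _ _
          · linarith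
      _ = ε := by field_simp
  obtain ⟨K, hK⟩ := h.tight (ε / 4) (by positivity)
  obtain ⟨δ, hδ, hP⟩ := h.linearization hη0
  refine ⟨δ, hδ, max 1 K, by positivity, ?_⟩
  filter_upwards [hK, hP, eventually_ge_atTop 1] with n hn1 hn2 hn
  have hs : 0 < √(n : ℝ) := Real.sqrt_pos.2 (by exact_mod_cast hn)
  have hsub : {ω | ∃ θ ∈ Θ, max 1 K / √(n : ℝ) ≤ ‖θ - θ₀‖ ∧ ‖θ - θ₀‖ ≤ δ ∧
        ε < |expansionRemainder (quadCriterion g Wn) θ₀ (linScore g (Gᵀ * W θ₀) θ₀)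
          (fun _ => Gᵀ * W θ₀ * G) n θ ω| / (n * ‖θ - θ₀‖ ^ 2)} ⊆
      {ω | (n, ω) ∉ {x : ℕ × Ω | ‖√(x.1 : ℝ) • g x.1 θ₀ x.2‖ ≤ K}} ∪
      {ω | ¬ ∀ θ ∈ Θ, ‖θ - θ₀‖ ≤ δ →
      ‖√(n : ℝ) • g n θ ω - (√(n : ℝ) • g n θ₀ ω + matVec G (√(n : ℝ) • (θ - θ₀)))‖ ≤
        η * (1 + 2 * (√(n : ℝ) * ‖θ - θ₀‖)) ∧
      ∀ a b, |Wn n θ ω a b - W θ₀ a b| ≤ η} := by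
    rintro ω ⟨θ, hθ, hθM, hθδ, hθε⟩
    by_contra hc
    rw [Set.mem_union, not_or] at hc
    obtain ⟨hc1, hc2⟩ := hc
    have hc1' : ‖√(n : ℝ) • g n θ₀ ω‖ ≤ K := not_not.1 hc1
    have hc2' := not_not.1 hc2
    obtain ⟨h1, h2⟩ := hc2' θ hθ hθδ
    have h3 := (hc2' θ₀ h.mem (by rw [sub_self, norm_zero]; exact hδ.le)).2
    rw [div_le_iff₀ hs] at hθM
    rw [expansionRemainder_quadCriterion (h.weight_posDef _ h.mem).transpose_eq] at hθε
    have hbound := abs_remainder_le hη1 h2 h3 (√(n : ℝ) • g n θ₀ ω +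
      matVec G (√(n : ℝ) • (θ - θ₀))) (√(n : ℝ) • g n θ ω) (√(n : ℝ) • g n θ₀ ω)
    set Z := √(n : ℝ) • g n θ₀ ω
    set Y := √(n : ℝ) • g n θ ω
    set X := Z + matVec G (√(n : ℝ) • (θ - θ₀)) with hX
    set H := √(n : ℝ) * ‖θ - θ₀‖ with hH
    have hH1 : 1 ≤ H := by
      rw [hH]
      linarith [le_max_left 1 K]
    have hZH : ‖Z‖ ≤ H := by
      rw [hH]
      linarith [le_max_right 1 K]
    have hXH : ‖X‖ ≤ (1 + γ) * H := by
      refine (norm_add_le _ _).trans ?_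
      have := norm_matVec_le G (√(n : ℝ) • (θ - θ₀))
      rw [norm_smul, Real.norm_of_nonneg hs.le] at this
      linarith
    have heH : ‖Y - X‖ ≤ η * (3 * H) := h1.trans (by gcongr; linarith)
    have hnH : (n : ℝ) * ‖θ - θ₀‖ ^ 2 = H ^ 2 := by
      rw [hH, mul_pow, Real.sq_sqrt (Nat.cast_nonneg n)]
    rw [hnH] at hθε
    refine absurd hθε (not_lt.2 (div_le_of_le_mul₀ (by positivity) hε.le (hbound.trans ?_)))
    calc _ ≤ (‖matVecL (W θ₀)‖ + q ^ 2) * (η * (((1 + γ) * H) ^ 2 + H ^ 2) +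
            2 * ((1 + γ) * H) * (η * (3 * H)) + (η * (3 * H)) ^ 2) := by gcongr
      _ ≤ (‖matVecL (W θ₀)‖ + q ^ 2) * (η * (((1 + γ) * H) ^ 2 + H ^ 2) +
            2 * ((1 + γ) * H) * (η * (3 * H)) + η * (3 * H) ^ 2) := by
          gcongr
          rw [mul_pow]
          gcongr
          nlinarith
      _ = η * C * H ^ 2 := by rw [hC]; ring
      _ ≤ ε * H ^ 2 := by gcongr
  calc _ ≤ _ := measure_mono hsub
    _ ≤ _ := measure_union_le _ _
    _ ≤ ENNReal.ofReal (ε / 4) + ENNReal.ofReal (ε / 4) := add_le_add hn1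
        (hn2.trans (ENNReal.ofReal_le_ofReal ((min_le_left _ _).trans (min_le_right _ _))))
    _ = ENNReal.ofReal (ε / 2) := by
        rw [← ENNReal.ofReal_add (by positivity) (by positivity)]
        congr 1
        ring

end Linearization

/-! ### The local quasi-posterior -/

/-- The data of a quasi-Bayesian experiment: parameter space, true parameter, criterion, prior
weight, score and curvature. -/
structure QuasiBayes (Ω : Type*) (d : ℕ) where
  /-- Parameter space. -/
  Θ : Set (Eu d)
  /-- True parameter. -/
  θ₀ : Eu d
  /-- Criterion function. -/
  L : ℕ → Eu d → Ω → ℝ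
  /-- Prior weight. -/
  prior : Eu d → ℝ
  /-- Score at the true parameter. -/
  Δ : ℕ → Ω → Eu d
  /-- Curvature. -/
  J : Matrix (Fin d) (Fin d) ℝ

namespace QuasiBayes

section Definitions

variable {Ω : Type*} {d : ℕ} (B : QuasiBayes Ω d)

/-- The centering `U_n` of the local parameter, as a function of the pair `(n, ω)`. -/
noncomputable def U (x : ℕ × Ω) : Eu d := centering B.Δ (fun _ => B.J) x.1 x.2

/-- The parameter with local coordinate `h`. -/
noncomputable def param (x : ℕ × Ω) (h : Eu d) : Eu d :=
  B.θ₀ + (√(x.1 : ℝ))⁻¹ • (h + B.U x)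

/-- The remainder of the quadratic expansion of the criterion. -/
noncomputable def remainder (x : ℕ × Ω) (θ : Eu d) : ℝ :=
  expansionRemainder B.L B.θ₀ B.Δ (fun _ => B.J) x.1 θ x.2

/-- The unnormalized quasi-posterior weight, extended by zero outside the parameter space. The
factor that does not depend on the parameter is chosen so that the weight converges in local
coordinates. -/
noncomputable def weight (x : ℕ × Ω) : Eu d → ℝ :=
  B.Θ.indicator fun θ =>
    Real.exp (B.L x.1 θ x.2 - B.L x.1 B.θ₀ x.2 - 1 / 2 * quadForm B.J (B.U x)) * B.prior θ

/-- The unnormalized weight in local coordinates. -/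
noncomputable def localWeight (x : ℕ × Ω) (h : Eu d) : ℝ := B.weight x (B.param x h)

/-- The quasi-posterior density of the local parameter, extended by zero. -/
noncomputable def localDensity (x : ℕ × Ω) (h : Eu d) : ℝ :=
  B.localWeight x h / ∫ u, B.localWeight x u

/-- The limit of the unnormalized local weights. -/
noncomputable def limitWeight (h : Eu d) : ℝ :=
  B.prior B.θ₀ * Real.exp (-(1 / 2) * quadForm B.J h)

/-- The quasi-posterior density as a function of the pair `(n, ω)`. -/
noncomputable def posterior (x : ℕ × Ω) (θ : Eu d) : ℝ :=
  quasiPosterior B.Θ B.L B.prior x.1 x.2 θ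

end Definitions

/-- The conditions on a quasi-Bayesian experiment under which the quasi-posterior is asymptotically
normal: the local parameter is centred at a tight sequence, the criterion decreases at least
quadratically over the whole parameter space, and it is locally quadratic. -/
structure Regular {Ω : Type*} [MeasurableSpace Ω] (P : Measure Ω) {d : ℕ} (B : QuasiBayes Ω d) :
    Prop where
  param : ParameterAssumption B.Θ B.θ₀
  prior_continuousOn : ContinuousOn B.prior B.Θ
  prior_pos : ∃ c : ℝ, 0 < c ∧ ∀ θ ∈ B.Θ, c ≤ B.prior θ
  measurable : ∀ n ω, Measurable fun θ : B.Θ => B.L n θ ω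
  posDef : B.J.PosDef
  tight : ExhaustsInProb P fun K : ℝ => {x : ℕ × Ω | ‖B.U x‖ ≤ K}
  growth : ∃ c : ℝ, 0 < c ∧ ExhaustsInProb P fun K : ℝ => {x : ℕ × Ω | ∀ θ ∈ B.Θ,
    B.L x.1 θ x.2 - B.L x.1 B.θ₀ x.2 ≤ K - c * (x.1 * ‖θ - B.θ₀‖ ^ 2)}
  remainder : ∀ M ε : ℝ, 0 < ε → ∀ᶠ x in highProb P, ∀ θ ∈ B.Θ,
    ‖θ - B.θ₀‖ ≤ M / √(x.1 : ℝ) → |B.remainder x θ| ≤ ε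

section Local

variable {Ω : Type*} {d : ℕ} {B : QuasiBayes Ω d}

lemma sqrt_smul_param_sub {x : ℕ × Ω} (hx : x.1 ≠ 0) (h : Eu d) :
    √(x.1 : ℝ) • (B.param x h - B.θ₀) = h + B.U x := by
  have : √(x.1 : ℝ) ≠ 0 := (Real.sqrt_pos.2 (by exact_mod_cast Nat.pos_of_ne_zero hx)).ne'
  rw [param, add_sub_cancel_left, smul_smul, mul_inv_cancel₀ this, one_smul]

lemma norm_param_sub (x : ℕ × Ω) (h : Eu d) :
    ‖B.param x h - B.θ₀‖ = ‖h + B.U x‖ / √(x.1 : ℝ) := by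
  rw [param, add_sub_cancel_left, norm_smul, norm_inv, Real.norm_of_nonneg (Real.sqrt_nonneg _)]
  ring

lemma param_of_mem {x : ℕ × Ω} (hx : x.1 ≠ 0) (θ : Eu d) :
    B.param x (√(x.1 : ℝ) • (θ - B.θ₀) - B.U x) = θ := by
  have : √(x.1 : ℝ) ≠ 0 := (Real.sqrt_pos.2 (by exact_mod_cast Nat.pos_of_ne_zero hx)).ne'
  rw [param, sub_add_cancel, smul_smul, inv_mul_cancel₀ this, one_smul]
  abel

lemma continuous_param (x : ℕ × Ω) : Continuous (B.param x) := by
  unfold param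
  fun_prop

/-- Completing the square in the quadratic expansion. -/
lemma criterion_param (hJ : B.J.PosDef) {x : ℕ × Ω} (hx : x.1 ≠ 0) (h : Eu d) :
    B.L x.1 (B.param x h) x.2 - B.L x.1 B.θ₀ x.2 - 1 / 2 * quadForm B.J (B.U x) =
      -(1 / 2) * quadForm B.J h + B.remainder x (B.param x h) := by
  have hs : √(x.1 : ℝ) ≠ 0 := (Real.sqrt_pos.2 (by exact_mod_cast Nat.pos_of_ne_zero hx)).ne'
  have hΔ : B.Δ x.1 x.2 = √(x.1 : ℝ) • matVec B.J (B.U x) := by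
    rw [U, centering, matVec_smul, smul_smul, mul_inv_cancel₀ hs, one_smul, matVec_matVec,
      Matrix.mul_nonsing_inv _ (isUnit_det_of_posDef hJ), matVec_one]
  have h1 : (B.param x h - B.θ₀).ofLp ⬝ᵥ (B.Δ x.1 x.2).ofLp =
      inner ℝ (h + B.U x) (matVec B.J (B.U x)) := by
    rw [dotProduct_eq_inner, hΔ, inner_smul_right, ← sqrt_smul_param_sub hx, inner_smul_left]
    simp
  have h2 : quadForm ((x.1 : ℝ) • B.J) (B.param x h - B.θ₀) = quadForm B.J (h + B.U x) := by
    rw [← sqrt_smul_param_sub hx, quadForm_smul, smul_quadForm, Real.sq_sqrt (Nat.cast_nonneg _)]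
  have h3 : quadForm B.J (h + B.U x) = quadForm B.J h + 2 * inner ℝ h (matVec B.J (B.U x)) +
      quadForm B.J (B.U x) := by
    have : inner ℝ (B.U x) (matVec B.J h) = inner ℝ h (matVec B.J (B.U x)) := by
      rw [inner_matVec_of_transpose_eq hJ.transpose_eq, real_inner_comm]
    simp only [quadForm_eq_inner, matVec_add, inner_add_left, inner_add_right]
    linarith
  rw [remainder, expansionRemainder, h1, h2, h3, inner_add_left, quadForm_eq_inner B.J (B.U x)]
  ring

/-- Change of variables to the local parameter. -/
lemma integral_comp_param {F : Type*} [NormedAddCommGroup F] [NormedSpace ℝ F] {x : ℕ × Ω}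
    (f : Eu d → F) : ∫ h, f (B.param x h) = (√(x.1 : ℝ)) ^ d • ∫ θ, f θ := by
  have h1 : ∫ h, f (B.param x h) = ∫ h, f (B.θ₀ + (√(x.1 : ℝ))⁻¹ • h) :=
    integral_add_right_eq_self (fun h => f (B.θ₀ + (√(x.1 : ℝ))⁻¹ • h)) (B.U x)
  have h2 := Measure.integral_comp_inv_smul_of_nonneg (volume : Measure (Eu d))
    (fun h => f (B.θ₀ + h)) (R := √(x.1 : ℝ)) (Real.sqrt_nonneg _)
  rw [h1, h2, integral_add_left_eq_self, finrank_euclideanSpace_fin]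

lemma exp_mul_prior_eq {x : ℕ × Ω} {θ : Eu d} (hθ : θ ∈ B.Θ) :
    Real.exp (B.L x.1 θ x.2) * B.prior θ =
      Real.exp (B.L x.1 B.θ₀ x.2 + 1 / 2 * quadForm B.J (B.U x)) * B.weight x θ := by
  rw [weight, Set.indicator_of_mem hθ, ← mul_assoc, ← Real.exp_add]
  congr 2
  ring

lemma integral_exp_mul_prior (hΘ : MeasurableSet B.Θ) {x : ℕ × Ω} :
    ∫ t in B.Θ, Real.exp (B.L x.1 t x.2) * B.prior t =
      Real.exp (B.L x.1 B.θ₀ x.2 + 1 / 2 * quadForm B.J (B.U x)) * ∫ θ, B.weight x θ := by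
  rw [setIntegral_congr_fun hΘ fun θ hθ => exp_mul_prior_eq hθ, integral_const_mul, weight,
    setIntegral_indicator hΘ, Set.inter_self, integral_indicator hΘ]

lemma setIntegral_posterior_smul {F : Type*} [NormedAddCommGroup F] [NormedSpace ℝ F]
    (hΘ : MeasurableSet B.Θ) {x : ℕ × Ω} (hx : x.1 ≠ 0) (f : Eu d → F) :
    ∫ θ in B.Θ, B.posterior x θ • f θ = ∫ h, B.localDensity x h • f (B.param x h) := by
  have hs : √(x.1 : ℝ) ≠ 0 := (Real.sqrt_pos.2 (by exact_mod_cast Nat.pos_of_ne_zero hx)).ne'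
  have hw {θ : Eu d} (hθ : θ ∈ B.Θ) := exp_mul_prior_eq (x := x) hθ
  have hnorm := integral_exp_mul_prior (x := x) hΘ
  have hpost : ∀ θ ∈ B.Θ, B.posterior x θ • f θ =
      B.Θ.indicator (fun θ => (B.weight x θ / ∫ t, B.weight x t) • f θ) θ := by
    intro θ hθ
    rw [Set.indicator_of_mem hθ, posterior, quasiPosterior, hw hθ, hnorm,
      mul_div_mul_left _ _ (Real.exp_pos _).ne']
  have hind : B.Θ.indicator (fun θ => (B.weight x θ / ∫ t, B.weight x t) • f θ) =
      fun θ => (B.weight x θ / ∫ t, B.weight x t) • f θ := by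
    refine Set.indicator_eq_self.2 fun θ hθ => ?_
    by_contra hc
    refine hθ ?_
    simp [weight, Set.indicator_of_notMem hc]
  rw [setIntegral_congr_fun hΘ hpost, setIntegral_indicator hΘ, Set.inter_self,
    ← integral_indicator hΘ, hind]
  have h1 := B.integral_comp_param (x := x)
    (fun θ => (B.weight x θ / ∫ t, B.weight x t) • f θ)
  have h2 : ∫ u, B.localWeight x u = (√(x.1 : ℝ)) ^ d * ∫ t, B.weight x t :=
    B.integral_comp_param (B.weight x)
  have h3 : ∀ h, B.localDensity x h • f (B.param x h) = ((√(x.1 : ℝ)) ^ d)⁻¹ •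
      (B.weight x (B.param x h) / ∫ t, B.weight x t) • f (B.param x h) := by
    intro h
    rw [localDensity, h2, smul_smul, localWeight]
    congr 1
    rw [div_mul_eq_div_div_swap, div_eq_inv_mul]
  simp_rw [h3]
  rw [integral_smul, h1, smul_smul, inv_mul_cancel₀ (pow_ne_zero _ hs), one_smul]

lemma localPosterior_eq (hΘ : MeasurableSet B.Θ) {x : ℕ × Ω} {h : Eu d}
    (hh : B.param x h ∈ B.Θ) :
    localPosterior B.Θ B.θ₀ B.L B.prior B.Δ (fun _ => B.J) x.1 x.2 h = B.localDensity x h := by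
  have hw {θ : Eu d} (hθ : θ ∈ B.Θ) := exp_mul_prior_eq (x := x) hθ
  have hnorm := integral_exp_mul_prior (x := x) hΘ
  have h2 : ∫ u, B.localWeight x u = (√(x.1 : ℝ)) ^ d * ∫ t, B.weight x t :=
    B.integral_comp_param (B.weight x)
  have h4 : quasiPosterior B.Θ B.L B.prior x.1 x.2 (B.param x h) =
      B.localWeight x h / ∫ t, B.weight x t := by
    rw [quasiPosterior, hw hh, hnorm, mul_div_mul_left _ _ (Real.exp_pos _).ne', localWeight]
  calc _ = ((√(x.1 : ℝ))⁻¹) ^ d * quasiPosterior B.Θ B.L B.prior x.1 x.2 (B.param x h) := rfl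
    _ = B.localDensity x h := by
      rw [h4, localDensity, h2, div_mul_eq_div_div_swap, div_eq_inv_mul (_ / _), inv_pow]

lemma mem_localRange_iff {x : ℕ × Ω} (hx : x.1 ≠ 0) {h : Eu d} :
    h ∈ localRange B.Θ B.θ₀ B.Δ (fun _ => B.J) x.1 x.2 ↔ B.param x h ∈ B.Θ := by
  constructor
  · rintro ⟨θ, hθ, rfl⟩
    have := B.param_of_mem hx θ
    rw [U] at this
    rwa [this]
  · intro hh
    refine ⟨_, hh, ?_⟩
    change √(x.1 : ℝ) • (B.param x h - B.θ₀) - B.U x = h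
    rw [sqrt_smul_param_sub hx, add_sub_cancel_right]

lemma limitWeight_eq (hJ : B.J.PosDef) (u : Eu d) :
    B.limitWeight u = B.prior B.θ₀ / √(B.J.det / (2 * Real.pi) ^ d) * limitDensity B.J u := by
  have : 0 < √(B.J.det / (2 * Real.pi) ^ d) :=
    Real.sqrt_pos.2 (by have := hJ.det_pos; positivity)
  rw [limitWeight, limitDensity]
  field_simp

lemma integral_limitWeight (hJ : B.J.PosDef) :
    ∫ u, B.limitWeight u = B.prior B.θ₀ / √(B.J.det / (2 * Real.pi) ^ d) := by
  simp_rw [limitWeight_eq hJ, integral_const_mul, integral_limitDensity hJ, mul_one]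

lemma integrable_mul_limitWeight (hJ : B.J.PosDef) {α : ℝ} (hα : 0 ≤ α) :
    Integrable fun u => (1 + ‖u‖ ^ α) * B.limitWeight u := by
  refine ((integrable_rpow_mul_limitDensity hJ hα).const_mul
    (B.prior B.θ₀ / √(B.J.det / (2 * Real.pi) ^ d))).congr (ae_of_all _ fun u => ?_)
  simp only [limitWeight_eq hJ u]
  ring

lemma integrable_limitWeight (hJ : B.J.PosDef) : Integrable B.limitWeight := by
  refine ((integrable_mul_limitWeight hJ le_rfl).const_mul (1 / 2)).congr
    (ae_of_all _ fun u => ?_)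
  simp only [Real.rpow_zero]
  ring

lemma quasiRisk_eq (hΘ : MeasurableSet B.Θ) {x : ℕ × Ω} (hx : x.1 ≠ 0) (ρ : Eu d → ℝ)
    (ζ : Eu d) : quasiRisk B.Θ B.L B.prior ρ x.1 x.2 ζ =
      ∫ u, ρ (u - (√(x.1 : ℝ) • (ζ - B.θ₀) - B.U x)) * B.localDensity x u := by
  have h1 := setIntegral_posterior_smul hΘ hx fun θ => ρ (√(x.1 : ℝ) • (θ - ζ))
  have h2 : ∀ u, √(x.1 : ℝ) • (B.param x u - ζ) =
      u - (√(x.1 : ℝ) • (ζ - B.θ₀) - B.U x) := by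
    intro u
    have : B.param x u - ζ = (B.param x u - B.θ₀) - (ζ - B.θ₀) := by abel
    rw [this, smul_sub, sqrt_smul_param_sub hx]
    abel
  simp_rw [h2] at h1
  rw [quasiRisk]
  simp only [smul_eq_mul, posterior] at h1
  simp_rw [mul_comm (ρ _)]
  exact h1

end Local

end QuasiBayes

/-! ### Convergence of the local quasi-posterior in total variation of moments -/

namespace QuasiBayes

section Convergence

variable {Ω : Type*} [MeasurableSpace Ω] {P : Measure Ω} {d : ℕ} {B : QuasiBayes Ω d}

lemma Regular.measurableSet (h : B.Regular P) : MeasurableSet B.Θ :=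
  h.param.compact.isClosed.measurableSet

lemma Regular.mem (h : B.Regular P) : B.θ₀ ∈ B.Θ := interior_subset h.param.interior

lemma Regular.measurable_weight (h : B.Regular P) (x : ℕ × Ω) : Measurable (B.weight x) := by
  refine measurable_of_restrict_of_restrict_compl h.measurableSet ?_ ?_
  · have h1 : Measurable fun θ : B.Θ => B.prior θ :=
      (continuousOn_iff_continuous_domRestrict.1 h.prior_continuousOn).measurable
    have h2 : Measurable fun θ : B.Θ =>
        Real.exp (B.L x.1 θ x.2 - B.L x.1 B.θ₀ x.2 - 1 / 2 * quadForm B.J (B.U x)) * B.prior θ :=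
      (Real.measurable_exp.comp (((h.measurable x.1 x.2).sub_const _).sub_const _)).mul h1
    convert h2 using 1
    ext θ
    simp [weight, Set.domRestrict_apply]
  · have : (B.Θᶜ).domRestrict (B.weight x) = fun _ => 0 := by
      ext θ
      have h0 : B.weight x θ = 0 := Set.indicator_of_notMem θ.2 _
      simpa [Set.domRestrict_apply] using h0
    rw [this]
    exact measurable_const

lemma Regular.measurable_localWeight (h : B.Regular P) (x : ℕ × Ω) :
    Measurable (B.localWeight x) :=
  (h.measurable_weight x).comp (continuous_param x).measurable

lemma Regular.prior_nonneg (h : B.Regular P) {θ : Eu d} (hθ : θ ∈ B.Θ) : 0 ≤ B.prior θ := by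
  obtain ⟨c, hc, hcp⟩ := h.prior_pos
  exact hc.le.trans (hcp θ hθ)

lemma Regular.prior_θ₀_pos (h : B.Regular P) : 0 < B.prior B.θ₀ := by
  obtain ⟨c, hc, hcp⟩ := h.prior_pos
  exact hc.trans_le (hcp _ h.mem)

lemma Regular.localWeight_nonneg (h : B.Regular P) (x : ℕ × Ω) (u : Eu d) :
    0 ≤ B.localWeight x u :=
  Set.indicator_nonneg (fun _ hθ => mul_nonneg (Real.exp_pos _).le (h.prior_nonneg hθ)) _

lemma Regular.localDensity_nonneg (h : B.Regular P) (x : ℕ × Ω) (u : Eu d) :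
    0 ≤ B.localDensity x u :=
  div_nonneg (h.localWeight_nonneg x u) (integral_nonneg fun v => h.localWeight_nonneg x v)

/-- Gaussian domination of the local weights, with constants that depend only on the bounds for the
stochastically bounded quantities. -/
lemma Regular.exists_localWeight_le (h : B.Regular P) {c K K' : ℝ} (hc : 0 < c) :
    ∃ C : ℝ, 0 ≤ C ∧ ∀ x : ℕ × Ω, x.1 ≠ 0 → ‖B.U x‖ ≤ K → (∀ θ ∈ B.Θ,
      B.L x.1 θ x.2 - B.L x.1 B.θ₀ x.2 ≤ K' - c * (x.1 * ‖θ - B.θ₀‖ ^ 2)) →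
      ∀ u, B.localWeight x u ≤ C * Real.exp (-(c / 2) * ‖u‖ ^ 2) := by
  obtain ⟨Q, hQ⟩ := h.param.compact.exists_bound_of_continuousOn h.prior_continuousOn
  have hQ0 : 0 ≤ Q := (norm_nonneg _).trans (hQ _ h.mem)
  refine ⟨Real.exp (K' + c * K ^ 2) * Q, by positivity, fun x hx hU hg u => ?_⟩
  by_cases hu : B.param x u ∈ B.Θ
  · rw [localWeight, weight, Set.indicator_of_mem hu]
    have h1 := hg _ hu
    have h2 : (x.1 : ℝ) * ‖B.param x u - B.θ₀‖ ^ 2 = ‖u + B.U x‖ ^ 2 := by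
      rw [norm_param_sub, div_pow, Real.sq_sqrt (Nat.cast_nonneg _)]
      have : (x.1 : ℝ) ≠ 0 := by exact_mod_cast hx
      field_simp
    rw [h2] at h1
    -- The growth bound is centred at `-U`; recentring at `0` halves the exponent.
    have h3 : ‖u‖ ^ 2 ≤ 2 * ‖u + B.U x‖ ^ 2 + 2 * K ^ 2 := by
      have h4 : ‖u‖ ≤ ‖u + B.U x‖ + ‖B.U x‖ := by
        have := norm_sub_le (u + B.U x) (B.U x)
        rwa [add_sub_cancel_right] at this
      have h5 : ‖u‖ ^ 2 ≤ (‖u + B.U x‖ + K) ^ 2 := by gcongr; linarith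
      nlinarith [sq_nonneg (‖u + B.U x‖ - K)]
    have h6 := h.posDef.quadForm_nonneg (B.U x)
    have h7 : B.prior (B.param x u) ≤ Q := (le_abs_self _).trans (hQ _ hu)
    rw [mul_assoc, mul_comm Q, ← mul_assoc, ← Real.exp_add]
    refine mul_le_mul ?_ h7 (h.prior_nonneg hu) (Real.exp_pos _).le
    rw [Real.exp_le_exp]
    nlinarith
  · rw [localWeight, weight, Set.indicator_of_notMem hu]
    positivity

lemma Regular.integrable_mul_localWeight (h : B.Regular P) {α : ℝ} (hα : 0 ≤ α) :
    ∀ᶠ x in highProb P, Integrable fun u => (1 + ‖u‖ ^ α) * B.localWeight x u := by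
  obtain ⟨c, hc, hg⟩ := h.growth
  refine (h.tight.inter hg).eventually fun k => ?_
  obtain ⟨C, hC, hbound⟩ := h.exists_localWeight_le (K := k.1) (K' := k.2) hc
  filter_upwards [tendsto_fst_highProb.eventually_ge_atTop 1] with x hx hk
  refine ((integrable_rpow_mul_exp (half_pos hc) hα).const_mul C).mono' ?_
    (ae_of_all _ fun u => ?_)
  · have := h.measurable_localWeight x
    exact Measurable.aestronglyMeasurable (by fun_prop)
  · rw [Real.norm_of_nonneg (mul_nonneg (by positivity) (h.localWeight_nonneg x u)), mul_left_comm]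
    exact mul_le_mul_of_nonneg_left (hbound x (by omega) hk.1 hk.2 u) (by positivity)

lemma Regular.tendsto_localWeight (h : B.Regular P) {l : Filter (ℕ × Ω)} {K : ℝ}
    (hfst : Tendsto Prod.fst l atTop) (hU : ∀ᶠ x in l, ‖B.U x‖ ≤ K)
    (hrem : ∀ M ε : ℝ, 0 < ε → ∀ᶠ x in l, ∀ θ ∈ B.Θ,
      ‖θ - B.θ₀‖ ≤ M / √(x.1 : ℝ) → |B.remainder x θ| ≤ ε) (u : Eu d) :
    Tendsto (fun x => B.localWeight x u) l (𝓝 (B.limitWeight u)) := by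
  have hnorm : ∀ᶠ x in l, ‖B.param x u - B.θ₀‖ ≤ (‖u‖ + K) / √(x.1 : ℝ) := by
    filter_upwards [hU] with x hx
    rw [norm_param_sub]
    gcongr
    exact (norm_add_le _ _).trans (by gcongr)
  have hsmall : Tendsto (fun x : ℕ × Ω => (‖u‖ + K) / √(x.1 : ℝ)) l (𝓝 0) :=
    tendsto_const_nhds.div_atTop
      (Real.tendsto_sqrt_atTop.comp (tendsto_natCast_atTop_atTop.comp hfst))
  have hparam : Tendsto (fun x => B.param x u) l (𝓝 B.θ₀) := by
    rw [tendsto_iff_norm_sub_tendsto_zero]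
    exact squeeze_zero' (Eventually.of_forall fun x => norm_nonneg _) hnorm hsmall
  have hmem : ∀ᶠ x in l, B.param x u ∈ B.Θ :=
    hparam.eventually (mem_interior_iff_mem_nhds.1 h.param.interior)
  have hR : Tendsto (fun x => B.remainder x (B.param x u)) l (𝓝 0) := by
    rw [Metric.tendsto_nhds]
    intro ε hε
    filter_upwards [hrem (‖u‖ + K) (ε / 2) (half_pos hε), hmem, hnorm] with x h1 h2 h3
    rw [Real.dist_0_eq_abs]
    exact (h1 _ h2 h3).trans_lt (half_lt_self hε)
  have hprior : Tendsto (fun x => B.prior (B.param x u)) l (𝓝 (B.prior B.θ₀)) :=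
    (h.prior_continuousOn.continuousAt
      (mem_interior_iff_mem_nhds.1 h.param.interior)).tendsto.comp hparam
  have hlim : Tendsto (fun x => Real.exp (-(1 / 2) * quadForm B.J u +
      B.remainder x (B.param x u)) * B.prior (B.param x u)) l (𝓝 (B.limitWeight u)) := by
    have h1 : Tendsto (fun x => -(1 / 2) * quadForm B.J u + B.remainder x (B.param x u)) l
        (𝓝 (-(1 / 2) * quadForm B.J u + 0)) := tendsto_const_nhds.add hR
    have h2 := ((Real.continuous_exp.tendsto _).comp h1).mul hprior
    rw [add_zero] at h2
    rw [limitWeight, mul_comm (B.prior B.θ₀)]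
    exact h2
  refine hlim.congr' ?_
  filter_upwards [hmem, hfst.eventually_ge_atTop 1] with x h1 h2
  rw [localWeight, weight, Set.indicator_of_mem h1, criterion_param h.posDef (by omega)]

/-- The local weights converge to the limit weight in every weighted `L¹` norm. The dominated
convergence theorem applies along the countably generated filter spanned by the bounds that it
needs, and that filter is coarser than `highProb P` on each set of an exhausting family. -/
lemma Regular.tendsto_integral_localWeight (h : B.Regular P) {α : ℝ} (hα : 0 ≤ α) :
    Tendsto (fun x => ∫ u, (1 + ‖u‖ ^ α) * |B.localWeight x u - B.limitWeight u|) (highProb P)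
      (𝓝 0) := by
  obtain ⟨c, hc, hg⟩ := h.growth
  refine (h.tight.inter hg).tendsto fun k => ?_
  obtain ⟨C, hC, hbound⟩ := h.exists_localWeight_le (K := k.1) (K' := k.2) hc
  set A : Set (ℕ × Ω) := {x : ℕ × Ω | ‖B.U x‖ ≤ k.1} ∩ {x : ℕ × Ω | ∀ θ ∈ B.Θ,
    B.L x.1 θ x.2 - B.L x.1 B.θ₀ x.2 ≤ k.2 - c * (x.1 * ‖θ - B.θ₀‖ ^ 2)} with hA
  -- The bounds on the remainder are needed only for the radii and tolerances `j` and `1 / (j + 1)`.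
  set R : ℕ → Set (ℕ × Ω) := fun j => {x | ∀ θ ∈ B.Θ, ‖θ - B.θ₀‖ ≤ j / √(x.1 : ℝ) →
    |B.remainder x θ| ≤ 1 / ((j : ℝ) + 1)} with hR
  set l : Filter (ℕ × Ω) := comap Prod.fst atTop ⊓ (⨅ j, 𝓟 (R j)) ⊓ 𝓟 A with hl
  have hle : highProb P ⊓ 𝓟 A ≤ l := by
    refine inf_le_inf_right _ (le_inf (map_le_iff_le_comap.1 tendsto_fst_highProb) ?_)
    exact le_iInf fun j => le_principal_iff.2 (h.remainder j _ (by positivity))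
  refine Tendsto.mono_left ?_ hle
  have hcg : l.IsCountablyGenerated := by
    rw [hl]
    infer_instance
  have hfst : Tendsto Prod.fst l atTop :=
    tendsto_comap.mono_left (inf_le_left.trans inf_le_left)
  have hAl : ∀ᶠ x in l, x ∈ A := mem_inf_of_right (mem_principal_self A)
  have hrem : ∀ M ε : ℝ, 0 < ε → ∀ᶠ x in l, ∀ θ ∈ B.Θ,
      ‖θ - B.θ₀‖ ≤ M / √(x.1 : ℝ) → |B.remainder x θ| ≤ ε := by
    intro M ε hε
    obtain ⟨j₁, hj₁⟩ := exists_nat_ge M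
    obtain ⟨j₂, hj₂⟩ := exists_nat_one_div_lt hε
    have hj : ∀ᶠ x in l, x ∈ R (max j₁ j₂) :=
      (inf_le_left.trans inf_le_right : l ≤ ⨅ j, 𝓟 (R j))
        (mem_iInf_of_mem (max j₁ j₂) (mem_principal_self _))
    filter_upwards [hj] with x hx θ hθ hθM
    refine (hx θ hθ (hθM.trans ?_)).trans (le_trans ?_ hj₂.le)
    · gcongr
      exact hj₁.trans (by exact_mod_cast le_max_left _ _)
    · gcongr
      exact le_max_right _ _
  obtain ⟨c', hc', hJ⟩ := h.posDef.exists_le_quadForm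
  have hlimint := integrable_mul_limitWeight h.posDef hα
  have hlim0 : ∀ u, 0 ≤ B.limitWeight u := fun u =>
    mul_nonneg h.prior_θ₀_pos.le (Real.exp_pos _).le
  have hmlim : Measurable B.limitWeight := by
    have := (continuous_quadForm B.J).measurable
    unfold limitWeight
    fun_prop
  have key := tendsto_integral_filter_of_dominated_convergence (μ := volume) (l := l)
    (F := fun x u => (1 + ‖u‖ ^ α) * |B.localWeight x u - B.limitWeight u|) (f := fun _ => 0)
    (fun u => C * ((1 + ‖u‖ ^ α) * Real.exp (-(c / 2) * ‖u‖ ^ 2)) +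
      (1 + ‖u‖ ^ α) * B.limitWeight u) ?_ ?_ ?_ ?_
  · simpa using key
  · refine Eventually.of_forall fun x => ?_
    have := h.measurable_localWeight x
    exact Measurable.aestronglyMeasurable (by fun_prop)
  · filter_upwards [hAl, hfst.eventually_ge_atTop 1] with x hx hx1
    refine ae_of_all _ fun u => ?_
    have h0 : 0 ≤ 1 + ‖u‖ ^ α := by positivity
    rw [Real.norm_of_nonneg (by positivity), mul_left_comm, ← mul_add]
    refine mul_le_mul_of_nonneg_left ?_ h0
    have h1 := hbound x (by omega) hx.1 hx.2 u
    have h2 := h.localWeight_nonneg x u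
    rw [abs_le]
    constructor <;> linarith [hlim0 u, mul_nonneg hC (Real.exp_pos (-(c / 2) * ‖u‖ ^ 2)).le]
  · exact ((integrable_rpow_mul_exp (half_pos hc) hα).const_mul C).add hlimint
  · refine ae_of_all _ fun u => ?_
    have h1 := h.tendsto_localWeight hfst (hAl.mono fun x hx => hx.1) hrem u
    have h2 := ((h1.sub_const (B.limitWeight u)).abs).const_mul (1 + ‖u‖ ^ α)
    simpa using h2

lemma Regular.integrable_localWeight (h : B.Regular P) :
    ∀ᶠ x in highProb P, Integrable (B.localWeight x) := by
  filter_upwards [h.integrable_mul_localWeight le_rfl] with x hx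
  refine (hx.const_mul (1 / 2)).congr (ae_of_all _ fun u => ?_)
  simp only [Real.rpow_zero]
  ring

lemma Regular.tendsto_normalizer (h : B.Regular P) :
    Tendsto (fun x => ∫ u, B.localWeight x u) (highProb P) (𝓝 (∫ u, B.limitWeight u)) := by
  rw [tendsto_iff_norm_sub_tendsto_zero]
  refine squeeze_zero' (Eventually.of_forall fun x => norm_nonneg _) ?_
    (h.tendsto_integral_localWeight le_rfl)
  filter_upwards [h.integrable_localWeight] with x hx
  rw [← integral_sub hx (integrable_limitWeight h.posDef)]
  refine (norm_integral_le_integral_norm _).trans ?_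
  have hi := (hx.sub (integrable_limitWeight h.posDef)).norm
  refine integral_mono hi ?_ fun u => ?_
  · refine (hi.const_mul 2).congr (ae_of_all _ fun u => ?_)
    simp only [Real.rpow_zero, Pi.sub_apply, Real.norm_eq_abs]
    ring
  · simp only [Real.rpow_zero, Real.norm_eq_abs]
    linarith [abs_nonneg (B.localWeight x u - B.limitWeight u)]

lemma Regular.integral_limitWeight_pos (h : B.Regular P) : 0 < ∫ u, B.limitWeight u := by
  rw [integral_limitWeight h.posDef]
  exact div_pos h.prior_θ₀_pos (Real.sqrt_pos.2 (by have := h.posDef.det_pos; positivity))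

lemma Regular.limitDensity_eq (h : B.Regular P) (u : Eu d) :
    limitDensity B.J u = B.limitWeight u / ∫ v, B.limitWeight v := by
  have := h.integral_limitWeight_pos
  rw [integral_limitWeight h.posDef] at this ⊢
  rw [limitWeight_eq h.posDef, mul_comm, mul_div_cancel_right₀ _ this.ne']

lemma Regular.integrable_mul_localDensity (h : B.Regular P) {α : ℝ} (hα : 0 ≤ α) :
    ∀ᶠ x in highProb P, Integrable fun u => (1 + ‖u‖ ^ α) * B.localDensity x u := by
  filter_upwards [h.integrable_mul_localWeight hα] with x hx
  refine (hx.div_const (∫ u, B.localWeight x u)).congr (ae_of_all _ fun u => ?_)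
  simp only [localDensity]
  ring

lemma Regular.integral_localDensity (h : B.Regular P) :
    ∀ᶠ x in highProb P, ∫ u, B.localDensity x u = 1 := by
  filter_upwards [h.tendsto_normalizer.eventually_const_lt h.integral_limitWeight_pos] with x hx
  simp only [localDensity]
  rw [integral_div, div_self hx.ne']

lemma Regular.integrable_mul_abs_sub (h : B.Regular P) {α : ℝ} (hα : 0 ≤ α) :
    ∀ᶠ x in highProb P,
      Integrable fun u => (1 + ‖u‖ ^ α) * |B.localDensity x u - limitDensity B.J u| := by
  filter_upwards [h.integrable_mul_localDensity hα] with x hx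
  refine (hx.sub (integrable_rpow_mul_limitDensity h.posDef hα)).abs.congr
    (ae_of_all _ fun u => ?_)
  simp only [Pi.sub_apply, ← mul_sub]
  rw [abs_mul, abs_of_nonneg (a := 1 + ‖u‖ ^ α) (by positivity)]

/-- Convergence of the local quasi-posterior density in total variation of moments, over the whole
space. -/
theorem Regular.tendsto_tvm (h : B.Regular P) {α : ℝ} (hα : 0 ≤ α) :
    Tendsto (fun x => ∫ u, (1 + ‖u‖ ^ α) * |B.localDensity x u - limitDensity B.J u|)
      (highProb P) (𝓝 0) := by
  set c := ∫ u, B.limitWeight u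
  have hc : 0 < c := h.integral_limitWeight_pos
  have hN : Tendsto _ _ (𝓝 c) := h.tendsto_normalizer
  have hD := h.tendsto_integral_localWeight hα
  have hlim : Tendsto (fun x => (∫ u, B.localWeight x u)⁻¹ *
      (∫ u, (1 + ‖u‖ ^ α) * |B.localWeight x u - B.limitWeight u|) +
      |(∫ u, B.localWeight x u)⁻¹ - c⁻¹| * ∫ u, (1 + ‖u‖ ^ α) * B.limitWeight u)
      (highProb P) (𝓝 0) := by
    have h1 := hN.inv₀ hc.ne'
    have h2 := (h1.mul hD).add (((h1.sub_const c⁻¹).abs).mul_const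
      (∫ u, (1 + ‖u‖ ^ α) * B.limitWeight u))
    simpa using h2
  refine squeeze_zero' (Eventually.of_forall fun x => integral_nonneg fun u => by positivity) ?_
    hlim
  filter_upwards [h.integrable_mul_localWeight hα, hN.eventually_const_lt hc,
    h.integrable_mul_abs_sub hα] with x hx hpos hi
  have hli := integrable_mul_limitWeight h.posDef hα
  have hi2 : Integrable fun u => (1 + ‖u‖ ^ α) * |B.localWeight x u - B.limitWeight u| := by
    refine (hx.sub hli).abs.congr (ae_of_all _ fun u => ?_)
    simp only [Pi.sub_apply, ← mul_sub]
    rw [abs_mul, abs_of_nonneg (a := 1 + ‖u‖ ^ α) (by positivity)]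
  rw [← integral_const_mul, ← integral_const_mul,
    ← integral_add (hi2.const_mul _) (hli.const_mul _)]
  refine integral_mono hi ((hi2.const_mul _).add (hli.const_mul _)) fun u => ?_
  have hlw : 0 ≤ B.limitWeight u := mul_nonneg h.prior_θ₀_pos.le (Real.exp_pos _).le
  have h0 : 0 ≤ 1 + ‖u‖ ^ α := by positivity
  have h1 : |B.localDensity x u - limitDensity B.J u| ≤
      (∫ u, B.localWeight x u)⁻¹ * |B.localWeight x u - B.limitWeight u| +
      |(∫ u, B.localWeight x u)⁻¹ - c⁻¹| * B.limitWeight u := by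
    rw [h.limitDensity_eq u, localDensity]
    have h2 : B.localWeight x u / (∫ v, B.localWeight x v) - B.limitWeight u / c =
        (∫ v, B.localWeight x v)⁻¹ * (B.localWeight x u - B.limitWeight u) +
        ((∫ v, B.localWeight x v)⁻¹ - c⁻¹) * B.limitWeight u := by ring
    rw [h2]
    refine (abs_add_le _ _).trans ?_
    rw [abs_mul, abs_mul, abs_of_nonneg (inv_pos.2 hpos).le, abs_of_nonneg hlw]
  calc (1 + ‖u‖ ^ α) * |B.localDensity x u - limitDensity B.J u| ≤ (1 + ‖u‖ ^ α) * _ :=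
        mul_le_mul_of_nonneg_left h1 h0
    _ = _ := by ring

/-- The `TVMConvergence` conclusion for a regular experiment. -/
theorem Regular.tvmConvergence (h : B.Regular P) :
    TVMConvergence P B.Θ B.θ₀ B.L B.prior B.Δ (fun _ => B.J) := by
  intro α hα ε hε
  have hev : ∀ᶠ x in highProb P, ¬ ENNReal.ofReal ε ≤
      ∫⁻ u in localRange B.Θ B.θ₀ B.Δ (fun _ => B.J) x.1 x.2, ENNReal.ofReal ((1 + ‖u‖ ^ α) *
        |localPosterior B.Θ B.θ₀ B.L B.prior B.Δ (fun _ => B.J) x.1 x.2 u -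
          limitDensity B.J u|) := by
    filter_upwards [(h.tendsto_tvm hα).eventually_lt_const hε, h.integrable_mul_abs_sub hα,
      tendsto_fst_highProb.eventually_ge_atTop 1] with x hx hi hx1
    rw [not_le]
    have hx0 : x.1 ≠ 0 := by omega
    have hms : MeasurableSet (localRange B.Θ B.θ₀ B.Δ (fun _ => B.J) x.1 x.2) := by
      have : localRange B.Θ B.θ₀ B.Δ (fun _ => B.J) x.1 x.2 = B.param x ⁻¹' B.Θ := by
        ext u
        exact mem_localRange_iff hx0
      rw [this]
      exact (continuous_param x).measurable h.measurableSet
    calc _ = ∫⁻ u in localRange B.Θ B.θ₀ B.Δ (fun _ => B.J) x.1 x.2,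
          ENNReal.ofReal ((1 + ‖u‖ ^ α) * |B.localDensity x u - limitDensity B.J u|) := by
          refine setLIntegral_congr_fun hms fun u hu => ?_
          rw [localPosterior_eq h.measurableSet ((mem_localRange_iff hx0).1 hu)]
      _ ≤ ∫⁻ u, ENNReal.ofReal ((1 + ‖u‖ ^ α) * |B.localDensity x u - limitDensity B.J u|) :=
          setLIntegral_le_lintegral _ _
      _ = ENNReal.ofReal (∫ u, (1 + ‖u‖ ^ α) * |B.localDensity x u - limitDensity B.J u|) :=
          (ofReal_integral_eq_lintegral_ofReal hi (ae_of_all _ fun u => by positivity)).symm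
      _ < ENNReal.ofReal ε := (ENNReal.ofReal_lt_ofReal_iff hε).2 hx
  have := eventually_highProb.1 hev
  simpa only [not_not] using this

end Convergence

end QuasiBayes

/-! ### Laplace type estimators -/

section ConvexRisk

variable {d : ℕ} {ρ φ : Eu d → ℝ}

lemma rpow_norm_sub_le {p R : ℝ} (hp : 0 ≤ p) {u z : Eu d} (hz : ‖z‖ ≤ R) :
    1 + ‖u - z‖ ^ p ≤ (1 + 2 ^ p * (1 + R ^ p)) * (1 + ‖u‖ ^ p) := by
  have hR : 0 ≤ R := (norm_nonneg z).trans hz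
  have h1 : ‖u - z‖ ≤ 2 * max ‖u‖ R := by
    have := norm_sub_le u z
    have h2 := le_max_left ‖u‖ R
    have h3 := le_max_right ‖u‖ R
    linarith
  have h2 : ‖u - z‖ ^ p ≤ 2 ^ p * (‖u‖ ^ p + R ^ p) := by
    calc ‖u - z‖ ^ p ≤ (2 * max ‖u‖ R) ^ p := by gcongr
      _ = 2 ^ p * (max ‖u‖ R) ^ p := Real.mul_rpow (by norm_num) (by positivity)
      _ ≤ _ := by
        gcongr
        rcases max_choice ‖u‖ R with h | h <;> rw [h]
        · linarith [Real.rpow_nonneg hR p]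
        · linarith [Real.rpow_nonneg (norm_nonneg u) p]
  have h3 : 0 ≤ ‖u‖ ^ p := by positivity
  have h4 : 0 ≤ (2 : ℝ) ^ p * R ^ p * ‖u‖ ^ p := by positivity
  have h5 : (0 : ℝ) ≤ 2 ^ p := by positivity
  nlinarith

lemma integrable_loss_mul (hρ : Continuous ρ) (hρ0 : ∀ u, 0 ≤ ρ u) {p : ℝ} (hp : 0 ≤ p)
    (hgrow : ∀ u, ρ u ≤ 1 + ‖u‖ ^ p) (hφm : Measurable φ) (hφ0 : ∀ u, 0 ≤ φ u)
    (hφ : Integrable fun u => (1 + ‖u‖ ^ p) * φ u) (z : Eu d) :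
    Integrable fun u => ρ (u - z) * φ u := by
  refine (hφ.const_mul (1 + 2 ^ p * (1 + ‖z‖ ^ p))).mono' ?_ (ae_of_all _ fun u => ?_)
  · have := hρ.measurable
    exact Measurable.aestronglyMeasurable (by fun_prop)
  · rw [Real.norm_of_nonneg (mul_nonneg (hρ0 _) (hφ0 _)), ← mul_assoc]
    exact mul_le_mul_of_nonneg_right ((hgrow _).trans (rpow_norm_sub_le hp le_rfl)) (hφ0 u)

/-- The risk of a location decision under a convex loss is convex. -/
lemma convexOn_risk (hconv : ConvexOn ℝ Set.univ ρ) (hφ0 : ∀ u, 0 ≤ φ u)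
    (hint : ∀ z, Integrable fun u => ρ (u - z) * φ u) :
    ConvexOn ℝ Set.univ fun z => ∫ u, ρ (u - z) * φ u := by
  refine ⟨convex_univ, fun z _ w _ a b ha hb hab => ?_⟩
  simp only [smul_eq_mul]
  rw [← integral_const_mul, ← integral_const_mul,
    ← integral_add ((hint z).const_mul a) ((hint w).const_mul b)]
  refine integral_mono (hint _) (((hint z).const_mul a).add ((hint w).const_mul b)) fun u => ?_
  have h1 : u - (a • z + b • w) = a • (u - z) + b • (u - w) := by
    have : u = a • u + b • u := by rw [← add_smul, hab, one_smul]
    conv_lhs => rw [this]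
    simp only [smul_sub]
    abel
  have h2 := hconv.2 (Set.mem_univ (u - z)) (Set.mem_univ (u - w)) ha hb hab
  simp only [smul_eq_mul] at h2
  calc ρ (u - (a • z + b • w)) * φ u ≤ (a * ρ (u - z) + b * ρ (u - w)) * φ u := by
        rw [h1]
        exact mul_le_mul_of_nonneg_right h2 (hφ0 u)
    _ = _ := by ring

/-- A convex function that is larger on a sphere than at its centre has its sublevel set inside the
ball. -/
lemma norm_sub_lt_of_convexOn {Q : Eu d → ℝ} (hQ : ConvexOn ℝ Set.univ Q) {ξ z : Eu d} {ε : ℝ}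
    (hε : 0 < ε) (hs : ∀ w, ‖w - ξ‖ = ε → Q ξ < Q w) (hz : Q z ≤ Q ξ) : ‖z - ξ‖ < ε := by
  by_contra hc
  rw [not_lt] at hc
  have hpos : 0 < ‖z - ξ‖ := hε.trans_le hc
  set t := ε / ‖z - ξ‖
  have ht0 : 0 ≤ t := by positivity
  have ht1 : t ≤ 1 := (div_le_one hpos).2 hc
  have h1 := hQ.2 (Set.mem_univ ξ) (Set.mem_univ z) (sub_nonneg.2 ht1) ht0 (by ring)
  have h2 : (1 - t) • ξ + t • z - ξ = t • (z - ξ) := by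
    rw [sub_smul, one_smul, smul_sub]
    abel
  have h3 := hs ((1 - t) • ξ + t • z) (by
    rw [h2, norm_smul, Real.norm_of_nonneg ht0]
    exact div_mul_cancel₀ _ hpos.ne')
  simp only [smul_eq_mul] at h1
  nlinarith

end ConvexRisk

namespace QuasiBayes

section LTE

variable {Ω : Type*} [MeasurableSpace Ω] {P : Measure Ω} {d : ℕ} {B : QuasiBayes Ω d}

lemma Regular.measurable_localDensity (h : B.Regular P) (x : ℕ × Ω) :
    Measurable (B.localDensity x) :=
  (h.measurable_localWeight x).div_const _

/-- Expectations of functions of polynomial growth under the local quasi-posterior and under its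
limit differ by at most a multiple of the total variation of moments distance. -/
lemma Regular.abs_integral_sub_le (h : B.Regular P) {α C : ℝ} (hα : 0 ≤ α) {x : ℕ × Ω}
    (hx : Integrable fun u => (1 + ‖u‖ ^ α) * B.localDensity x u) {f : Eu d → ℝ}
    (hf : Measurable f) (hfC : ∀ u, |f u| ≤ C * (1 + ‖u‖ ^ α)) :
    Integrable (fun u => f u * B.localDensity x u) ∧
    |(∫ u, f u * B.localDensity x u) - ∫ u, f u * limitDensity B.J u| ≤
      C * ∫ u, (1 + ‖u‖ ^ α) * |B.localDensity x u - limitDensity B.J u| := by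
  have hm := h.measurable_localDensity x
  have hm' := (continuous_limitDensity B.J).measurable
  have hl := integrable_rpow_mul_limitDensity h.posDef hα
  have h1 : Integrable fun u => f u * B.localDensity x u := by
    refine (hx.const_mul C).mono' (Measurable.aestronglyMeasurable (by fun_prop))
      (ae_of_all _ fun u => ?_)
    rw [Real.norm_eq_abs, abs_mul, abs_of_nonneg (h.localDensity_nonneg x u), ← mul_assoc]
    exact mul_le_mul_of_nonneg_right (hfC u) (h.localDensity_nonneg x u)
  have h2 : Integrable fun u => f u * limitDensity B.J u := by
    refine (hl.const_mul C).mono' (Measurable.aestronglyMeasurable (by fun_prop))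
      (ae_of_all _ fun u => ?_)
    rw [Real.norm_eq_abs, abs_mul, abs_of_nonneg (limitDensity_nonneg B.J u), ← mul_assoc]
    exact mul_le_mul_of_nonneg_right (hfC u) (limitDensity_nonneg B.J u)
  refine ⟨h1, ?_⟩
  have h3 : Integrable fun u => (1 + ‖u‖ ^ α) * |B.localDensity x u - limitDensity B.J u| := by
    refine (hx.sub hl).abs.congr (ae_of_all _ fun u => ?_)
    simp only [Pi.sub_apply, ← mul_sub]
    rw [abs_mul, abs_of_nonneg (a := 1 + ‖u‖ ^ α) (by positivity)]
  rw [← integral_sub h1 h2, ← integral_const_mul]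
  refine (abs_integral_le_integral_abs).trans ?_
  refine integral_mono (h1.sub h2).abs (h3.const_mul C) fun u => ?_
  simp only [← mul_sub]
  rw [abs_mul, ← mul_assoc]
  exact mul_le_mul_of_nonneg_right (hfC u) (abs_nonneg _)

/-- In local coordinates the Laplace type estimator minimizes a convex risk that converges
uniformly on compact sets to the risk under the normal limit. -/
lemma Regular.tendsto_lte (h : B.Regular P) {ρ : Eu d → ℝ} (hρ0 : ∀ u, 0 ≤ ρ u)
    (hconv : ConvexOn ℝ Set.univ ρ) {p : ℝ} (hp : 0 ≤ p) (hgrow : ∀ u, ρ u ≤ 1 + ‖u‖ ^ p)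
    {ξ : Eu d} (hξ : ∀ z, (∀ y, ∫ u, ρ (u - z) * limitDensity B.J u ≤
      ∫ u, ρ (u - y) * limitDensity B.J u) ↔ z = ξ)
    {θhat : ℕ → Ω → Eu d} (hθ : IsLTE B.Θ B.L B.prior ρ θhat) :
    Tendsto (fun x : ℕ × Ω => √(x.1 : ℝ) • (θhat x.1 x.2 - B.θ₀) - (ξ + B.U x)) (highProb P)
      (𝓝 0) := by
  have hρ : Continuous ρ := continuousOn_univ.1 (hconv.continuousOn isOpen_univ)
  set Q : Eu d → ℝ := fun z => ∫ u, ρ (u - z) * limitDensity B.J u with hQ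
  have hQint := integrable_loss_mul hρ hρ0 hp hgrow (continuous_limitDensity B.J).measurable
    (limitDensity_nonneg B.J) (integrable_rpow_mul_limitDensity h.posDef hp)
  have hQconv : ConvexOn ℝ Set.univ Q := convexOn_risk hconv (limitDensity_nonneg B.J) hQint
  have hQcont : Continuous Q := continuousOn_univ.1 (hQconv.continuousOn isOpen_univ)
  have hmin : ∀ y, Q ξ ≤ Q y := (hξ ξ).2 rfl
  rw [Metric.tendsto_nhds]
  intro ε hε
  -- By compactness the limit risk on a sphere around its unique minimizer is larger by some `η`.
  obtain ⟨η, hη, hsph⟩ : ∃ η : ℝ, 0 < η ∧ ∀ w, ‖w - ξ‖ = ε → Q ξ + η ≤ Q w := by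
    rcases (Metric.sphere ξ ε).eq_empty_or_nonempty with he | hne
    · refine ⟨1, one_pos, fun w hw => ?_⟩
      have : w ∈ Metric.sphere ξ ε := by rwa [mem_sphere_iff_norm]
      rw [he] at this
      exact absurd this (Set.notMem_empty w)
    · obtain ⟨w₀, hw₀, hw₀min⟩ := (isCompact_sphere ξ ε).exists_isMinOn hne hQcont.continuousOn
      have hlt : Q ξ < Q w₀ := by
        refine lt_of_le_of_ne (hmin w₀) fun heq => ?_
        have h1 := (hξ w₀).1 fun y => by
          have := hmin y
          rw [heq] at this
          exact this
        rw [h1, mem_sphere_iff_norm, sub_self, norm_zero] at hw₀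
        exact hε.ne hw₀
      refine ⟨Q w₀ - Q ξ, sub_pos.2 hlt, fun w hw => ?_⟩
      rw [add_sub_cancel]
      exact hw₀min (by rwa [mem_sphere_iff_norm])
  set C := 1 + 2 ^ p * (1 + (‖ξ‖ + ε) ^ p) with hC
  have hC0 : 0 < C := by positivity
  have hlim : Tendsto (fun x => C * ∫ u, (1 + ‖u‖ ^ p) *
      |B.localDensity x u - limitDensity B.J u|) (highProb P) (𝓝 0) := by
    simpa using (h.tendsto_tvm hp).const_mul C
  -- The minimizer of the limit risk has to be an admissible competitor of the estimator.
  have hmem : ∀ᶠ x in highProb P, B.param x ξ ∈ B.Θ := by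
    refine h.tight.eventually fun K => ?_
    have hsmall : Tendsto (fun x : ℕ × Ω => (‖ξ‖ + K) / √(x.1 : ℝ)) (highProb P) (𝓝 0) :=
      tendsto_const_nhds.div_atTop
        (Real.tendsto_sqrt_atTop.comp (tendsto_natCast_atTop_atTop.comp tendsto_fst_highProb))
    obtain ⟨r, hr, hball⟩ := Metric.mem_nhds_iff.1 (mem_interior_iff_mem_nhds.1 h.param.interior)
    filter_upwards [hsmall.eventually_lt_const hr] with x hx hK
    refine hball ?_
    rw [Metric.mem_ball, dist_eq_norm, norm_param_sub]
    refine lt_of_le_of_lt ?_ hx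
    have hK' : ‖B.U x‖ ≤ K := hK
    gcongr
    exact (norm_add_le _ _).trans (by gcongr)
  filter_upwards [hlim.eventually_lt_const (half_pos hη), hmem,
    h.integrable_mul_localDensity hp, tendsto_fst_highProb.eventually_ge_atTop 1]
    with x hx hxΘ hxi hx1
  have hx0 : x.1 ≠ 0 := by omega
  set Qx : Eu d → ℝ := fun z => ∫ u, ρ (u - z) * B.localDensity x u with hQx
  have hQxconv : ConvexOn ℝ Set.univ Qx := convexOn_risk hconv (h.localDensity_nonneg x)
    (integrable_loss_mul hρ hρ0 hp hgrow (h.measurable_localDensity x) (h.localDensity_nonneg x)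
      hxi)
  have hclose : ∀ z, ‖z‖ ≤ ‖ξ‖ + ε → |Qx z - Q z| < η / 2 := by
    intro z hz
    refine lt_of_le_of_lt (h.abs_integral_sub_le hp hxi ?_ fun u => ?_).2 hx
    · have := hρ.measurable
      fun_prop
    · rw [abs_of_nonneg (hρ0 _)]
      exact (hgrow _).trans (rpow_norm_sub_le hp hz)
  have hle := (hθ x.1 x.2).2 _ hxΘ
  rw [quasiRisk_eq h.measurableSet hx0, quasiRisk_eq h.measurableSet hx0,
    sqrt_smul_param_sub hx0, add_sub_cancel_right] at hle
  have hfin := norm_sub_lt_of_convexOn hQxconv hε (fun w hw => ?_) hle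
  · rw [dist_zero_right]
    rw [sub_add_eq_sub_sub_swap]
    exact hfin
  · have h1 := abs_lt.1 (hclose ξ (by linarith))
    have h2 := abs_lt.1 (hclose w (by
      have := norm_add_le (w - ξ) ξ
      rw [sub_add_cancel] at this
      linarith))
    have h3 := hsph w hw
    linarith

/-- The `LTEConclusion` for a regular experiment with asymptotically normal score. -/
theorem Regular.lteConclusion [IsProbabilityMeasure P] (h : B.Regular P)
    {ρ : Eu d → ℝ} (hpen : PenaltyAssumption B.Θ ρ B.prior)
    {S : Matrix (Fin d) (Fin d) ℝ} (hΔ : ∀ n, Measurable (B.Δ n))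
    (hscore : TendstoInLaw P (fun (n : ℕ) ω => matVec (invSqrt S) ((√(n : ℝ))⁻¹ • B.Δ n ω))
      (stdGaussian (Eu d))) :
    LTEConclusion P B.Θ B.θ₀ B.L B.prior ρ B.Δ (fun _ => B.J) (fun _ => S) := by
  set k := √(B.J.det / (2 * Real.pi) ^ d) with hk
  have hk0 : 0 < k := Real.sqrt_pos.2 (by have := h.posDef.det_pos; positivity)
  have hscale : ∀ z, ∫ u, ρ (u - z) * limitDensity B.J u =
      k * ∫ u, ρ (u - z) * Real.exp (-quadForm ((1 / 2 : ℝ) • B.J) u) := by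
    intro z
    rw [← integral_const_mul]
    refine integral_congr_ae (ae_of_all _ fun u => ?_)
    simp only [limitDensity, smul_quadForm]
    rw [neg_mul]
    ring
  obtain ⟨ξ, hξ1, hξ2⟩ := hpen.unique_min ((1 / 2 : ℝ) • B.J)
    (h.posDef.smul (by norm_num : (0 : ℝ) < 1 / 2))
  have hξ : ∀ z, (∀ y, ∫ u, ρ (u - z) * limitDensity B.J u ≤
      ∫ u, ρ (u - y) * limitDensity B.J u) ↔ z = ξ := by
    intro z
    simp_rw [hscale, mul_le_mul_iff_right₀ hk0]
    exact ⟨fun hz => hξ2 z hz, fun hz => hz ▸ hξ1⟩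
  obtain ⟨p, hp1, hgrow⟩ := hpen.growth
  have hp : 0 ≤ p := zero_le_one.trans hp1
  have hlaw : TendstoInLaw P (fun (n : ℕ) ω => matVec (invSqrt S * B.J)
      (centering B.Δ (fun _ => B.J) n ω)) (stdGaussian (Eu d)) := by
    convert hscore using 3 with n ω
    rw [centering, ← matVec_matVec, ← matVec_smul, matVec_matVec B.J,
      Matrix.mul_nonsing_inv _ (isUnit_det_of_posDef h.posDef), matVec_one]
  refine ⟨fun _ => ξ, fun _ => hξ, fun hsymm _ => ?_, hlaw, fun θhat hθ => ?_⟩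
  · have hneg : ∀ z, ∫ u, ρ (u - -z) * limitDensity B.J u =
        ∫ u, ρ (u - z) * limitDensity B.J u := by
      intro z
      conv_lhs => rw [← integral_neg_eq_self]
      refine integral_congr_ae (ae_of_all _ fun u => ?_)
      simp only [limitDensity_neg]
      rw [← hsymm (u - z)]
      congr 2
      abel
    -- The risk is even, so `-ξ` is a minimizer as well.
    have h1 : -ξ = ξ := (hξ (-ξ)).1 fun y => by
      rw [hneg]
      exact (hξ ξ).2 rfl y
    have h2 : (2 : ℝ) • ξ = 0 := by
      rw [two_smul]
      exact eq_neg_iff_add_eq_zero.1 h1.symm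
    exact (smul_eq_zero.1 h2).resolve_left two_ne_zero
  · have hlim := h.tendsto_lte hpen.nonneg hpen.convex hp hgrow hξ hθ
    refine ⟨tendstoInMeasure_iff_highProb.2 hlim, ?_⟩
    refine hlaw.of_sub_tendsto (fun n => ?_) ?_ ?_
    · refine (continuous_matVec _).measurable.comp ?_
      have hm : Measurable fun ω => matVec B.J⁻¹ (B.Δ n ω) :=
        (continuous_matVec _).measurable.comp (hΔ n)
      exact hm.const_smul ((√(n : ℝ))⁻¹)
    · refine h.tight.mono fun K => ⟨‖matVecL (invSqrt S * B.J)‖ * K, Eventually.of_forall ?_⟩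
      intro x hx
      refine (norm_matVec_le _ _).trans ?_
      have hx' : ‖B.U x‖ ≤ K := hx
      exact mul_le_mul_of_nonneg_left hx' (norm_nonneg _)
    · have h2 := ((continuous_matVec (invSqrt S * B.J)).tendsto 0).comp hlim
      have h3 : matVec (invSqrt S * B.J) (0 : Eu d) = 0 := (matVecL _).map_zero
      rw [h3] at h2
      refine h2.congr fun x => ?_
      simp only [Function.comp]
      rw [← matVecL_apply, ← matVecL_apply, ← matVecL_apply, ← map_sub, U]
      congr 1
      abel

end LTE

end QuasiBayes

/-! ### Posterior moments, the delta method and coverage of intervals -/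

section Matrices

variable {ι : Type*} {l : Filter ι} {d : ℕ}

lemma tendsto_matrix_iff {A : ι → Matrix (Fin d) (Fin d) ℝ} {B : Matrix (Fin d) (Fin d) ℝ} :
    Tendsto A l (𝓝 B) ↔ ∀ i j, Tendsto (fun x => A x i j) l (𝓝 (B i j)) := by
  refine ⟨fun h i j => ?_, fun h => ?_⟩
  · exact ((continuous_id.matrix_elem i j).tendsto B).comp h
  · exact tendsto_pi_nhds.2 fun i => tendsto_pi_nhds.2 fun j => h i j

lemma matTendstoInProb_iff {Ω : Type*} [MeasurableSpace Ω] {P : Measure Ω}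
    {A : ℕ → Ω → Matrix (Fin d) (Fin d) ℝ} {B : Matrix (Fin d) (Fin d) ℝ} :
    MatTendstoInProb P A B ↔ Tendsto (fun x : ℕ × Ω => A x.1 x.2) (highProb P) (𝓝 B) :=
  (forall₂_congr fun i j =>
    tendstoInMeasure_iff_highProb (X := fun n ω => A n ω i j)).trans tendsto_matrix_iff.symm

lemma tendsto_euclidean {X : ι → Eu d} {c : Eu d}
    (h : ∀ i, Tendsto (fun x => X x i) l (𝓝 (c i))) : Tendsto X l (𝓝 c) :=
  ((PiLp.continuous_toLp 2 fun _ : Fin d => ℝ).tendsto c.ofLp).comp (tendsto_pi_nhds.2 h)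

lemma Filter.Tendsto.quadForm {A : ι → Matrix (Fin d) (Fin d) ℝ} {B : Matrix (Fin d) (Fin d) ℝ}
    {X : ι → Eu d} {c : Eu d} (hA : Tendsto A l (𝓝 B)) (hX : Tendsto X l (𝓝 c)) :
    Tendsto (fun x => _root_.quadForm (A x) (X x)) l (𝓝 (_root_.quadForm B c)) := by
  have hc : Continuous fun p : Matrix (Fin d) (Fin d) ℝ × Eu d => _root_.quadForm p.1 p.2 := by
    unfold _root_.quadForm
    fun_prop
  exact (hc.tendsto (B, c)).comp (hA.prodMk_nhds hX)

lemma tendsto_of_mul_inv_tendsto_one {A : ι → Matrix (Fin d) (Fin d) ℝ}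
    {S : Matrix (Fin d) (Fin d) ℝ} (hS : S.PosDef) (h : Tendsto (fun x => A x * S⁻¹) l (𝓝 1)) :
    Tendsto A l (𝓝 S) := by
  have h1 := h.mul_const S
  rw [one_mul] at h1
  refine h1.congr fun x => ?_
  rw [Matrix.mul_assoc, Matrix.nonsing_inv_mul _ (isUnit_det_of_posDef hS), Matrix.mul_one]

lemma tendsto_inv_mul_one {A : ι → Matrix (Fin d) (Fin d) ℝ}
    {J : Matrix (Fin d) (Fin d) ℝ} (hJ : J.PosDef) (h : Tendsto A l (𝓝 J⁻¹)) :
    Tendsto (fun x => (A x)⁻¹ * J⁻¹) l (𝓝 1) := by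
  have hu := isUnit_det_of_posDef hJ.inv
  have h1 : Tendsto (fun x => (A x)⁻¹) l (𝓝 (J⁻¹)⁻¹) := by
    refine Tendsto.comp (continuousAt_matrix_inv J⁻¹ ?_) h
    exact NormedRing.inverse_continuousAt hu.unit
  have h2 := h1.mul_const J⁻¹
  rwa [Matrix.nonsing_inv_mul _ hu] at h2

end Matrices

section Gradient

variable {d : ℕ} {g : Eu d → ℝ} {Θ : Set (Eu d)} {θ₀ : Eu d}

lemma hasGradientAt_of_contDiffOn (hg : ContDiffOn ℝ 1 g Θ) (hθ : θ₀ ∈ interior Θ) :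
    HasGradientAt g (gradient g θ₀) θ₀ :=
  ((hg.contDiffAt (mem_interior_iff_mem_nhds.1 hθ)).differentiableAt one_ne_zero).hasGradientAt

lemma continuousAt_gradient (hg : ContDiffOn ℝ 1 g Θ) (hθ : θ₀ ∈ interior Θ) :
    ContinuousAt (gradient g) θ₀ :=
  (InnerProductSpace.toDual ℝ (Eu d)).symm.continuous.continuousAt.comp
    ((hg.contDiffAt (mem_interior_iff_mem_nhds.1 hθ)).continuousAt_fderiv one_ne_zero)

/-- A differentiable function is linear in local coordinates, uniformly on bounded sets. -/
lemma HasGradientAt.eventually_local {a : Eu d} (hg : HasGradientAt g a θ₀) (R : ℝ) {ε : ℝ}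
    (hε : 0 < ε) : ∀ᶠ n : ℕ in atTop, ∀ θ, ‖√(n : ℝ) • (θ - θ₀)‖ ≤ R →
      |√(n : ℝ) * (g θ - g θ₀) - inner ℝ a (√(n : ℝ) • (θ - θ₀))| ≤ ε := by
  have hR : 0 < |R| + 1 := by positivity
  have h1 := (hasGradientAt_iff_isLittleO.1 hg).def (div_pos hε hR)
  obtain ⟨δ, hδ, hball⟩ := Metric.eventually_nhds_iff.1 h1
  have hlarge := (Real.tendsto_sqrt_atTop.comp tendsto_natCast_atTop_atTop).eventually_gt_atTop
    ((|R| + 1) / δ)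
  filter_upwards [hlarge] with n hn θ hθ
  have hs : 0 < √(n : ℝ) := lt_trans (by positivity) hn
  rw [norm_smul, Real.norm_of_nonneg hs.le] at hθ
  have hlt : √(n : ℝ) * ‖θ - θ₀‖ ≤ |R| + 1 := hθ.trans ((le_abs_self R).trans (by linarith))
  have h2 : dist θ θ₀ < δ := by
    rw [dist_eq_norm]
    have hn' : |R| + 1 < √(n : ℝ) * δ := (div_lt_iff₀ hδ).1 hn
    exact lt_of_mul_lt_mul_left (hlt.trans_lt hn') hs.le
  have h3 := hball h2
  rw [Real.norm_eq_abs] at h3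
  rw [inner_smul_right, ← mul_sub, abs_mul, abs_of_pos hs]
  calc √(n : ℝ) * |g θ - g θ₀ - inner ℝ a (θ - θ₀)|
      ≤ √(n : ℝ) * (ε / (|R| + 1) * ‖θ - θ₀‖) := by gcongr
    _ = ε / (|R| + 1) * (√(n : ℝ) * ‖θ - θ₀‖) := by ring
    _ ≤ ε / (|R| + 1) * (|R| + 1) := by gcongr
    _ = ε := div_mul_cancel₀ _ hR.ne'

end Gradient

namespace QuasiBayes

section Inference

variable {Ω : Type*} [MeasurableSpace Ω] {P : Measure Ω} {d : ℕ} {B : QuasiBayes Ω d}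

lemma Regular.tendsto_integral_mul (h : B.Regular P) {α C : ℝ} (hα : 0 ≤ α) {f : Eu d → ℝ}
    (hf : Measurable f) (hfC : ∀ u, |f u| ≤ C * (1 + ‖u‖ ^ α)) :
    Tendsto (fun x => ∫ u, f u * B.localDensity x u) (highProb P)
      (𝓝 (∫ u, f u * limitDensity B.J u)) := by
  rw [tendsto_iff_norm_sub_tendsto_zero]
  have hlim := (h.tendsto_tvm hα).const_mul C
  rw [mul_zero] at hlim
  refine squeeze_zero' (Eventually.of_forall fun x => norm_nonneg _) ?_ hlim
  filter_upwards [h.integrable_mul_localDensity hα] with x hx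
  exact (h.abs_integral_sub_le hα hx hf hfC).2

lemma abs_coord_le (u : Eu d) (i : Fin d) : |u i| ≤ 1 * (1 + ‖u‖ ^ (1 : ℝ)) := by
  have := PiLp.norm_apply_le u i
  rw [Real.norm_eq_abs] at this
  rw [Real.rpow_one]
  linarith

lemma abs_coord_mul_coord_le (u : Eu d) (i j : Fin d) :
    |u i * u j| ≤ 1 * (1 + ‖u‖ ^ (2 : ℝ)) := by
  have h1 := PiLp.norm_apply_le u i
  have h2 := PiLp.norm_apply_le u j
  rw [Real.norm_eq_abs] at h1 h2
  rw [Real.rpow_two, abs_mul]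
  have := mul_le_mul h1 h2 (abs_nonneg _) (norm_nonneg _)
  nlinarith

/-- The quasi-posterior mean in local coordinates. -/
noncomputable def localMean (B : QuasiBayes Ω d) (x : ℕ × Ω) : Eu d :=
  √(x.1 : ℝ) • (posteriorMean B.Θ B.L B.prior x.1 x.2 - B.θ₀) - B.U x

lemma Regular.localMean_apply (h : B.Regular P) :
    ∀ᶠ x in highProb P, ∀ i, B.localMean x i = ∫ u : Eu d, u i * B.localDensity x u := by
  filter_upwards [h.integrable_mul_localDensity zero_le_one, h.integral_localDensity,
    h.integrable_mul_localDensity le_rfl, tendsto_fst_highProb.eventually_ge_atTop 1]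
    with x hx1 hmass hx0 hn i
  have hn0 : x.1 ≠ 0 := by omega
  have hs : √(x.1 : ℝ) ≠ 0 := (Real.sqrt_pos.2 (by exact_mod_cast Nat.pos_of_ne_zero hn0)).ne'
  have hm := h.measurable_localDensity x
  have hi0 : Integrable (B.localDensity x) := by
    simpa using (h.abs_integral_sub_le le_rfl hx0 (f := fun _ => 1) (C := 1) measurable_const
      (by intro u; simp)).1
  have hi1 : Integrable fun u => B.localDensity x u • u := by
    refine hx1.mono' (Measurable.aestronglyMeasurable (by fun_prop)) (ae_of_all _ fun u => ?_)
    rw [norm_smul, Real.norm_of_nonneg (h.localDensity_nonneg x u), Real.rpow_one, mul_comm]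
    exact mul_le_mul_of_nonneg_right (by linarith) (h.localDensity_nonneg x u)
  have hmean : posteriorMean B.Θ B.L B.prior x.1 x.2 = B.θ₀ + (√(x.1 : ℝ))⁻¹ • B.U x +
      (√(x.1 : ℝ))⁻¹ • ∫ u, B.localDensity x u • u := by
    have h1 := setIntegral_posterior_smul h.measurableSet hn0 fun θ => θ
    have h2 : ∀ u, B.localDensity x u • B.param x u = B.localDensity x u •
        (B.θ₀ + (√(x.1 : ℝ))⁻¹ • B.U x) + (√(x.1 : ℝ))⁻¹ • (B.localDensity x u • u) := by
      intro u
      rw [smul_comm (√(x.1 : ℝ))⁻¹ (B.localDensity x u) u, ← smul_add, QuasiBayes.param,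
        smul_add (√(x.1 : ℝ))⁻¹ u, add_comm (_ • u), add_assoc]
    simp_rw [h2] at h1
    have hi2 : Integrable fun u => (√(x.1 : ℝ))⁻¹ • (B.localDensity x u • u) :=
      hi1.smul ((√(x.1 : ℝ))⁻¹)
    rw [integral_add (hi0.smul_const _) hi2, integral_smul, integral_smul_const, hmass,
      one_smul] at h1
    exact h1
  have hloc : B.localMean x = ∫ u, B.localDensity x u • u := by
    rw [localMean, hmean, add_assoc, add_sub_cancel_left, ← smul_add, smul_smul,
      mul_inv_cancel₀ hs, one_smul, add_sub_cancel_left]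
  rw [hloc]
  have := (EuclideanSpace.proj (𝕜 := ℝ) i).integral_comp_comm hi1
  simp only [PiLp.proj_apply, PiLp.smul_apply, smul_eq_mul] at this
  rw [← this]
  simp_rw [mul_comm]

/-- The quasi-posterior mean is asymptotically equivalent to the centering. -/
lemma Regular.tendsto_localMean (h : B.Regular P) : Tendsto B.localMean (highProb P) (𝓝 0) := by
  refine tendsto_euclidean fun i => ?_
  have h1 := h.tendsto_integral_mul zero_le_one (f := fun u => u i) (by fun_prop)
    (fun u => abs_coord_le u i)
  rw [integral_coord_mul_limitDensity] at h1
  refine h1.congr' ?_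
  filter_upwards [h.localMean_apply] with x hx
  exact (hx i).symm

lemma Regular.posteriorVar_apply (h : B.Regular P) :
    ∀ᶠ x in highProb P, ∀ i j, posteriorVar B.Θ B.L B.prior x.1 x.2 i j =
      (∫ u : Eu d, u i * u j * B.localDensity x u) - B.localMean x i * B.localMean x j := by
  filter_upwards [h.localMean_apply, h.integral_localDensity, h.integrable_mul_localDensity le_rfl,
    h.integrable_mul_localDensity zero_le_one, h.integrable_mul_localDensity zero_le_two,
    tendsto_fst_highProb.eventually_ge_atTop 1] with x hmean hmass hx0 hx1 hx2 hn i j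
  have hn0 : x.1 ≠ 0 := by omega
  have hi0 : Integrable (B.localDensity x) := by
    simpa using (h.abs_integral_sub_le le_rfl hx0 (f := fun _ => 1) (C := 1) measurable_const
      (by intro u; simp)).1
  have hi1 (i : Fin d) : Integrable fun u : Eu d => u i * B.localDensity x u :=
    (h.abs_integral_sub_le zero_le_one hx1 (f := fun u => u i) (by fun_prop)
      (fun u => abs_coord_le u i)).1
  have hi2 : Integrable fun u : Eu d => u i * u j * B.localDensity x u :=
    (h.abs_integral_sub_le zero_le_two hx2 (f := fun u => u i * u j) (by fun_prop)
      (fun u => abs_coord_mul_coord_le u i j)).1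
  set m := posteriorMean B.Θ B.L B.prior x.1 x.2 with hm
  -- The deviation from the posterior mean is `u - localMean` in local coordinates.
  have hdev : ∀ u, √(x.1 : ℝ) • (B.param x u - m) = u - B.localMean x := by
    intro u
    have : B.param x u - m = (B.param x u - B.θ₀) - (m - B.θ₀) := by abel
    rw [this, smul_sub, sqrt_smul_param_sub hn0, localMean]
    abel
  have hcoord : ∀ u i, √(x.1 : ℝ) * (B.param x u i - m i) = u i - B.localMean x i := by
    intro u i
    have := congrArg (fun v : Eu d => v i) (hdev u)
    simpa using this
  have h1 := setIntegral_posterior_smul h.measurableSet hn0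
    fun θ => (x.1 : ℝ) * (θ i - m i) * (θ j - m j)
  have h2 : posteriorVar B.Θ B.L B.prior x.1 x.2 i j =
      ∫ θ in B.Θ, B.posterior x θ • ((x.1 : ℝ) * (θ i - m i) * (θ j - m j)) := by
    rw [posteriorVar, Matrix.of_apply]
    simp only [posterior, smul_eq_mul, mul_comm (quasiPosterior _ _ _ _ _ _), hm]
  have h3 : ∀ u, B.localDensity x u • ((x.1 : ℝ) * (B.param x u i - m i) *
      (B.param x u j - m j)) = u i * u j * B.localDensity x u -
        B.localMean x j * (u i * B.localDensity x u) -
        B.localMean x i * (u j * B.localDensity x u) +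
        B.localMean x i * B.localMean x j * B.localDensity x u := by
    intro u
    have hsq : (x.1 : ℝ) * (B.param x u i - m i) * (B.param x u j - m j) =
        (√(x.1 : ℝ) * (B.param x u i - m i)) * (√(x.1 : ℝ) * (B.param x u j - m j)) := by
      have := Real.mul_self_sqrt (Nat.cast_nonneg x.1 : (0 : ℝ) ≤ x.1)
      calc _ = (√(x.1 : ℝ) * √(x.1 : ℝ)) * (B.param x u i - m i) * (B.param x u j - m j) := by
            rw [this]
        _ = _ := by ring
    rw [hsq, hcoord, hcoord, smul_eq_mul]
    ring
  rw [h2, h1]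
  simp_rw [h3]
  have hA := (hi1 i).const_mul (B.localMean x j)
  have hB := (hi1 j).const_mul (B.localMean x i)
  have hC := hi0.const_mul (B.localMean x i * B.localMean x j)
  have hD : Integrable fun u : Eu d => u i * u j * B.localDensity x u -
      B.localMean x j * (u i * B.localDensity x u) := hi2.sub hA
  have hE : Integrable fun u : Eu d => u i * u j * B.localDensity x u -
      B.localMean x j * (u i * B.localDensity x u) -
        B.localMean x i * (u j * B.localDensity x u) := hD.sub hB
  rw [integral_add hE hC, integral_sub hD hB, integral_sub hi2 hA,
    integral_const_mul, integral_const_mul, integral_const_mul, hmass, ← hmean i, ← hmean j]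
  ring

/-- The scaled quasi-posterior variance is consistent for the inverse curvature. -/
lemma Regular.tendsto_posteriorVar (h : B.Regular P) :
    Tendsto (fun x : ℕ × Ω => posteriorVar B.Θ B.L B.prior x.1 x.2) (highProb P) (𝓝 B.J⁻¹) := by
  refine tendsto_matrix_iff.2 fun i j => ?_
  have h1 := h.tendsto_integral_mul zero_le_two (f := fun u => u i * u j) (by fun_prop)
    (fun u => abs_coord_mul_coord_le u i j)
  rw [integral_coord_mul_coord_mul_limitDensity h.posDef] at h1
  have hc (i : Fin d) : Tendsto (fun x => B.localMean x i) (highProb P) (𝓝 0) :=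
    ((EuclideanSpace.proj (𝕜 := ℝ) i).continuous.tendsto 0).comp h.tendsto_localMean
  have h2 := h1.sub ((hc i).mul (hc j))
  rw [mul_zero, sub_zero] at h2
  refine h2.congr' ?_
  filter_upwards [h.posteriorVar_apply] with x hx
  exact (hx i j).symm

/-- An estimator with a linear expansion is consistent. -/
lemma Regular.tendsto_of_expansion (h : B.Regular P) {θhat : ℕ × Ω → Eu d}
    (hθ : Tendsto (fun x => √(x.1 : ℝ) • (θhat x - B.θ₀) - B.U x) (highProb P) (𝓝 0)) :
    Tendsto θhat (highProb P) (𝓝 B.θ₀) := by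
  refine h.tight.tendsto fun K => ?_
  rw [tendsto_iff_norm_sub_tendsto_zero]
  have hsmall : Tendsto (fun x : ℕ × Ω => (1 + K) / √(x.1 : ℝ))
      (highProb P ⊓ 𝓟 {x | ‖B.U x‖ ≤ K}) (𝓝 0) :=
    (tendsto_const_nhds.div_atTop (Real.tendsto_sqrt_atTop.comp
      (tendsto_natCast_atTop_atTop.comp tendsto_fst_highProb))).mono_left inf_le_left
  refine squeeze_zero' (Eventually.of_forall fun x => norm_nonneg _) ?_ hsmall
  have h1 := (Metric.tendsto_nhds.1 hθ 1 one_pos).and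
    (tendsto_fst_highProb.eventually_ge_atTop 1)
  filter_upwards [h1.filter_mono inf_le_left, mem_inf_of_right (mem_principal_self _)]
    with x ⟨hx, hn⟩ hK
  have hs : 0 < √(x.1 : ℝ) := Real.sqrt_pos.2 (by exact_mod_cast hn)
  rw [dist_zero_right] at hx
  have h2 := norm_add_le (√(x.1 : ℝ) • (θhat x - B.θ₀) - B.U x) (B.U x)
  rw [sub_add_cancel, norm_smul, Real.norm_of_nonneg hs.le] at h2
  have hK' : ‖B.U x‖ ≤ K := hK
  rw [le_div_iff₀ hs, mul_comm]
  linarith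

/-- The delta method. -/
lemma Regular.tendsto_delta (h : B.Regular P) {g : Eu d → ℝ} {a : Eu d}
    (hg : HasGradientAt g a B.θ₀) {θhat : ℕ × Ω → Eu d}
    (hθ : Tendsto (fun x => √(x.1 : ℝ) • (θhat x - B.θ₀) - B.U x) (highProb P) (𝓝 0)) :
    Tendsto (fun x => √(x.1 : ℝ) * (g (θhat x) - g B.θ₀) - inner ℝ a (B.U x)) (highProb P)
      (𝓝 0) := by
  have h1 : Tendsto (fun x => √(x.1 : ℝ) * (g (θhat x) - g B.θ₀) -
      inner ℝ a (√(x.1 : ℝ) • (θhat x - B.θ₀))) (highProb P) (𝓝 0) := by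
    rw [Metric.tendsto_nhds]
    intro ε hε
    refine h.tight.eventually fun K => ?_
    filter_upwards [Metric.tendsto_nhds.1 hθ 1 one_pos,
      tendsto_fst_highProb.eventually (hg.eventually_local (1 + K) (half_pos hε))] with x hx hloc hK
    rw [dist_zero_right] at hx ⊢
    have hK' : ‖B.U x‖ ≤ K := hK
    have h2 := norm_add_le (√(x.1 : ℝ) • (θhat x - B.θ₀) - B.U x) (B.U x)
    rw [sub_add_cancel] at h2
    rw [Real.norm_eq_abs]
    exact (hloc _ (by linarith)).trans_lt (half_lt_self hε)
  have h2 : Tendsto (fun x => inner ℝ a (√(x.1 : ℝ) • (θhat x - B.θ₀) - B.U x)) (highProb P)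
      (𝓝 0) := by
    have := ((continuous_const.inner continuous_id : Continuous fun v : Eu d => inner ℝ a v).tendsto
      0).comp hθ
    rwa [inner_zero_right] at this
  have h3 := h1.add h2
  rw [add_zero] at h3
  refine h3.congr fun x => ?_
  rw [inner_sub_right]
  ring

/-- Coverage of an interval for `g₀` whose endpoints are `g₀ + (b' U + q σ + o_p(1)) / √n`, with `q` a
normal quantile and `σ` the asymptotic standard deviation of `b' U`. -/
lemma Regular.tendsto_coverage [IsProbabilityMeasure P] (h : B.Regular P)
    (hΔ : ∀ n, Measurable (B.Δ n)) {S : Matrix (Fin d) (Fin d) ℝ} (hS : S.PosDef)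
    (hlaw : TendstoInLaw P (fun (n : ℕ) ω => (√(n : ℝ))⁻¹ • B.Δ n ω) (multivariateGaussian 0 S))
    {b : Eu d} (hb : b ≠ 0) {g₀ : ℝ} {c₁ c₂ : ℕ → Ω → ℝ} {α : ℝ} (hα : α ∈ Set.Ioo (0 : ℝ) 1)
    (h₁ : Tendsto (fun x : ℕ × Ω => √(x.1 : ℝ) * (c₁ x.1 x.2 - g₀) - inner ℝ b (B.U x))
      (highProb P) (𝓝 (stdNormalQuantile (α / 2) * √(quadForm S (matVec B.J⁻¹ b)))))
    (h₂ : Tendsto (fun x : ℕ × Ω => √(x.1 : ℝ) * (c₂ x.1 x.2 - g₀) - inner ℝ b (B.U x))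
      (highProb P) (𝓝 (stdNormalQuantile (1 - α / 2) * √(quadForm S (matVec B.J⁻¹ b))))) :
    Tendsto (fun n => P {ω | c₁ n ω ≤ g₀ ∧ g₀ ≤ c₂ n ω}) atTop (𝓝 (ENNReal.ofReal (1 - α))) ∧
    Tendsto (fun n => innerProb P {ω | c₁ n ω ≤ g₀ ∧ g₀ ≤ c₂ n ω}) atTop
      (𝓝 (ENNReal.ofReal (1 - α))) := by
  set a := matVec B.J⁻¹ b with ha
  set σ := √(quadForm S a) with hσ
  have hJu := isUnit_det_of_posDef h.posDef
  have ha0 : a ≠ 0 := by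
    intro h0
    have h1 : matVec B.J a = b := by
      rw [ha, matVec_matVec, Matrix.mul_nonsing_inv _ hJu, matVec_one]
    rw [h0, ← matVecL_apply, map_zero] at h1
    exact hb h1.symm
  have hQ : 0 < quadForm S a := hS.quadForm_pos ha0
  have hσ0 : 0 < σ := Real.sqrt_pos.2 hQ
  set T : ℕ → Ω → ℝ := fun n ω => inner ℝ (σ⁻¹ • a) ((√(n : ℝ))⁻¹ • B.Δ n ω) with hT
  -- `T` is the studentized linear functional `b' U / σ`, since `b' J⁻¹ Δ = (J⁻¹ b)' Δ`.
  have hTU : ∀ n ω, inner ℝ b (B.U (n, ω)) = σ * T n ω := by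
    intro n ω
    have hsymm : (B.J⁻¹)ᵀ = B.J⁻¹ := h.posDef.inv.transpose_eq
    simp only [hT, U, centering, inner_smul_left, inner_smul_right, ha,
      ← inner_matVec_of_transpose_eq hsymm]
    simp only [map_inv₀, conj_trivial]
    field_simp
  have hX : ∀ n : ℕ, Measurable fun ω => (√(n : ℝ))⁻¹ • B.Δ n ω := fun n =>
    (hΔ n).const_smul ((√(n : ℝ))⁻¹)
  have hTm : ∀ n, Measurable (T n) := fun n => Measurable.const_inner (hX n)
  have hcont : Continuous fun v : Eu d => inner ℝ (σ⁻¹ • a) v := by fun_prop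
  have hTlaw : ∀ f : BoundedContinuousFunction ℝ ℝ,
      Tendsto (fun n => ∫ ω, f (T n ω) ∂P) atTop (𝓝 (∫ x, f x ∂gaussianReal 0 1)) := by
    intro f
    have h1 := hlaw.tendsto_integral hX (f.compContinuous ⟨_, hcont⟩)
    have h2 := multivariateGaussian_map_inner hS.posSemidef (σ⁻¹ • a)
    have h3 : quadForm S (σ⁻¹ • a) = 1 := by
      rw [quadForm_smul, inv_pow, hσ, Real.sq_sqrt hQ.le, inv_mul_cancel₀ hQ.ne']
    rw [h3, Real.toNNReal_one] at h2
    rw [← h2, integral_map hcont.measurable.aemeasurable f.continuous.aestronglyMeasurable]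
    exact h1
  have hA := (h₂.div_const σ).neg
  have hB := (h₁.div_const σ).neg
  rw [mul_div_cancel_right₀ _ hσ0.ne'] at hA hB
  have key := tendsto_prob_between hTm hTlaw
    (A := fun n ω => -((√(n : ℝ) * (c₂ n ω - g₀) - inner ℝ b (B.U (n, ω))) / σ))
    (B := fun n ω => -((√(n : ℝ) * (c₁ n ω - g₀) - inner ℝ b (B.U (n, ω))) / σ)) hA hB
  rw [stdNormal_symmetric_interval hα] at key
  have hset : ∀ᶠ n : ℕ in atTop,
      {ω | -((√(n : ℝ) * (c₂ n ω - g₀) - inner ℝ b (B.U (n, ω))) / σ) ≤ T n ω ∧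
        T n ω ≤ -((√(n : ℝ) * (c₁ n ω - g₀) - inner ℝ b (B.U (n, ω))) / σ)} =
      {ω | c₁ n ω ≤ g₀ ∧ g₀ ≤ c₂ n ω} := by
    filter_upwards [eventually_ge_atTop 1] with n hn
    have hs : 0 < √(n : ℝ) := Real.sqrt_pos.2 (by exact_mod_cast hn)
    ext ω
    simp only [Set.mem_ofPred_eq, hTU]
    have e1 : -((√(n : ℝ) * (c₂ n ω - g₀) - σ * T n ω) / σ) ≤ T n ω ↔ g₀ ≤ c₂ n ω := by
      rw [sub_div, mul_div_cancel_left₀ _ hσ0.ne', neg_sub, sub_le_self_iff,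
        le_div_iff₀ hσ0, zero_mul, mul_nonneg_iff_of_pos_left hs, sub_nonneg]
    have e2 : T n ω ≤ -((√(n : ℝ) * (c₁ n ω - g₀) - σ * T n ω) / σ) ↔ c₁ n ω ≤ g₀ := by
      rw [sub_div, mul_div_cancel_left₀ _ hσ0.ne', neg_sub, le_sub_self_iff,
        div_le_iff₀ hσ0, zero_mul, mul_nonpos_iff_pos_imp_nonpos]
      constructor
      · intro hh
        linarith [hh.1 hs]
      · intro hh
        exact ⟨fun _ => by linarith, fun _ => hs.le⟩
    rw [e1, e2, and_comm]
  refine ⟨key.1.congr' ?_, key.2.congr' ?_⟩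
  · filter_upwards [hset] with n hn
    rw [hn]
  · filter_upwards [hset] with n hn
    rw [hn]

/-- The `InferenceII` conclusion for a regular experiment with asymptotically normal score. -/
theorem Regular.inferenceII [IsProbabilityMeasure P] (h : B.Regular P)
    (hΔ : ∀ n, Measurable (B.Δ n)) {S : Matrix (Fin d) (Fin d) ℝ} (hS : S.PosDef)
    (hlaw : TendstoInLaw P (fun (n : ℕ) ω => (√(n : ℝ))⁻¹ • B.Δ n ω)
      (multivariateGaussian 0 S)) :
    InferenceII P B.Θ B.θ₀ B.L B.prior (fun _ => B.J) (fun _ => S) := by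
  have hV := h.tendsto_posteriorVar
  refine ⟨matTendstoInProb_iff.2 (tendsto_inv_mul_one h.posDef hV),
    fun Shat hShat g hg hb α hα => ?_⟩
  have hSh : Tendsto (fun x : ℕ × Ω => Shat x.1 x.2) (highProb P) (𝓝 S) := by
    have h1 := matTendstoInProb_iff.1 hShat
    exact tendsto_of_mul_inv_tendsto_one hS h1
  set θbar : ℕ × Ω → Eu d := fun x => posteriorMean B.Θ B.L B.prior x.1 x.2 with hθbar
  have hmean : Tendsto (fun x => √(x.1 : ℝ) • (θbar x - B.θ₀) - B.U x) (highProb P) (𝓝 0) :=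
    h.tendsto_localMean
  have hgrad := (continuousAt_gradient hg h.param.interior).tendsto.comp
    (h.tendsto_of_expansion hmean)
  have hdelta := h.tendsto_delta (hasGradientAt_of_contDiffOn hg h.param.interior) hmean
  have hvar := ((hV.mul hSh).mul hV).quadForm hgrad
  have hlim : quadForm (B.J⁻¹ * S * B.J⁻¹) (gradient g B.θ₀) =
      quadForm S (matVec B.J⁻¹ (gradient g B.θ₀)) := by
    rw [quadForm_eq_inner, quadForm_eq_inner, ← matVec_matVec, ← matVec_matVec,
      inner_matVec_of_transpose_eq h.posDef.inv.transpose_eq]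
  rw [hlim] at hvar
  have hend (β : ℝ) : Tendsto (fun x : ℕ × Ω => √(x.1 : ℝ) *
      (sandwichEndpoint B.Θ B.L B.prior Shat g x.1 x.2 β - g B.θ₀) -
        inner ℝ (gradient g B.θ₀) (B.U x)) (highProb P)
      (𝓝 (stdNormalQuantile β * √(quadForm S (matVec B.J⁻¹ (gradient g B.θ₀))))) := by
    have h1 := hdelta.add (hvar.sqrt.const_mul (stdNormalQuantile β))
    rw [zero_add] at h1
    refine h1.congr' ?_
    filter_upwards [tendsto_fst_highProb.eventually_ge_atTop 1] with x hx
    have hs : √(x.1 : ℝ) ≠ 0 := (Real.sqrt_pos.2 (by exact_mod_cast hx)).ne'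
    rw [sandwichEndpoint]
    simp only [Function.comp]
    field_simp
    ring
  have h₁ := hend (α / 2)
  have h₂ := hend (1 - α / 2)
  have key := h.tendsto_coverage hΔ hS hlaw hb
    (c₁ := fun n ω => sandwichEndpoint B.Θ B.L B.prior Shat g n ω (α / 2))
    (c₂ := fun n ω => sandwichEndpoint B.Θ B.L B.prior Shat g n ω (1 - α / 2)) hα h₁ h₂
  exact key.2

end Inference

end QuasiBayes

/-! ### Quasi-posterior quantiles -/

section NormalQuantile

variable {d : ℕ}

/-- A linear functional of a centred normal vector with standard deviation `σ`, possibly zero, is at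
most `t` with probability greater than `α` if `t > q_α σ`, and less than `α` if `t < q_α σ`. -/
lemma lt_multivariateGaussian_halfSpace {S : Matrix (Fin d) (Fin d) ℝ} (hS : S.PosSemidef)
    (a : Eu d) {α t : ℝ} (hα : α ∈ Set.Ioo (0 : ℝ) 1) :
    (stdNormalQuantile α * √(quadForm S a) < t →
      α < (multivariateGaussian 0 S).real {u | inner ℝ a u ≤ t}) ∧
    (t < stdNormalQuantile α * √(quadForm S a) →
      (multivariateGaussian 0 S).real {u | inner ℝ a u ≤ t} < α) := by
  set q := stdNormalQuantile α with hq
  set σ := √(quadForm S a) with hσ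
  have hσ0 : 0 ≤ σ := Real.sqrt_nonneg _
  have hnn : 0 ≤ quadForm S a := by
    have := hS.dotProduct_mulVec_nonneg a.ofLp
    simpa [quadForm] using this
  have hlaw : (multivariateGaussian 0 S).real {u | inner ℝ a u ≤ t} =
      (gaussianReal 0 1).real {z | σ * z ≤ t} := by
    have h1 := multivariateGaussian_map_inner hS a
    have h2 : (gaussianReal 0 1).map (fun z => σ * z) = gaussianReal 0 (quadForm S a).toNNReal := by
      rw [gaussianReal_map_const_mul, mul_zero, mul_one]
      congr 1
      ext
      simp [hσ, Real.sq_sqrt hnn, Real.coe_toNNReal _ hnn]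
    have hm1 : Measurable fun u : Eu d => inner ℝ a u := by fun_prop
    have hm2 : Measurable fun z : ℝ => σ * z := by fun_prop
    have e1 := map_measureReal_apply (μ := multivariateGaussian 0 S) hm1
      (measurableSet_Iic (a := t))
    have e2 := map_measureReal_apply (μ := gaussianReal 0 1) hm2 (measurableSet_Iic (a := t))
    rw [h1] at e1
    rw [h2] at e2
    exact e1.symm.trans e2
  have hcdf (y : ℝ) : (gaussianReal 0 1).real (Set.Iic y) = cdf (gaussianReal 0 1) y :=
    (cdf_eq_real _ y).symm
  rw [hlaw]
  have hqα : cdf (gaussianReal 0 1) q = α := cdf_stdNormalQuantile hα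
  constructor
  · intro ht
    -- Dividing by `σ + 1` instead of `σ` covers `σ = 0`.
    have hη : 0 < (t - q * σ) / (σ + 1) := div_pos (sub_pos.2 ht) (by positivity)
    set η := (t - q * σ) / (σ + 1) with hη'
    have hησ : η * σ ≤ t - q * σ := by
      have : η * (σ + 1) = t - q * σ := div_mul_cancel₀ _ (by positivity)
      nlinarith
    calc α = cdf (gaussianReal 0 1) q := hqα.symm
      _ < cdf (gaussianReal 0 1) (q + η) := strictMono_cdf_stdNormal (by linarith)
      _ = (gaussianReal 0 1).real (Set.Iic (q + η)) := (hcdf _).symm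
      _ ≤ _ := by
        refine measureReal_mono fun z hz => ?_
        have hz' : z ≤ q + η := hz
        change σ * z ≤ t
        nlinarith
  · intro ht
    have hη : 0 < (q * σ - t) / (σ + 1) := div_pos (sub_pos.2 ht) (by positivity)
    set η := (q * σ - t) / (σ + 1) with hη'
    have hησ : η * σ < q * σ - t := by
      have : η * (σ + 1) = q * σ - t := div_mul_cancel₀ _ (by positivity)
      nlinarith
    calc _ ≤ (gaussianReal 0 1).real (Set.Iic (q - η)) := by
          refine measureReal_mono fun z hz => ?_
          have hz' : σ * z ≤ t := hz
          by_contra hc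
          have hc' : q - η < z := not_le.1 hc
          nlinarith
      _ = cdf (gaussianReal 0 1) (q - η) := hcdf _
      _ < cdf (gaussianReal 0 1) q := strictMono_cdf_stdNormal (by linarith)
      _ = α := hqα

lemma tendsto_measureReal_inter_closedBall (μ : Measure (Eu d)) [IsFiniteMeasure μ]
    (A : Set (Eu d)) :
    Tendsto (fun k : ℕ => μ.real (A ∩ Metric.closedBall 0 k)) atTop (𝓝 (μ.real A)) := by
  have hmono : Monotone fun k : ℕ => A ∩ Metric.closedBall (0 : Eu d) k := fun i j hij =>
    Set.inter_subset_inter_right _ (Metric.closedBall_subset_closedBall (by exact_mod_cast hij))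
  have h1 := tendsto_measure_iUnion_atTop (μ := μ) hmono
  rw [← Set.inter_iUnion, Metric.iUnion_closedBall_nat, Set.inter_univ] at h1
  exact (ENNReal.tendsto_toReal (measure_ne_top μ A)).comp h1

lemma integral_indicator_mul_limitDensity {J : Matrix (Fin d) (Fin d) ℝ} (hJ : J.PosDef)
    {A : Set (Eu d)} (hA : MeasurableSet A) :
    ∫ u, A.indicator 1 u * limitDensity J u = (multivariateGaussian 0 J⁻¹).real A := by
  have := integral_limitDensity_smul hJ (A.indicator (1 : Eu d → ℝ))
  rw [integral_indicator_one hA] at this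
  rw [← this]
  simp_rw [smul_eq_mul, mul_comm]

end NormalQuantile

namespace QuasiBayes

section Quantile

variable {Ω : Type*} [MeasurableSpace Ω] {P : Measure Ω} {d : ℕ} {B : QuasiBayes Ω d}

lemma abs_indicator_one_le (A : Set (Eu d)) (u : Eu d) :
    |A.indicator (1 : Eu d → ℝ) u| ≤ 1 * (1 + ‖u‖ ^ (0 : ℝ)) := by
  by_cases hu : u ∈ A <;> simp [hu]

/-- The quasi-posterior probability of a measurable set `A` of local parameters converges to its
probability under the normal limit. -/
lemma Regular.tendsto_integral_indicator (h : B.Regular P) {A : Set (Eu d)}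
    (hA : MeasurableSet A) :
    Tendsto (fun x => ∫ u, A.indicator 1 u * B.localDensity x u) (highProb P)
      (𝓝 ((multivariateGaussian 0 B.J⁻¹).real A)) := by
  rw [← integral_indicator_mul_limitDensity h.posDef hA]
  exact h.tendsto_integral_mul le_rfl (measurable_one.indicator hA) (abs_indicator_one_le A)

/-- The values of the parameter at which `g` is at most `y`. -/
def sublevel (B : QuasiBayes Ω d) (g : Eu d → ℝ) (y : ℝ) : Set (Eu d) := B.Θ ∩ {θ | g θ ≤ y}

lemma Regular.measurableSet_sublevel (h : B.Regular P) {g : Eu d → ℝ} (hg : ContinuousOn g B.Θ)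
    (y : ℝ) : MeasurableSet (B.sublevel g y) :=
  (hg.preimage_isClosed_of_isClosed h.param.compact.isClosed
    (isClosed_Iic (a := y))).measurableSet

lemma Regular.posteriorCDF_eq (h : B.Regular P) {g : Eu d → ℝ} (hg : ContinuousOn g B.Θ)
    {x : ℕ × Ω} (hx : x.1 ≠ 0) (y : ℝ) :
    posteriorCDF B.Θ B.L B.prior g x.1 x.2 y =
      ∫ u, (B.param x ⁻¹' B.sublevel g y).indicator 1 u * B.localDensity x u := by
  have hm := h.measurableSet_sublevel hg y
  have h1 := setIntegral_posterior_smul h.measurableSet hx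
    ((B.sublevel g y).indicator (1 : Eu d → ℝ))
  have h2 : ∫ θ in B.Θ, B.posterior x θ • (B.sublevel g y).indicator (1 : Eu d → ℝ) θ =
      ∫ θ in B.sublevel g y, B.posterior x θ := by
    have : (fun θ => B.posterior x θ • (B.sublevel g y).indicator (1 : Eu d → ℝ) θ) =
        (B.sublevel g y).indicator (B.posterior x) := by
      ext θ
      by_cases hθ : θ ∈ B.sublevel g y <;> simp [hθ]
    rw [this, setIntegral_indicator hm, sublevel, ← Set.inter_assoc, Set.inter_self]
  rw [h2] at h1
  refine h1.trans (integral_congr_ae (ae_of_all _ fun u => ?_))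
  simp only [smul_eq_mul, mul_comm (B.localDensity x u)]
  rfl

/-- Asymptotic linearity of the quasi-posterior quantiles of a smooth function of the parameter. -/
lemma Regular.tendsto_posteriorQuantile (h : B.Regular P) {g : Eu d → ℝ}
    (hg : ContinuousOn g B.Θ) {a : Eu d} (ha : HasGradientAt g a B.θ₀) {α : ℝ}
    (hα : α ∈ Set.Ioo (0 : ℝ) 1) :
    Tendsto (fun x : ℕ × Ω => √(x.1 : ℝ) *
      (posteriorQuantile B.Θ B.L B.prior g x.1 x.2 α - g B.θ₀) - inner ℝ a (B.U x)) (highProb P)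
      (𝓝 (stdNormalQuantile α * √(quadForm B.J⁻¹ a))) := by
  set τ := stdNormalQuantile α * √(quadForm B.J⁻¹ a) with hτ
  set μ := multivariateGaussian 0 B.J⁻¹ with hμ
  have hS := h.posDef.inv.posSemidef
  have hhalf (t : ℝ) : MeasurableSet {u : Eu d | inner ℝ a u ≤ t} :=
    measurableSet_le (by fun_prop) measurable_const
  rw [Metric.tendsto_nhds]
  intro ε' hε'
  obtain ⟨ε, hε, hεε⟩ : ∃ ε : ℝ, 0 < ε ∧ ε < ε' := ⟨ε' / 2, half_pos hε', half_lt_self hε'⟩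
  -- A ball outside which the limit has too little mass to matter.
  have hupper := (lt_multivariateGaussian_halfSpace hS a (t := τ + ε / 2) hα).1 (by linarith)
  have hlower := (lt_multivariateGaussian_halfSpace hS a (t := τ - ε / 2) hα).2 (by linarith)
  have hballs := tendsto_measureReal_inter_closedBall μ Set.univ
  simp only [Set.univ_inter, probReal_univ] at hballs
  obtain ⟨k, hk1, hk2⟩ := (((tendsto_measureReal_inter_closedBall μ
    {u | inner ℝ a u ≤ τ + ε / 2}).eventually_const_lt hupper).and
    (hballs.eventually_const_lt (u := 1 - (α - μ.real {u : Eu d | inner ℝ a u ≤ τ - ε / 2}))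
      (by linarith))).exists
  have hball : MeasurableSet (Metric.closedBall (0 : Eu d) k) := measurableSet_closedBall
  have hcompl : μ.real (Metric.closedBall (0 : Eu d) k)ᶜ = 1 - μ.real (Metric.closedBall 0 k) :=
    probReal_compl_eq_one_sub hball
  have hlim1 := (h.tendsto_integral_indicator ((hhalf (τ + ε / 2)).inter hball)).eventually_const_lt
    hk1
  have hlim2 := ((h.tendsto_integral_indicator (hhalf (τ - ε / 2))).add
    (h.tendsto_integral_indicator hball.compl)).eventually_lt_const (u := α) (by linarith)
  refine h.tight.eventually fun K => ?_
  filter_upwards [hlim1, hlim2, h.integrable_mul_localDensity le_rfl,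
    tendsto_fst_highProb.eventually (ha.eventually_local (k + K) (half_pos hε)),
    tendsto_fst_highProb.eventually_ge_atTop 1] with x hx1 hx2 hxi hloc hn hK
  have hn0 : x.1 ≠ 0 := by omega
  have hs : 0 < √(x.1 : ℝ) := Real.sqrt_pos.2 (by exact_mod_cast hn)
  have hK' : ‖B.U x‖ ≤ K := hK
  have hint {A : Set (Eu d)} (hA : MeasurableSet A) :
      Integrable fun u => A.indicator 1 u * B.localDensity x u :=
    (h.abs_integral_sub_le le_rfl hxi (measurable_one.indicator hA) (abs_indicator_one_le A)).1
  have hpre (y : ℝ) : MeasurableSet (B.param x ⁻¹' B.sublevel g y) :=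
    (continuous_param x).measurable (h.measurableSet_sublevel hg y)
  have hind0 (A : Set (Eu d)) (u : Eu d) : 0 ≤ A.indicator (1 : Eu d → ℝ) u :=
    Set.indicator_nonneg (fun _ _ => zero_le_one) u
  have hlin {u : Eu d} (hu : u ∈ Metric.closedBall (0 : Eu d) k) :
      |√(x.1 : ℝ) * (g (B.param x u) - g B.θ₀) - (inner ℝ a u + inner ℝ a (B.U x))| ≤ ε / 2 := by
    have h1 := hloc (B.param x u)
    rw [sqrt_smul_param_sub hn0, inner_add_right] at h1
    refine h1 ((norm_add_le _ _).trans (add_le_add ?_ hK'))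
    rwa [mem_closedBall_zero_iff] at hu
  -- The point with local coordinate `s`. On the ball, `g (param u) ≤ y s` amounts to `a' u ≤ s` up to
  -- an error of `ε / 2`.
  set y : ℝ → ℝ := fun s => g B.θ₀ + (inner ℝ a (B.U x) + s) / √(x.1 : ℝ) with hy
  have hle (v s : ℝ) : v ≤ y s ↔ √(x.1 : ℝ) * (v - g B.θ₀) ≤ inner ℝ a (B.U x) + s := by
    rw [hy, ← sub_le_iff_le_add', le_div_iff₀ hs, mul_comm]
  have hge (v s : ℝ) : y s ≤ v ↔ inner ℝ a (B.U x) + s ≤ √(x.1 : ℝ) * (v - g B.θ₀) := by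
    rw [hy, ← le_sub_iff_add_le', div_le_iff₀ hs, mul_comm]
  have hhi : α ≤ posteriorCDF B.Θ B.L B.prior g x.1 x.2 (y (τ + ε)) := by
    rw [h.posteriorCDF_eq hg hn0]
    refine hx1.le.trans (integral_mono (hint ((hhalf _).inter hball)) (hint (hpre _)) fun u => ?_)
    by_cases hΘ : B.param x u ∈ B.Θ
    · refine mul_le_mul_of_nonneg_right ?_ (h.localDensity_nonneg x u)
      by_cases hu : u ∈ {u | inner ℝ a u ≤ τ + ε / 2} ∩ Metric.closedBall (0 : Eu d) k
      · have hu1 : inner ℝ a u ≤ τ + ε / 2 := hu.1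
        have hu2 := (abs_le.1 (hlin hu.2)).2
        have hmem : u ∈ B.param x ⁻¹' B.sublevel g (y (τ + ε)) :=
          ⟨hΘ, (hle _ _).2 (by linarith)⟩
        rw [Set.indicator_of_mem hu, Set.indicator_of_mem hmem]
      · rw [Set.indicator_of_notMem hu]
        exact hind0 _ u
    · have : B.localDensity x u = 0 := by
        rw [localDensity, localWeight, weight, Set.indicator_of_notMem hΘ, zero_div]
      simp [this]
  have hlo : posteriorCDF B.Θ B.L B.prior g x.1 x.2 (y (τ - ε)) < α := by
    rw [h.posteriorCDF_eq hg hn0]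
    refine lt_of_le_of_lt ?_ hx2
    rw [← integral_add (hint (hhalf _)) (hint hball.compl)]
    refine integral_mono (hint (hpre _)) ((hint (hhalf _)).add (hint hball.compl)) fun u => ?_
    simp only [← add_mul]
    refine mul_le_mul_of_nonneg_right ?_ (h.localDensity_nonneg x u)
    by_cases hu : u ∈ Metric.closedBall (0 : Eu d) k
    · refine le_add_of_le_of_nonneg ?_ (hind0 _ u)
      by_cases hmem : u ∈ B.param x ⁻¹' B.sublevel g (y (τ - ε))
      · have hu1 := (hle _ _).1 hmem.2
        have hu2 := (abs_le.1 (hlin hu)).1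
        have hu3 : u ∈ {u | inner ℝ a u ≤ τ - ε / 2} :=
          show inner ℝ a u ≤ τ - ε / 2 by linarith
        rw [Set.indicator_of_mem hu3, Set.indicator_of_mem hmem]
      · rw [Set.indicator_of_notMem hmem]
        exact hind0 _ u
    · refine le_add_of_nonneg_of_le (hind0 _ u) ?_
      rw [Set.indicator_of_mem (s := (Metric.closedBall (0 : Eu d) k)ᶜ) hu]
      exact Set.indicator_le_self' (fun _ _ => zero_le_one) u
  have hmono : ∀ v w, v ≤ w → posteriorCDF B.Θ B.L B.prior g x.1 x.2 v ≤
      posteriorCDF B.Θ B.L B.prior g x.1 x.2 w := by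
    intro v w hvw
    rw [h.posteriorCDF_eq hg hn0, h.posteriorCDF_eq hg hn0]
    refine integral_mono (hint (hpre _)) (hint (hpre _)) fun u => ?_
    refine mul_le_mul_of_nonneg_right ?_ (h.localDensity_nonneg x u)
    refine Set.indicator_le_indicator_of_subset (fun u hu => ?_) (fun _ => zero_le_one) u
    exact ⟨hu.1, le_trans (show g _ ≤ v from hu.2) hvw⟩
  have hlb : ∀ v ∈ {v : ℝ | α ≤ posteriorCDF B.Θ B.L B.prior g x.1 x.2 v}, y (τ - ε) ≤ v := by
    intro v hv
    by_contra hc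
    exact absurd ((show α ≤ _ from hv).trans (hmono _ _ (not_le.1 hc).le)) (not_le.2 hlo)
  -- The quantile is the infimum of a set that contains `y (τ + ε)` and is bounded below by
  -- `y (τ - ε)`.
  have hc1 : posteriorQuantile B.Θ B.L B.prior g x.1 x.2 α ≤ y (τ + ε) := csInf_le ⟨_, hlb⟩ hhi
  have hc2 : y (τ - ε) ≤ posteriorQuantile B.Θ B.L B.prior g x.1 x.2 α := le_csInf ⟨_, hhi⟩ hlb
  rw [hle] at hc1
  rw [hge] at hc2
  rw [Real.dist_eq]
  refine lt_of_le_of_lt (abs_le.2 ⟨?_, ?_⟩) hεε <;> linarith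

/-- The `InferenceI` conclusion for a regular experiment that satisfies the information equality. -/
theorem Regular.inferenceI [IsProbabilityMeasure P] (h : B.Regular P)
    (hΔ : ∀ n, Measurable (B.Δ n))
    (hlaw : TendstoInLaw P (fun (n : ℕ) ω => (√(n : ℝ))⁻¹ • B.Δ n ω)
      (multivariateGaussian 0 B.J)) :
    InferenceI P B.Θ B.θ₀ B.L B.prior B.Δ (fun _ => B.J) := by
  intro g hg
  have hgrad := hasGradientAt_of_contDiffOn hg h.param.interior
  have hquant {β : ℝ} (hβ : β ∈ Set.Ioo (0 : ℝ) 1) :=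
    h.tendsto_posteriorQuantile hg.continuousOn hgrad hβ
  refine ⟨fun θhat hθ α hα => ?_, fun hb α hα => ?_⟩
  · have h1 := tendstoInMeasure_iff_highProb.1 hθ
    set θ' : ℕ × Ω → Eu d := fun x => θhat x.1 x.2 with hθ'
    have h2 : Tendsto (fun x => √(x.1 : ℝ) • (θ' x - B.θ₀) - B.U x) (highProb P) (𝓝 0) := h1
    have h3 := h.tendsto_delta hgrad h2
    have h4 := ((hquant hα).sub h3).sub_const (stdNormalQuantile α *
      √(quadForm B.J⁻¹ (gradient g B.θ₀)))
    rw [sub_zero, sub_self] at h4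
    refine tendstoInMeasure_iff_highProb.2 (h4.congr' ?_)
    filter_upwards [tendsto_fst_highProb.eventually_ge_atTop 1] with x hx
    have hs : √(x.1 : ℝ) ≠ 0 := (Real.sqrt_pos.2 (by exact_mod_cast hx)).ne'
    simp only [hθ']
    field_simp
    ring
  · have hvar : quadForm B.J (matVec B.J⁻¹ (gradient g B.θ₀)) =
        quadForm B.J⁻¹ (gradient g B.θ₀) := by
      rw [quadForm_eq_inner, quadForm_eq_inner, matVec_matVec,
        Matrix.mul_nonsing_inv _ (isUnit_det_of_posDef h.posDef), matVec_one, real_inner_comm]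
    have h₁ := hquant (β := α / 2) ⟨by linarith [hα.1], by linarith [hα.2]⟩
    have h₂ := hquant (β := 1 - α / 2) ⟨by linarith [hα.2], by linarith [hα.1]⟩
    rw [← hvar] at h₁ h₂
    have key := h.tendsto_coverage hΔ h.posDef hlaw hb
      (c₁ := fun n ω => posteriorQuantile B.Θ B.L B.prior g n ω (α / 2))
      (c₂ := fun n ω => posteriorQuantile B.Θ B.L B.prior g n ω (1 - α / 2)) hα h₁ h₂
    exact key.1

end Quantile

end QuasiBayes

/-! ### Method of moments -/

section MethodOfMoments

variable {Ω : Type*} [MeasurableSpace Ω] {P : Measure Ω} {d q : ℕ} {Θ : Set (Eu d)} {θ₀ : Eu d}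

section Model

variable {g : ℕ → Eu d → Ω → Eu q} {f : Eu d → Eu q} {G : Matrix (Fin q) (Fin d) ℝ}
  {Wn : ℕ → Eu d → Ω → Matrix (Fin q) (Fin q) ℝ} {W : Eu d → Matrix (Fin q) (Fin q) ℝ}

lemma sqrt_inv_smul_linScore {Ω : Type*} {g : ℕ → Eu d → Ω → Eu q}
    (A : Matrix (Fin d) (Fin q) ℝ) (n : ℕ) (ω : Ω) :
    (√(n : ℝ))⁻¹ • linScore g A θ₀ n ω = -matVec A (√(n : ℝ) • g n θ₀ ω) := by
  rw [linScore, smul_neg, smul_smul, matVec_smul]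
  congr 2
  rw [inv_mul_eq_div, Real.div_sqrt]

/-- The quasi-Bayesian experiment of a moment model. -/
noncomputable def MomentModel.quasiBayes (Θ : Set (Eu d)) (θ₀ : Eu d) (g : ℕ → Eu d → Ω → Eu q)
    (G : Matrix (Fin q) (Fin d) ℝ) (Wn : ℕ → Eu d → Ω → Matrix (Fin q) (Fin q) ℝ)
    (W : Eu d → Matrix (Fin q) (Fin q) ℝ) (prior : Eu d → ℝ) : QuasiBayes Ω d where
  Θ := Θ
  θ₀ := θ₀
  L := quadCriterion g Wn
  prior := prior
  Δ := linScore g (Gᵀ * W θ₀) θ₀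
  J := Gᵀ * W θ₀ * G

lemma MomentModel.regular (h : MomentModel P Θ θ₀ g f G Wn W) {prior : Eu d → ℝ}
    (hprior : ContinuousOn prior Θ) (hpos : ∃ c : ℝ, 0 < c ∧ ∀ θ ∈ Θ, c ≤ prior θ)
    (hL : ∀ n ω, Measurable fun θ : Θ => quadCriterion g Wn n θ ω) :
    (MomentModel.quasiBayes Θ θ₀ g G Wn W prior).Regular P where
  param := h.param
  prior_continuousOn := hprior
  prior_pos := hpos
  measurable := hL
  posDef := h.curvature
  growth := h.exists_exhausts_criterion
  remainder := fun M ε hε => h.remainder_near M hε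
  tight := by
    refine h.tight.mono fun K => ⟨‖matVecL (Gᵀ * W θ₀ * G)⁻¹‖ * (‖matVecL (Gᵀ * W θ₀)‖ * K),
      Eventually.of_forall fun x hx => ?_⟩
    have hx' : ‖√(x.1 : ℝ) • g x.1 θ₀ x.2‖ ≤ K := hx
    change ‖centering (linScore g (Gᵀ * W θ₀) θ₀) (fun _ => Gᵀ * W θ₀ * G) x.1 x.2‖ ≤ _
    rw [centering, ← matVec_smul, sqrt_inv_smul_linScore]
    refine (norm_matVec_le _ _).trans (mul_le_mul_of_nonneg_left ?_ (norm_nonneg _))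
    rw [norm_neg]
    exact (norm_matVec_le _ _).trans (mul_le_mul_of_nonneg_left hx' (norm_nonneg _))

lemma MomentModel.expansionAssumption (h : MomentModel P Θ θ₀ g f G Wn W)
    {S : Matrix (Fin d) (Fin d) ℝ} (hS : S.PosDef)
    (hscore : TendstoInLaw P (fun (n : ℕ) ω => matVec (invSqrt S)
      ((√(n : ℝ))⁻¹ • linScore g (Gᵀ * W θ₀) θ₀ n ω)) (stdGaussian (Eu d))) :
    ExpansionAssumption P Θ θ₀ (quadCriterion g Wn) (linScore g (Gᵀ * W θ₀) θ₀)
      (fun _ => Gᵀ * W θ₀ * G) (fun _ => S) where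
  score_normal := hscore
  J_posDef := uniformlyPosDef_const h.curvature
  S_posDef := uniformlyPosDef_const hS
  remainder := by
    intro ε hε
    obtain ⟨δ₀, hδ₀, M₀, hM₀, hfar⟩ := h.remainder_far hε
    refine ⟨δ₀, hδ₀, M₀, hM₀, fun δ _ hδ M hM => ⟨?_, ?_⟩⟩
    · refine lt_of_le_of_lt (limsup_le_of_le (by isBoundedDefault) ?_)
        ((ENNReal.ofReal_lt_ofReal_iff hε).2 (half_lt_self hε))
      filter_upwards [hfar] with n hn
      refine (measure_mono ?_).trans hn
      rintro ω ⟨θ, hθ, h1, h2, h3⟩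
      exact ⟨θ, hθ, le_trans (by gcongr) h1, h2.trans hδ, h3⟩
    · have h1 := eventually_highProb.1 (h.remainder_near M hε)
      simp only [not_forall, not_le, exists_prop] at h1
      exact h1.limsup_eq

end Model

/-- Normalization of a normal vector by the inverse square root of its variance. -/
lemma multivariateGaussian_map_invSqrt {S : Matrix (Fin d) (Fin d) ℝ} (hS : S.PosDef) :
    (multivariateGaussian 0 S).map (matVec (invSqrt S)) = stdGaussian (Eu d) := by
  have h1 : invSqrt S * S * (invSqrt S)ᵀ = 1 := by
    rw [transpose_invSqrt]
    have hu := isUnit_det_sqrt hS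
    have h2 : invSqrt S * S * invSqrt S = invSqrt S * (CFC.sqrt S * CFC.sqrt S) * invSqrt S := by
      rw [sqrt_mul_sqrt_of_posDef hS]
    rw [h2, invSqrt, ← Matrix.mul_assoc, Matrix.nonsing_inv_mul _ hu, Matrix.one_mul,
      Matrix.mul_nonsing_inv _ hu]
  rw [multivariateGaussian_map_matVec hS.posSemidef _ (by rw [h1]; exact Matrix.PosSemidef.one), h1]
  exact multivariateGaussian_zero_one

lemma multivariateGaussian_injective {S T : Matrix (Fin d) (Fin d) ℝ} (hS : S.PosSemidef)
    (hT : T.PosSemidef) (h : multivariateGaussian 0 S = multivariateGaussian 0 T) : S = T := by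
  ext i j
  rw [← covariance_eval_multivariateGaussian (μ := 0) hS i j, h,
    covariance_eval_multivariateGaussian hT]

/-- The moment conditions make up a moment model in the sense of `MomentModel`. -/
lemma momentModel_of_moments {m : ℕ → Eu d → Ω → Eu q}
    {Wn : ℕ → Eu d → Ω → Matrix (Fin q) (Fin q) ℝ} {W : Eu d → Matrix (Fin q) (Fin q) ℝ}
    {G : Eu d → Matrix (Fin q) (Fin d) ℝ} (hparam : ParameterAssumption Θ θ₀)
    (hstat : ∀ θ ∈ Θ, IsStationaryErgodic P fun i => m i θ)
    (hint : ∀ i, ∀ θ ∈ Θ, Integrable (m i θ) P)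
    (hident : ∀ i, ∀ θ ∈ Θ, ∫ ω, m i θ ω ∂P = 0 ↔ θ = θ₀)
    (hWn : ∀ ε : ℝ, 0 < ε → Tendsto
      (fun n : ℕ => P {ω | ∃ θ ∈ Θ, ∃ a b, ε < |Wn n θ ω a b - W θ a b|}) atTop (𝓝 0))
    (hWpos : ∀ θ ∈ Θ, (W θ).PosDef) (hWcont : ContinuousOn W Θ)
    (hG : ∀ i, ∀ θ ∈ Θ, HasFDerivWithinAt (fun t => ∫ ω, m i t ω ∂P)
      (LinearMap.toContinuousLinearMap (Matrix.toEuclideanLin (G θ))) Θ θ)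
    (hJ : (gmmJ W G θ₀).PosDef)
    (htight : BoundedInProb P fun (n : ℕ) ω => √(n : ℝ) • sampleMoment m n θ₀ ω)
    (hequi : ∀ ε : ℝ, 0 < ε → ∃ δ : ℝ, 0 < δ ∧
      limsup (fun n : ℕ => P {ω | ∃ θ ∈ Θ, ∃ θ' ∈ Θ, ‖θ - θ'‖ ≤ δ ∧
        ε < √(n : ℝ) * ‖(sampleMoment m n θ ω - sampleMoment m n θ' ω) -
              ((∫ ω', sampleMoment m n θ ω' ∂P) - ∫ ω', sampleMoment m n θ' ω' ∂P)‖ /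
            (1 + √(n : ℝ) * ‖θ - θ'‖)}) atTop < ENNReal.ofReal ε) :
    MomentModel P Θ θ₀ (sampleMoment m) (fun θ => ∫ ω, m 0 θ ω ∂P) (G θ₀) Wn W where
  param := hparam
  continuousOn := fun θ hθ => (hG 0 θ hθ).continuousWithinAt
  eq_zero_iff := hident 0
  hasFDerivAt := (hG 0 θ₀ (interior_subset hparam.interior)).hasFDerivAt
    (mem_interior_iff_mem_nhds.1 hparam.interior)
  curvature := hJ
  weight_posDef := hWpos
  weight_continuousOn := hWcont
  weight_tendsto := by
    intro ε hε
    rw [eventually_highProb]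
    simpa only [not_forall, not_le, exists_prop] using hWn ε hε
  equicontinuous := by
    intro ε hε
    obtain ⟨δ, hδ, hlim⟩ := hequi ε hε
    refine ⟨δ, hδ, ?_⟩
    filter_upwards [eventually_lt_of_limsup_lt hlim, eventually_ge_atTop 1] with n hn hn1
    refine (measure_mono ?_).trans hn.le
    intro ω hω
    by_contra hc
    refine hω fun θ hθ θ' hθ' hd => ?_
    change √(n : ℝ) * ‖(sampleMoment m n θ ω - sampleMoment m n θ' ω) -
      ((∫ ω', m 0 θ ω' ∂P) - ∫ ω', m 0 θ' ω' ∂P)‖ ≤ ε * (1 + √(n : ℝ) * ‖θ - θ'‖)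
    rw [← integral_sampleMoment (hstat θ hθ) (fun i => hint i θ hθ) (by omega : n ≠ 0),
      ← integral_sampleMoment (hstat θ' hθ') (fun i => hint i θ' hθ') (by omega : n ≠ 0)]
    by_contra hlt
    refine hc ⟨θ, hθ, θ', hθ', hd, ?_⟩
    rw [lt_div_iff₀ (by positivity)]
    exact not_le.1 hlt
  tight := htight.exhausts

/-- If the weight is the inverse of the limiting variance of the normalized moments, the limiting
variance of the score equals the curvature. -/
lemma score_variance_eq_curvature {m : ℕ → Eu d → Ω → Eu q}
    {W : Eu d → Matrix (Fin q) (Fin q) ℝ} {G : Eu d → Matrix (Fin q) (Fin d) ℝ}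
    {S : Matrix (Fin d) (Fin d) ℝ} {V : Matrix (Fin q) (Fin q) ℝ}
    (hS : S.PosDef) (hW : (W θ₀).PosDef) (hJ : (gmmJ W G θ₀).PosDef)
    (hscore : TendstoInLaw P (fun (n : ℕ) ω => (√(n : ℝ))⁻¹ • gmmScore m W G θ₀ n ω)
      (multivariateGaussian 0 S)) (hWV : W θ₀ = V⁻¹)
    (hmom : TendstoInLaw P (fun (n : ℕ) ω => √(n : ℝ) • sampleMoment m n θ₀ ω)
      (multivariateGaussian 0 V)) :
    S = gmmJ W G θ₀ := by
  have hu : IsUnit V.det := by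
    rw [← Matrix.isUnit_nonsing_inv_det_iff, ← hWV]
    exact isUnit_det_of_posDef hW
  have hV : V.PosDef := by
    rw [← Matrix.nonsing_inv_nonsing_inv V hu, ← hWV]
    exact hW.inv
  set A := (G θ₀)ᵀ * W θ₀ with hA
  have hvar : -A * V * (-A)ᵀ = gmmJ W G θ₀ := by
    have h1 : W θ₀ * V = 1 := by rw [hWV, Matrix.nonsing_inv_mul _ hu]
    rw [Matrix.transpose_neg, Matrix.neg_mul, Matrix.neg_mul, Matrix.mul_neg, neg_neg,
      hA, Matrix.transpose_mul,
      Matrix.transpose_transpose, hW.transpose_eq, Matrix.mul_assoc _ (W θ₀) V, h1,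
      Matrix.mul_one, ← Matrix.mul_assoc, gmmJ]
  have h1 := hmom.comp_continuous (continuous_matVec (-A))
  rw [multivariateGaussian_map_matVec hV.posSemidef _ (by rw [hvar]; exact hJ.posSemidef),
    hvar] at h1
  have h2 : (fun (n : ℕ) ω => (√(n : ℝ))⁻¹ • gmmScore m W G θ₀ n ω) =
      fun (n : ℕ) ω => matVec (-A) (√(n : ℝ) • sampleMoment m n θ₀ ω) := by
    ext1 n
    ext1 ω
    refine (sqrt_inv_smul_linScore A n ω).trans ?_
    simp [matVec, Matrix.neg_mulVec]
  rw [h2] at hscore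
  exact multivariateGaussian_injective hS.posSemidef hJ.posSemidef (hscore.unique h1)

end MethodOfMoments

theorem proposition1 {Ω : Type*} [MeasurableSpace Ω] (P : Measure Ω) [IsProbabilityMeasure P]
    {d q : ℕ} (Θ : Set (Eu d)) (θ₀ : Eu d) (ρ prior : Eu d → ℝ)
    (m : ℕ → Eu d → Ω → Eu q)
    (Wn : ℕ → Eu d → Ω → Matrix (Fin q) (Fin q) ℝ)
    (W : Eu d → Matrix (Fin q) (Fin q) ℝ)
    (G : Eu d → Matrix (Fin q) (Fin d) ℝ)
    (S : Matrix (Fin d) (Fin d) ℝ)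
    -- parameter space, loss function, prior
    (hparam : ParameterAssumption Θ θ₀)
    (hpen : PenaltyAssumption Θ ρ prior)
    -- the criterion is a measurable function of the parameter
    (hL : ∀ n ω, Measurable fun θ : Θ => gmmCriterion m Wn n (θ : Eu d) ω)
    -- stationary and ergodic moment functions, with a mean
    (hstat : ∀ θ ∈ Θ, IsStationaryErgodic P fun i => m i θ)
    (hint : ∀ i, ∀ θ ∈ Θ, Integrable (m i θ) P)
    -- (i) identification, and uniformly consistent, continuous, positive definite weights
    (hident : ∀ i, ∀ θ ∈ Θ, ∫ ω, m i θ ω ∂P = 0 ↔ θ = θ₀)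
    (hWn : ∀ ε : ℝ, 0 < ε → Tendsto
      (fun n : ℕ => P {ω | ∃ θ ∈ Θ, ∃ a b, ε < |Wn n θ ω a b - W θ a b|}) atTop (𝓝 0))
    (hWpos : ∀ θ ∈ Θ, (W θ).PosDef)
    (hWcont : ContinuousOn W Θ)
    -- (ii) continuous derivative of the mean; `J > 0` near `θ₀`, continuous
    (hG : ∀ i, ∀ θ ∈ Θ, HasFDerivWithinAt (fun t => ∫ ω, m i t ω ∂P)
      (LinearMap.toContinuousLinearMap (Matrix.toEuclideanLin (G θ))) Θ θ)
    (hGcont : ContinuousOn G Θ)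
    (hJpos : ∀ᶠ θ in 𝓝 θ₀, (gmmJ W G θ).PosDef)
    (hJcont : ContinuousOn (gmmJ W G) Θ)
    -- (iii) asymptotic normality of the score; the normalized moments at `θ₀` are `O_p(1)`
    (hS : S.PosDef)
    (hscore : TendstoInLaw P (fun (n : ℕ) ω => (√(n : ℝ))⁻¹ • gmmScore m W G θ₀ n ω)
      (multivariateGaussian 0 S))
    (htight : BoundedInProb P fun (n : ℕ) ω => √(n : ℝ) • sampleMoment m n θ₀ ω)
    -- (iv) stochastic equicontinuity
    (hequi : ∀ ε : ℝ, 0 < ε → ∃ δ : ℝ, 0 < δ ∧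
      limsup (fun n : ℕ => P {ω | ∃ θ ∈ Θ, ∃ θ' ∈ Θ, ‖θ - θ'‖ ≤ δ ∧
        ε < √(n : ℝ) * ‖(sampleMoment m n θ ω - sampleMoment m n θ' ω) -
              ((∫ ω', sampleMoment m n θ ω' ∂P) - ∫ ω', sampleMoment m n θ' ω' ∂P)‖ /
            (1 + √(n : ℝ) * ‖θ - θ'‖)}) atTop < ENNReal.ofReal ε) :
    -- the expansion holds with `J_n = J(θ₀)`, `Ω_n = S`, and so do the conclusions that do not
    -- need the information equality
    (ExpansionAssumption P Θ θ₀ (gmmCriterion m Wn) (gmmScore m W G θ₀)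
        (fun _ => gmmJ W G θ₀) (fun _ => S) ∧
      TVMConvergence P Θ θ₀ (gmmCriterion m Wn) prior (gmmScore m W G θ₀)
        (fun _ => gmmJ W G θ₀) ∧
      LTEConclusion P Θ θ₀ (gmmCriterion m Wn) prior ρ (gmmScore m W G θ₀)
        (fun _ => gmmJ W G θ₀) (fun _ => S) ∧
      InferenceII P Θ θ₀ (gmmCriterion m Wn) prior (fun _ => gmmJ W G θ₀) (fun _ => S)) ∧
    -- if the score variance is `G' W G`, the information equality holds, and so does the rest
    (S = gmmJ W G θ₀ →
      InformationEquality (fun _ => gmmJ W G θ₀) (fun _ => S) ∧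
      InferenceI P Θ θ₀ (gmmCriterion m Wn) prior (gmmScore m W G θ₀)
        (fun _ => gmmJ W G θ₀)) ∧
    -- this is so when `W(θ₀)` is the inverse of the long-run variance of the moments and the
    -- normalized moments are asymptotically normal with that variance
    (∀ V : Matrix (Fin q) (Fin q) ℝ, IsLongRunVariance P m θ₀ V → W θ₀ = V⁻¹ →
      TendstoInLaw P (fun (n : ℕ) ω => √(n : ℝ) • sampleMoment m n θ₀ ω)
        (multivariateGaussian 0 V) →
      S = gmmJ W G θ₀ ∧
      InformationEquality (fun _ => gmmJ W G θ₀) (fun _ => S) ∧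
      InferenceI P Θ θ₀ (gmmCriterion m Wn) prior (gmmScore m W G θ₀)
        (fun _ => gmmJ W G θ₀)) := by
  have hJ : (gmmJ W G θ₀).PosDef := hJpos.self_of_nhds
  have hθ₀ : θ₀ ∈ Θ := interior_subset hparam.interior
  have hmodel := momentModel_of_moments hparam hstat hint hident hWn hWpos hWcont hG hJ htight hequi
  have hreg := hmodel.regular hpen.prior_continuous hpen.prior_pos hL
  have hΔ : ∀ n, Measurable (gmmScore m W G θ₀ n) := fun n =>
    (((continuous_matVec _).measurable.comp (measurable_sampleMoment (hstat θ₀ hθ₀) n)).const_smul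
      (n : ℝ)).neg
  have hstd : TendstoInLaw P (fun (n : ℕ) ω =>
      matVec (invSqrt S) ((√(n : ℝ))⁻¹ • gmmScore m W G θ₀ n ω)) (stdGaussian (Eu d)) := by
    rw [← multivariateGaussian_map_invSqrt hS]
    exact hscore.comp_continuous (continuous_matVec _)
  have hinfo : S = gmmJ W G θ₀ →
      InformationEquality (fun _ => gmmJ W G θ₀) (fun _ => S) ∧
      InferenceI P Θ θ₀ (gmmCriterion m Wn) prior (gmmScore m W G θ₀)
        (fun _ => gmmJ W G θ₀) := by
    intro hSJ
    have hscore' : TendstoInLaw P (fun (n : ℕ) ω => (√(n : ℝ))⁻¹ • gmmScore m W G θ₀ n ω)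
        (multivariateGaussian 0 (gmmJ W G θ₀)) := hSJ ▸ hscore
    refine ⟨?_, hreg.inferenceI hΔ hscore'⟩
    simp only [InformationEquality, hSJ, Matrix.mul_nonsing_inv _ (isUnit_det_of_posDef hJ)]
    exact tendsto_const_nhds
  refine ⟨⟨hmodel.expansionAssumption hS hstd, hreg.tvmConvergence, hreg.lteConclusion hpen hΔ hstd,
    hreg.inferenceII hΔ hS hscore⟩, hinfo, fun V _ hWV hmom => ?_⟩
  have hSJ := score_variance_eq_curvature hS (hWpos θ₀ hθ₀) hJ hscore hWV hmom
  exact ⟨hSJ, hinfo hSJ⟩
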